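/- Let $L\ge 0$ be an integer, $0<r_{L+1}<r_L<\dots<r_1$, $\sigma_0=1$, $\sigma_1,\dots,\sigma_L>0$ and $\sigma_{L+1}\ge 0$ (the value $\sigma_{L+1}=0$ is an insulating core). Let $\sigma$ be the conductivity on $\mathbb{R}^3$ equal to $\sigma_0$ for $|x|>r_1$, to $\sigma_j$ for $r_{j+1}<|x|\le r_j$ ($1\le j\le L$), and to $\sigma_{L+1}$ for $|x|<r_{L+1}$. For each $k\ge 0$ let $Y_k^l$ ($-k\le l\le k$) be a basis of the real spherical harmonics of degree $k$, so that the functions $r^kY_k^l$ form a basis of the homogeneous harmonic polynomials of degree $k$ in $x\in\mathbb{R}^3$, $r=|x|$. For a harmonic polynomial $H=H(0)+\sum_{k\ge1}\sum_{l}a_k^l\,r^kY_k^l$ consider the weak solutions $u\in H^1_{\mathrm{loc}}(\mathbb{R}^3)$ of $$\nabla\cdot(\sigma\nabla u)=0\ \text{ in }\mathbb{R}^3,\qquad u(x)-H(x)=O(|x|^{-1})\ \text{ as }|x|\to\infty .\tag{1}$$ The contracted generalized polarization tensors (CGPTs) of $\sigma$ are the coefficients $M_{mk}^{nl}$ ($m,k\ge1$,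 $|n|\le m$, $|l|\le k$) for which, for every such $H$ and every solution $u$ of (1), $$(u-H)(x)=\sum_{m=1}^{\infty}\sum_{n=-m}^{m}\frac{Y_m^n}{(2m+1)\,r^{m+1}}\sum_{k\ge1}\sum_{l=-k}^{k}M_{mk}^{nl}\,a_k^l\qquad(|x|\gg1).\tag{2}$$ A family $(M_{\alpha\beta})$ indexed by pairs of multi-indices is a family of generalized polarization tensors (GPTs) of $\sigma$ if for every harmonic polynomial $H$ and every solution $u$ of (1) $$(u-H)(x)=\sum_{\alpha}\sum_{\beta}\frac{(-1)^{|\alpha|}}{\alpha!\,\beta!}\,\partial^\alpha\Gamma(x)\,M_{\alpha\beta}\,\partial^\beta H(0)\quad(|x|\gg1),\qquad \Gamma(x)=-\frac1{4\pi|x|} .$$ Writing $r^mY_m^n=\sum_{|\alpha|=m}b_\alpha^{n}x^\alpha$ (coefficients depending on $m$ and $n$), $\sigma$ is called GPT-vanishing of order $N$ if it has GPTs and for every family of GPTs $\sum_{|\alpha|=m}\sum_{|\beta|=k}b_\alpha^nb_\beta^lM_{\alpha\beta}=0$ for all $1\le m,k\le N$ and all $|n|\le m$, $|l|\le k$. For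 $k\ge1$ put $\mathbf P^{(k)}=P_{L+1}^{(k)}P_L^{(k)}\cdots P_1^{(k)}=\begin{bmatrix}p_{11}^{(k)}&p_{12}^{(k)}\\p_{21}^{(k)}&p_{22}^{(k)}\end{bmatrix}$, where $$P_j^{(k)}=\frac1{(2k+1)\sigma_j}\begin{bmatrix}k\sigma_{j-1}+(k+1)\sigma_j&(k+1)(\sigma_j-\sigma_{j-1})r_j^{-(2k+1)}\\k(\sigma_j-\sigma_{j-1})r_j^{2k+1}&(k+1)\sigma_{j-1}+k\sigma_j\end{bmatrix},$$ except that, if $\sigma_{L+1}=0$, one takes $P_{L+1}^{(k)}=\begin{bmatrix}0&0\\-k\,r_{L+1}^{2k+1}&k+1\end{bmatrix}$. Then (1) has a solution for every harmonic polynomial $H$, and $p_{22}^{(k)}\ne0$ for all $k\ge 1$. The CGPTs exist and are unique; $M_{mk}^{nl}=0$ unless $m=k$ and $n=l$, and $$M_k:=M_{kk}^{ll}=-(2k+1)\,\frac{p_{21}^{(k)}}{p_{22}^{(k)}}\qquad(k\ge1,\ |l|\le k).$$ Consequently, for every $N$, if $\mathbf P^{(k)}$ is upper triangular (that is, $p_{21}^{(k)}=0$)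 for all $1\le k\le N$, then $\sigma$ is GPT-vanishing of order $N$, and $M_{mk}^{nl}=0$ for all $1\le m,k\le N$ and all $n,l$; in particular $M_k=0$ for all $1\le k\le N$. This holds in particular for $N=L$. -/

import Mathlib

noncomputable section

namespace Gpt

open MeasureTheory

/-- Euclidean three-space. -/
abbrev E3 : Type := EuclideanSpace ℝ (Fin 3)

/-! ### The layered ball -/

/-- The regions `A_0` (exterior), `A_1, …, A_L` (coating layers) and `A_{L+1}` (core). -/
def region (L : ℕ) (r : ℕ → ℝ) (j : ℕ) : Set E3 :=
  if j = 0 then {x | r 1 < ‖x‖}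
  else if j = L + 1 then Metric.ball 0 (r (L + 1))
  else {x | r (j + 1) < ‖x‖ ∧ ‖x‖ ≤ r j}

/-- The conductivity distribution `∑_{j=0}^{L+1} σ_j χ_{A_j}`. -/
def conductivity (L : ℕ) (s r : ℕ → ℝ) (x : E3) : ℝ :=
  ∑ j ∈ Finset.range (L + 2), (region L r j).indicator (fun _ => s j) x

/-! ### The transfer matrices -/

/-- The matrix of the interface `|x| = ρ` with conductivity `sOut` outside and `sIn` inside. -/
def interfaceMatrix (k : ℕ) (sOut sIn ρ : ℝ) : Matrix (Fin 2) (Fin 2) ℝ :=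
  (1 / ((2 * (k : ℝ) + 1) * sIn)) •
    !![(k : ℝ) * sOut + ((k : ℝ) + 1) * sIn,
         ((k : ℝ) + 1) * (sIn - sOut) * (ρ ^ (2 * k + 1))⁻¹;
       (k : ℝ) * (sIn - sOut) * ρ ^ (2 * k + 1),
         ((k : ℝ) + 1) * sOut + (k : ℝ) * sIn]

/-- The matrix of the innermost interface `|x| = ρ` when the core is insulating. -/
def insulatingMatrix (k : ℕ) (ρ : ℝ) : Matrix (Fin 2) (Fin 2) ℝ :=
  !![0, 0; -((k : ℝ) * ρ ^ (2 * k + 1)), (k : ℝ) + 1]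

/-- The product `P_j ⋯ P_1` of the interface matrices. -/
def layerProduct (s r : ℕ → ℝ) (k : ℕ) : ℕ → Matrix (Fin 2) (Fin 2) ℝ
  | 0 => 1
  | j + 1 => interfaceMatrix k (s j) (s (j + 1)) (r (j + 1)) * layerProduct s r k j

/-- The matrix `P^{(k)} = P_{L+1} ⋯ P_1`, with the modified factor `P_{L+1}` when the core is
insulating (`σ_{L+1} = 0`). -/
def transferMatrix (L : ℕ) (s r : ℕ → ℝ) (k : ℕ) : Matrix (Fin 2) (Fin 2) ℝ :=
  (if s (L + 1) = 0 then insulatingMatrix k (r (L + 1))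
    else interfaceMatrix k (s L) (s (L + 1)) (r (L + 1))) * layerProduct s r k L

/-! ### The conductivity problem -/

/-- `g` is the weak (distributional) gradient of `u` on `ℝ³`. -/
def IsWeakGradient (u : E3 → ℝ) (g : E3 → E3) : Prop :=
  ∀ φ : E3 → ℝ, ContDiff ℝ (⊤ : ℕ∞) φ → HasCompactSupport φ →
    ∫ x, u x • gradient φ x = -∫ x, φ x • g x

/-- `u` is a weak solution of `∇ · (σ ∇u) = 0` in `ℝ³` in the class `H¹_loc`, with
`u - H = O(|x|⁻¹)` at infinity. Since `u` matters only up to null sets, so does the bound.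
Where `σ` vanishes the equation encodes the homogeneous Neumann condition on the boundary of
the insulated region. -/
def IsSolution (σ H u : E3 → ℝ) : Prop :=
  (∃ g : E3 → E3,
    (∀ K : Set E3, IsCompact K →
      MemLp u 2 (volume.restrict K) ∧ MemLp g 2 (volume.restrict K)) ∧
    IsWeakGradient u g ∧
    ∀ φ : E3 → ℝ, ContDiff ℝ (⊤ : ℕ∞) φ → HasCompactSupport φ →
      ∫ x, σ x * inner ℝ (g x) (gradient φ x) = 0) ∧
  ∃ C R : ℝ, ∀ᵐ x : E3, R < ‖x‖ → |u x - H x| ≤ C / ‖x‖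

/-! ### Harmonic polynomials and spherical harmonics -/

/-- The Laplacian on polynomials in three variables. -/
def polyLaplacian : MvPolynomial (Fin 3) ℝ →ₗ[ℝ] MvPolynomial (Fin 3) ℝ :=
  ∑ i : Fin 3, (MvPolynomial.pderiv i).toLinearMap ∘ₗ (MvPolynomial.pderiv i).toLinearMap

/-- A polynomial as a function on `ℝ³`. -/
def polyFun (p : MvPolynomial (Fin 3) ℝ) (x : E3) : ℝ :=
  MvPolynomial.eval (fun i => x i) p

/-- The solid harmonics of degree `k`: homogeneous harmonic polynomials of degree `k`. Their
restrictions to the unit sphere are the spherical harmonics of degree `k`. -/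
def solidHarmonics (k : ℕ) : Submodule ℝ (MvPolynomial (Fin 3) ℝ) :=
  MvPolynomial.homogeneousSubmodule (Fin 3) ℝ k ⊓ LinearMap.ker polyLaplacian

/-- The orders `l = -k, …, k` of the spherical harmonics of degree `k`. -/
abbrev Order (k : ℕ) : Type := Finset.Icc (-(k : ℤ)) (k : ℤ)

/-- A system of spherical harmonics: for each degree `k` a basis `Y_k^l`, `-k ≤ l ≤ k`. The basis
vector is the solid harmonic `r^k Y_k^l`. -/
abbrev HarmonicSystem : Type := (k : ℕ) → Module.Basis (Order k) ℝ (solidHarmonics k)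

/-- The spherical harmonic `Y_k^l` as a function of the direction `x / |x|`. -/
def sphericalHarmonic (Y : HarmonicSystem) (k : ℕ) (l : Order k) (x : E3) : ℝ :=
  polyFun (Y k l : MvPolynomial (Fin 3) ℝ) (‖x‖⁻¹ • x)

/-- The harmonic polynomial `c + ∑_{k=1}^K ∑_{l=-k}^k a_k^l r^k Y_k^l`. -/
def background (Y : HarmonicSystem) (c : ℝ) (K : ℕ) (a : (k : ℕ) → Order k → ℝ) :
    MvPolynomial (Fin 3) ℝ :=
  MvPolynomial.C c +
    ∑ k ∈ Finset.Icc 1 K, ∑ l : Order k, a k l • (Y k l : MvPolynomial (Fin 3) ℝ)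

/-! ### Contracted GPTs as coefficients of the multipole expansion -/

/-- The family `M m n k l` (standing for `M_{mk}^{nl}`) consists of the contracted GPTs of `σ` in
the normalization of the far-field expansion
`(u - H)(x) = ∑_{m ≥ 1} ∑_n Y_m^n / ((2m+1) r^{m+1}) ∑_{k ≥ 1} ∑_l M_{mk}^{nl} a_k^l`
for `|x|` large, where `H = H(0) + ∑_{k ≥ 1} ∑_l a_k^l r^k Y_k^l`. Entries with `m = 0` or
`k = 0` play no role. -/
def IsCGPT (σ : E3 → ℝ) (Y : HarmonicSystem)
    (M : (m : ℕ) → Order m → (k : ℕ) → Order k → ℝ) : Prop :=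
  ∀ (c : ℝ) (K : ℕ) (a : (k : ℕ) → Order k → ℝ) (u : E3 → ℝ),
    IsSolution σ (polyFun (background Y c K a)) u →
    ∃ R : ℝ, ∀ᵐ x : E3, R < ‖x‖ →
      HasSum (fun i : ℕ => ∑ n : Order (i + 1),
          sphericalHarmonic Y (i + 1) n x /
              ((2 * ((i + 1 : ℕ) : ℝ) + 1) * ‖x‖ ^ ((i + 1) + 1)) *
            ∑ k ∈ Finset.Icc 1 K, ∑ l : Order k, M (i + 1) n k l * a k l)
        (u x - polyFun (background Y c K a) x)

/-! ### GPTs and GPT-vanishing structures -/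

/-- The fundamental solution `|x|^{2-d} / ((2-d) ω_d)` of the Laplacian for `d = 3`, `ω_3 = 4π`. -/
def fundSol (x : E3) : ℝ := 1 / ((2 - 3) * (4 * Real.pi)) * ‖x‖⁻¹

/-- The partial derivative in the `i`-th coordinate. -/
def partialD (i : Fin 3) (f : E3 → ℝ) (x : E3) : ℝ :=
  fderiv ℝ f x (EuclideanSpace.single i 1)

/-- The iterated partial derivative `∂^α f`. -/
def multiD (α : Fin 3 →₀ ℕ) (f : E3 → ℝ) : E3 → ℝ :=
  (partialD 0)^[α 0] ((partialD 1)^[α 1] ((partialD 2)^[α 2] f))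

/-- The multi-indices of length `m`. -/
def multiIndices (m : ℕ) : Finset (Fin 3 →₀ ℕ) :=
  (Finset.univ : Finset (Fin 3)).finsuppAntidiag m

/-- `α! = α_1! α_2! α_3!`. -/
def multiFactorial (α : Fin 3 →₀ ℕ) : ℕ := ∏ i : Fin 3, (α i).factorial

/-- The family `M α β` consists of generalized polarization tensors of `σ`:
`(u - H)(x) = ∑_α ∑_β (-1)^{|α|} / (α! β!) ∂^α Γ(x) M_{αβ} ∂^β H(0)` for `|x|` large. For a
polynomial `H` the number `∂^β H(0) / β!` is the coefficient of `x^β`, and the sum over `β` is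
finite. -/
def IsGPT (σ : E3 → ℝ) (M : (Fin 3 →₀ ℕ) → (Fin 3 →₀ ℕ) → ℝ) : Prop :=
  ∀ (H : MvPolynomial (Fin 3) ℝ), polyLaplacian H = 0 → ∀ u : E3 → ℝ,
    IsSolution σ (polyFun H) u →
    ∃ R : ℝ, ∀ᵐ x : E3, R < ‖x‖ →
      HasSum (fun m : ℕ => ∑ α ∈ multiIndices m, ∑ β ∈ H.support,
          (-1) ^ m / (multiFactorial α : ℝ) * multiD α fundSol x * M α β * H.coeff β)
        (u x - polyFun H x)

/-- The contraction `∑_{|α|=m} ∑_{|β|=k} b_α^n b_β^l M_{αβ}` of GPTs, where `b_α^n` and `b_β^l`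
are the coefficients of the polynomials `r^m Y_m^n` and `r^k Y_k^l`. -/
def contraction (Y : HarmonicSystem) (M : (Fin 3 →₀ ℕ) → (Fin 3 →₀ ℕ) → ℝ)
    (m : ℕ) (n : Order m) (k : ℕ) (l : Order k) : ℝ :=
  ∑ α ∈ multiIndices m, ∑ β ∈ multiIndices k,
    (Y m n : MvPolynomial (Fin 3) ℝ).coeff α * (Y k l : MvPolynomial (Fin 3) ℝ).coeff β * M α β

/-- `σ` is a GPT-vanishing structure of order `N`: it has GPTs, and their contractions of
orders `1 ≤ m, k ≤ N` vanish. -/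
def IsGPTVanishing (σ : E3 → ℝ) (Y : HarmonicSystem) (N : ℕ) : Prop :=
  (∃ M, IsGPT σ M) ∧
  ∀ M, IsGPT σ M → ∀ m k : ℕ, 1 ≤ m → m ≤ N → 1 ≤ k → k ≤ N →
    ∀ (n : Order m) (l : Order k), contraction Y M m n k l = 0

end Gpt

end

noncomputable section

namespace Gpt

/-! ### Harmonic polynomials: Laplacian, Fischer pairing, derivatives of 1/|x|. -/

section

open MeasureTheory MvPolynomial

/-! ### The Laplacian on polynomials -/

/-! For a solid harmonic p of degree k, the functions (a + b|x|^{-(2k+1)}) p(x) are harmonic away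
from the origin, and on a sphere both their value and their radial flux are scalar multiples of p.
Continuity of u and of the flux of σ∇u across |x| = r_j is therefore a 2×2 linear system for the
inner coefficients in terms of the outer ones, and P_j is its solution operator. With the background
p the outer coefficients are (1, β). A conducting core admits no singular term and an insulating
core admits no flux; either condition reads p_21 + p_22 β = 0. Hence u - H = β|x|^{-(2k+1)} p with β
= -p_21/p_22 (`modeCoeff`), different harmonics do not interact, and M_k = (2k+1)β. The entry p_22
is nonzero by a sign argument (`layerCoeff_signs`): the value and the flux of the mode with outer
coefficients (0, 1) keep opposite signs down to the core.

The piecewise multipole is a weak solution (`isWeakSolution_layered`) because it is a telescoping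
sum of multipoles cut off at the interfaces. Each cut-off needs only the divergence theorem for
fields tangential to the sphere (`integral_divergence_exterior`), which involves no surface
integral.

Every other solution has the same far field. The difference w of two solutions is O(1/|x|), so
Caccioppoli's inequality bounds its energy in a ball by O(1/T), hence by 0. Where σ > 0 the gradient
vanishes, and decay forces w = 0 near infinity (`IsWeakSolution.exists_ae_eq_zero`). Inside an
insulating core nothing is claimed, and nothing is needed.

Finally, a multipole series determines its terms (`eq_zero_of_hasSum_multipole`), which identifies
the CGPTs. For GPTs one uses that p(∂)|x|⁻¹ is a multiple of |x|^{-(2m+1)} p for a solid harmonic p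
of degree m (`sum_coeff_smul_kelvinPoly`). GPTs are not determined by the expansion, but their
contractions with harmonic coefficients are, by the orthogonality of harmonic polynomials to
multiples of |x|² in the Fischer pairing (`contraction_eq_zero`). -/

lemma polyLaplacian_apply (p : MvPolynomial (Fin 3) ℝ) :
    polyLaplacian p = ∑ i : Fin 3, pderiv i (pderiv i p) := by
  simp [polyLaplacian]

lemma mem_solidHarmonics {k : ℕ} {p : MvPolynomial (Fin 3) ℝ} :
    p ∈ solidHarmonics k ↔ p.IsHomogeneous k ∧ polyLaplacian p = 0 := by
  simp [solidHarmonics]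

lemma pderiv_comm (i j : Fin 3) (p : MvPolynomial (Fin 3) ℝ) :
    pderiv i (pderiv j p) = pderiv j (pderiv i p) := by
  ext d
  simp only [coeff_pderiv]
  rw [add_right_comm]
  by_cases h : i = j
  · subst h; rfl
  · simp [h, Ne.symm h]; ring

lemma polyLaplacian_pderiv (i : Fin 3) (p : MvPolynomial (Fin 3) ℝ) :
    polyLaplacian (pderiv i p) = pderiv i (polyLaplacian p) := by
  simp only [polyLaplacian_apply, map_sum]
  refine Finset.sum_congr rfl fun j _ => ?_
  rw [pderiv_comm j i, pderiv_comm j i]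

lemma isHomogeneous_pderiv {m : ℕ} {p : MvPolynomial (Fin 3) ℝ} (h : p.IsHomogeneous (m + 1))
    (i : Fin 3) : (pderiv i p).IsHomogeneous m := by
  rw [← mem_homogeneousSubmodule, homogeneousSubmodule_eq_finsupp_supported,
    AddMonoidAlgebra.mem_supported]
  intro d hd
  by_contra hd'
  refine mem_support_iff.1 hd ?_
  rw [coeff_pderiv, h.coeff_eq_zero, zero_mul]
  simpa using hd'

lemma pderiv_eq_zero_of_isHomogeneous_zero {p : MvPolynomial (Fin 3) ℝ} (h : p.IsHomogeneous 0)
    (i : Fin 3) : pderiv i p = 0 := by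
  ext d
  rw [coeff_pderiv, h.coeff_eq_zero, zero_mul, coeff_zero]
  simp

/-- The polynomial `|x|²`. -/
def normSq : MvPolynomial (Fin 3) ℝ := ∑ i : Fin 3, X i ^ 2

lemma isHomogeneous_normSq : normSq.IsHomogeneous 2 :=
  IsHomogeneous.sum _ _ _ fun i _ => isHomogeneous_X_pow i 2

lemma polyLaplacian_X_mul (i : Fin 3) (p : MvPolynomial (Fin 3) ℝ) :
    polyLaplacian (X i * p) = 2 * pderiv i p + X i * polyLaplacian p := by
  simp only [polyLaplacian_apply, Fin.sum_univ_three]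
  fin_cases i <;> simp [pderiv_X] <;> ring

lemma polyLaplacian_normSq_mul (p : MvPolynomial (Fin 3) ℝ) :
    polyLaplacian (normSq * p) =
      6 * p + 4 * (∑ i : Fin 3, X i * pderiv i p) + normSq * polyLaplacian p := by
  simp only [polyLaplacian_apply, normSq, Fin.sum_univ_three]
  have h2 : ∀ i : Fin 3, pderiv i (2 : MvPolynomial (Fin 3) ℝ) = 0 := fun i => by
    rw [← map_ofNat C 2, pderiv_C]
  simp [pderiv_X, h2]
  ring

/-- The Laplacian lowers degrees by exactly two, so a given coefficient of Δp involves coefficients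
of p from a single homogeneous component. -/
lemma polyLaplacian_homogeneousComponent {p : MvPolynomial (Fin 3) ℝ}
    (hp : polyLaplacian p = 0) (k : ℕ) : polyLaplacian (homogeneousComponent k p) = 0 := by
  ext d
  have key : ∀ q : MvPolynomial (Fin 3) ℝ, coeff d (polyLaplacian q) =
      ∑ i : Fin 3, coeff (d + Finsupp.single i 1 + Finsupp.single i 1) q *
        ((d i : ℝ) + 1 + 1) * (d i + 1) := by
    intro q
    simp [polyLaplacian_apply, coeff_sum, coeff_pderiv]
  by_cases h : d.degree + 2 = k
  · have := key p
    rw [hp] at this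
    rw [this, key]
    refine Finset.sum_congr rfl fun i _ => ?_
    rw [coeff_homogeneousComponent, if_pos]
    simp only [map_add, Finsupp.degree_single]; omega
  · rw [key, coeff_zero]
    refine Finset.sum_eq_zero fun i _ => ?_
    rw [coeff_homogeneousComponent, if_neg, zero_mul, zero_mul]
    simp only [map_add, Finsupp.degree_single]; omega

lemma homogeneousComponent_mem_solidHarmonics {p : MvPolynomial (Fin 3) ℝ}
    (hp : polyLaplacian p = 0) (k : ℕ) : homogeneousComponent k p ∈ solidHarmonics k :=
  mem_solidHarmonics.2
    ⟨homogeneousComponent_isHomogeneous k p, polyLaplacian_homogeneousComponent hp k⟩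

/-! ### The Fischer pairing -/

/-- The Fischer pairing `∑_α α! p_α q_α`. -/
def fischer (p : MvPolynomial (Fin 3) ℝ) : MvPolynomial (Fin 3) ℝ →ₗ[ℝ] ℝ :=
  (basisMonomials (Fin 3) ℝ).constr ℝ fun α => (multiFactorial α : ℝ) * coeff α p

lemma fischer_monomial (p : MvPolynomial (Fin 3) ℝ) (α : Fin 3 →₀ ℕ) (c : ℝ) :
    fischer p (monomial α c) = multiFactorial α * coeff α p * c := by
  have h1 : monomial α c = c • basisMonomials (Fin 3) ℝ α := by
    simp [smul_monomial]
  rw [h1, map_smul, fischer, Module.Basis.constr_basis, smul_eq_mul, mul_comm]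

lemma multiFactorial_add_single (α : Fin 3 →₀ ℕ) (i : Fin 3) :
    multiFactorial (α + Finsupp.single i 1) = (α i + 1) * multiFactorial α := by
  simp only [multiFactorial, Fin.prod_univ_three]
  fin_cases i <;> simp [Nat.factorial_succ] <;> ring

lemma multiFactorial_pos (α : Fin 3 →₀ ℕ) : 0 < multiFactorial α :=
  Finset.prod_pos fun i _ => (α i).factorial_pos

/-- Multiplication by a variable is adjoint to differentiation because (α + eᵢ)! = (αᵢ + 1) α!; this
is the purpose of the weights α!. Consequently |x|² is adjoint to the Laplacian. -/
lemma fischer_X_mul (p q : MvPolynomial (Fin 3) ℝ) (i : Fin 3) :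
    fischer p (X i * q) = fischer (pderiv i p) q := by
  have h : (fischer p).comp (LinearMap.mulLeft ℝ (X i)) = fischer (pderiv i p) := by
    apply (basisMonomials (Fin 3) ℝ).ext
    intro α
    simp only [coe_basisMonomials, LinearMap.comp_apply, LinearMap.mulLeft_apply]
    rw [X, monomial_mul, add_comm, one_mul, fischer_monomial, fischer_monomial, coeff_pderiv,
      multiFactorial_add_single]
    push_cast; ring
  exact congrArg (fun f => f q) h

lemma fischer_normSq_mul (p q : MvPolynomial (Fin 3) ℝ) :
    fischer p (normSq * q) = fischer (polyLaplacian p) q := by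
  have hadd : ∀ a b : MvPolynomial (Fin 3) ℝ, fischer (a + b) q = fischer a q + fischer b q := by
    intro a b
    have h : fischer (a + b) = fischer a + fischer b := by
      apply (basisMonomials (Fin 3) ℝ).ext
      intro α
      simp only [coe_basisMonomials, LinearMap.add_apply, fischer_monomial, coeff_add]
      ring
    rw [h]; rfl
  simp only [polyLaplacian_apply, Fin.sum_univ_three, hadd, normSq, add_mul, map_add, sq, mul_assoc,
    fischer_X_mul]

lemma fischer_self (p : MvPolynomial (Fin 3) ℝ) :
    fischer p p = ∑ α ∈ p.support, multiFactorial α * coeff α p ^ 2 := by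
  conv_lhs => rw [← support_sum_monomial_coeff p]
  rw [map_sum, support_sum_monomial_coeff]
  exact Finset.sum_congr rfl fun α _ => by rw [fischer_monomial]; ring

lemma fischer_zero_left (q : MvPolynomial (Fin 3) ℝ) : fischer 0 q = 0 := by
  have h : fischer 0 = 0 := by
    apply (basisMonomials (Fin 3) ℝ).ext
    intro α
    simp [fischer_monomial]
  rw [h]; rfl

lemma fischer_eq_zero_of_dvd {p q : MvPolynomial (Fin 3) ℝ} (hp : polyLaplacian p = 0)
    (hq : normSq ∣ q) : fischer p q = 0 := by
  obtain ⟨t, rfl⟩ := hq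
  rw [fischer_normSq_mul, hp, fischer_zero_left]

/-- A harmonic polynomial divisible by `|x|²` vanishes. -/
lemma eq_zero_of_harmonic_of_dvd {p : MvPolynomial (Fin 3) ℝ} (hp : polyLaplacian p = 0)
    (hd : normSq ∣ p) : p = 0 := by
  -- `p` is orthogonal to all multiples of |x|², hence to itself, and the pairing is positive
  -- definite.
  have h := fischer_eq_zero_of_dvd hp hd
  rw [fischer_self, Finset.sum_eq_zero_iff_of_nonneg (fun α _ => by positivity)] at h
  ext α
  by_contra hα
  have := h α (mem_support_iff.2 hα)
  have h2 := multiFactorial_pos α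
  have h3 : (multiFactorial α : ℝ) ≠ 0 := by exact_mod_cast h2.ne'
  simp [h3] at this
  exact hα (by simpa using this)

/-! ### Derivatives of multipoles -/

/-- If `q` is a solid harmonic of degree `m`, then
`∂ᵢ (|x|^{-(2m+1)} q) = |x|^{-(2m+3)} (kelvinStep m i q)`. -/
def kelvinStep (m : ℕ) (i : Fin 3) (q : MvPolynomial (Fin 3) ℝ) : MvPolynomial (Fin 3) ℝ :=
  normSq * pderiv i q - C (2 * (m : ℝ) + 1) * (X i * q)

/-- By Euler's identity for ∂ᵢq, of degree m - 1, Δ(|x|² ∂ᵢq) = (6 + 4(m-1)) ∂ᵢq = 2(2m+1) ∂ᵢq,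
which is exactly Δ((2m+1) xᵢ q). In degree 0 the first term is absent. -/
lemma kelvinStep_mem {m : ℕ} {q : MvPolynomial (Fin 3) ℝ} (hq : q ∈ solidHarmonics m)
    (i : Fin 3) : kelvinStep m i q ∈ solidHarmonics (m + 1) := by
  rw [mem_solidHarmonics] at hq ⊢
  obtain ⟨h1, h2⟩ := hq
  have hX : (C (2 * (m : ℝ) + 1) * (X i * q)).IsHomogeneous (m + 1) := by
    have := ((isHomogeneous_X ℝ i).mul h1).C_mul (2 * (m : ℝ) + 1)
    rwa [add_comm 1 m] at this
  have hL : polyLaplacian (C (2 * (m : ℝ) + 1) * (X i * q)) =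
      C (2 * (m : ℝ) + 1) * (2 * pderiv i q) := by
    rw [C_mul', map_smul, polyLaplacian_X_mul, h2, mul_zero, add_zero, ← C_mul']
  rw [kelvinStep, map_sub, hL, polyLaplacian_normSq_mul, polyLaplacian_pderiv, h2, map_zero,
    mul_zero, add_zero]
  cases m with
  | zero =>
    rw [pderiv_eq_zero_of_isHomogeneous_zero h1] at *
    simpa using hX.neg
  | succ m =>
    have h3 := isHomogeneous_pderiv h1 i
    refine ⟨?_, ?_⟩
    · have := isHomogeneous_normSq.mul h3
      rw [show 2 + m = m + 1 + 1 by omega] at this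
      exact this.sub hX
    · rw [h3.sum_X_mul_pderiv]
      simp only [nsmul_eq_mul, map_add, map_mul, map_one, Nat.cast_add, Nat.cast_one,
        show (C (2 : ℝ) : MvPolynomial (Fin 3) ℝ) = 2 from map_ofNat C 2, map_natCast]
      ring

/-- `kelvinStep` iterated `n` times in the direction `i`, starting in degree `m`. -/
def kelvinIter (i : Fin 3) (m : ℕ) (q : MvPolynomial (Fin 3) ℝ) : ℕ → MvPolynomial (Fin 3) ℝ
  | 0 => q
  | n + 1 => kelvinStep (m + n) i (kelvinIter i m q n)

/-- The solid harmonic `q` with `∂^α |x|⁻¹ = |x|^{-(2|α|+1)} q`. -/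
def kelvinPoly (α : Fin 3 →₀ ℕ) : MvPolynomial (Fin 3) ℝ :=
  kelvinIter 0 (α 2 + α 1) (kelvinIter 1 (α 2) (kelvinIter 2 0 1 (α 2)) (α 1)) (α 0)

/-- The constant `(-1)^m (2m-1)!!`. -/
def kelvinConst (m : ℕ) : ℝ := ∏ j ∈ Finset.range m, -(2 * (j : ℝ) + 1)

lemma kelvinConst_ne_zero (m : ℕ) : kelvinConst m ≠ 0 :=
  Finset.prod_ne_zero_iff.2 fun j _ => by
    have : (0 : ℝ) < 2 * j + 1 := by positivity
    linarith

lemma kelvinIter_mem (i : Fin 3) {m : ℕ} {q : MvPolynomial (Fin 3) ℝ} (hq : q ∈ solidHarmonics m)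
    (n : ℕ) : kelvinIter i m q n ∈ solidHarmonics (m + n) := by
  induction n with
  | zero => exact hq
  | succ n ih => exact kelvinStep_mem ih i

lemma one_mem_solidHarmonics : (1 : MvPolynomial (Fin 3) ℝ) ∈ solidHarmonics 0 :=
  mem_solidHarmonics.2 ⟨isHomogeneous_one _ _, by simp [polyLaplacian_apply]⟩

lemma degree_fin_three (α : Fin 3 →₀ ℕ) : α.degree = α 2 + α 1 + α 0 := by
  rw [Finsupp.degree_eq_sum, Fin.sum_univ_three]; ring

lemma kelvinPoly_mem (α : Fin 3 →₀ ℕ) : kelvinPoly α ∈ solidHarmonics α.degree := by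
  rw [degree_fin_three, kelvinPoly]
  have := kelvinIter_mem 0 (kelvinIter_mem 1 (kelvinIter_mem 2 one_mem_solidHarmonics (α 2)) (α 1))
    (α 0)
  simpa using this

/-- Modulo |x|², `kelvinStep` is multiplication by -(2m+1)xᵢ. Derivatives of 1/|x| are thus known
modulo |x|², and harmonicity removes the remaining ambiguity. -/
lemma kelvinIter_dvd (i : Fin 3) (m : ℕ) {q t : MvPolynomial (Fin 3) ℝ}
    (h : normSq ∣ q - C (kelvinConst m) * t) (n : ℕ) :
    normSq ∣ kelvinIter i m q n - C (kelvinConst (m + n)) * (X i ^ n * t) := by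
  induction n with
  | zero => simpa [kelvinIter] using h
  | succ n ih =>
    have hc : kelvinConst (m + (n + 1)) = -(2 * ((m + n : ℕ) : ℝ) + 1) * kelvinConst (m + n) := by
      rw [← add_assoc, kelvinConst, Finset.prod_range_succ, mul_comm, kelvinConst]
    have e : kelvinIter i m q (n + 1) - C (kelvinConst (m + (n + 1))) * (X i ^ (n + 1) * t) =
        normSq * pderiv i (kelvinIter i m q n) - C (2 * ((m + n : ℕ) : ℝ) + 1) * X i *
          (kelvinIter i m q n - C (kelvinConst (m + n)) * (X i ^ n * t)) := by
      rw [hc, kelvinIter, kelvinStep, C_mul, C_neg]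
      ring
    rw [e]
    exact dvd_sub (dvd_mul_right _ _) (ih.mul_left _)

lemma kelvinPoly_dvd (α : Fin 3 →₀ ℕ) :
    normSq ∣ kelvinPoly α - C (kelvinConst α.degree) * monomial α 1 := by
  have h0 : normSq ∣ (1 : MvPolynomial (Fin 3) ℝ) - C (kelvinConst 0) * 1 := by
    simp [kelvinConst]
  have h := kelvinIter_dvd 0 _ (kelvinIter_dvd 1 _ (kelvinIter_dvd 2 0 h0 (α 2)) (α 1)) (α 0)
  rw [zero_add, ← degree_fin_three] at h
  convert h using 3
  · rfl
  rw [monomial_eq, Finsupp.prod_fintype _ _ (by simp), Fin.prod_univ_three]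
  simp [mul_assoc]

lemma mem_multiIndices {m : ℕ} {α : Fin 3 →₀ ℕ} : α ∈ multiIndices m ↔ α.degree = m := by
  simp [multiIndices, Finset.mem_finsuppAntidiag, Finsupp.degree_eq_sum]

lemma support_subset_multiIndices {m : ℕ} {p : MvPolynomial (Fin 3) ℝ} (hp : p.IsHomogeneous m) :
    p.support ⊆ multiIndices m := fun α hα => by
  rw [mem_multiIndices]
  by_contra h
  exact mem_support_iff.1 hα (hp.coeff_eq_zero h)

lemma sum_multiIndices_monomial {m : ℕ} {p : MvPolynomial (Fin 3) ℝ} (hp : p.IsHomogeneous m) :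
    ∑ α ∈ multiIndices m, monomial α (coeff α p) = p := by
  conv_rhs => rw [← support_sum_monomial_coeff p]
  refine (Finset.sum_subset (support_subset_multiIndices hp) fun α _ hα => ?_).symm
  rw [notMem_support_iff.1 hα, map_zero]

lemma sum_smul_kelvinPoly_dvd (m : ℕ) (w : (Fin 3 →₀ ℕ) → ℝ) :
    normSq ∣ (∑ α ∈ multiIndices m, w α • kelvinPoly α) -
      C (kelvinConst m) * ∑ α ∈ multiIndices m, monomial α (w α) := by
  rw [Finset.mul_sum, ← Finset.sum_sub_distrib]
  refine Finset.dvd_sum fun α hα => ?_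
  have h := (kelvinPoly_dvd α).mul_left (C (w α))
  rw [mem_multiIndices.1 hα] at h
  convert h using 1
  rw [mul_sub, ← C_mul', mul_left_comm, C_mul_monomial, C_mul_monomial,
    C_mul_monomial, mul_one]

/-- Applying a solid harmonic `p` of degree `m`, as a differential operator, to `|x|⁻¹` gives a
multiple of `|x|^{-(2m+1)} p`. -/
lemma sum_coeff_smul_kelvinPoly {m : ℕ} {p : MvPolynomial (Fin 3) ℝ} (hp : p ∈ solidHarmonics m) :
    ∑ α ∈ multiIndices m, coeff α p • kelvinPoly α = kelvinConst m • p := by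
  have h := sum_smul_kelvinPoly_dvd m fun α => coeff α p
  rw [mem_solidHarmonics] at hp
  rw [sum_multiIndices_monomial hp.1, C_mul'] at h
  rw [← sub_eq_zero]
  -- Both sides are harmonic and agree modulo |x|².
  refine eq_zero_of_harmonic_of_dvd ?_ h
  rw [map_sub, map_smul, hp.2, map_sum, smul_zero, sub_zero]
  exact Finset.sum_eq_zero fun α _ => by
    rw [map_smul, (mem_solidHarmonics.1 (kelvinPoly_mem α)).2, smul_zero]

/-- If the multipole with weights w_α/α! vanishes, then ∑ (w_α/α!) x^α is a multiple of |x|² and so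
is orthogonal to harmonic polynomials; the α! of the Fischer pairing cancels the denominators. This
is what makes contractions insensitive to the non-uniqueness of GPTs. -/
lemma sum_coeff_mul_eq_zero_of_kelvin {m : ℕ} {w : (Fin 3 →₀ ℕ) → ℝ}
    (hw : ∑ α ∈ multiIndices m, (w α / multiFactorial α) • kelvinPoly α = 0)
    {p : MvPolynomial (Fin 3) ℝ} (hp : polyLaplacian p = 0) :
    ∑ α ∈ multiIndices m, coeff α p * w α = 0 := by
  have h := sum_smul_kelvinPoly_dvd m fun α => w α / multiFactorial α
  rw [hw, zero_sub, dvd_neg, C_mul'] at h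
  have h2 := fischer_eq_zero_of_dvd hp h
  rw [map_smul, smul_eq_mul, mul_eq_zero, or_iff_right (kelvinConst_ne_zero m), map_sum] at h2
  rw [← h2]
  refine Finset.sum_congr rfl fun α _ => ?_
  have h3 : (multiFactorial α : ℝ) ≠ 0 := by exact_mod_cast (multiFactorial_pos α).ne'
  rw [fischer_monomial]
  field_simp

end

/-! ### Pointwise calculus of polynomial functions and multipoles. -/

section

open MeasureTheory MvPolynomial

/-! ### Polynomial functions -/

lemma polyFun_add (p q : MvPolynomial (Fin 3) ℝ) (x : E3) :
    polyFun (p + q) x = polyFun p x + polyFun q x := by simp [polyFun]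

lemma polyFun_sub (p q : MvPolynomial (Fin 3) ℝ) (x : E3) :
    polyFun (p - q) x = polyFun p x - polyFun q x := by simp [polyFun]

lemma polyFun_mul (p q : MvPolynomial (Fin 3) ℝ) (x : E3) :
    polyFun (p * q) x = polyFun p x * polyFun q x := by simp [polyFun]

lemma polyFun_smul (c : ℝ) (p : MvPolynomial (Fin 3) ℝ) (x : E3) :
    polyFun (c • p) x = c * polyFun p x := by simp [polyFun]

lemma polyFun_C (c : ℝ) (x : E3) : polyFun (C c) x = c := by simp [polyFun]

lemma polyFun_X (i : Fin 3) (x : E3) : polyFun (X i) x = x i := by simp [polyFun]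

lemma polyFun_zero (x : E3) : polyFun 0 x = 0 := by simp [polyFun]

lemma polyFun_sum {ι : Type*} (t : Finset ι) (p : ι → MvPolynomial (Fin 3) ℝ) (x : E3) :
    polyFun (∑ j ∈ t, p j) x = ∑ j ∈ t, polyFun (p j) x := by simp [polyFun]

lemma polyFun_normSq (x : E3) : polyFun normSq x = ‖x‖ ^ 2 := by
  simp [polyFun, normSq, EuclideanSpace.norm_sq_eq, sq_abs]

lemma contDiff_polyFun {n : WithTop ℕ∞} (p : MvPolynomial (Fin 3) ℝ) :
    ContDiff ℝ n (polyFun p) := by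
  induction p using MvPolynomial.induction_on with
  | C a =>
    have : polyFun (C a) = fun _ => a := by
      funext x; simp [polyFun]
    rw [this]; exact contDiff_const
  | add p q hp hq =>
    have : polyFun (p + q) = fun x => polyFun p x + polyFun q x := by
      funext x; exact polyFun_add p q x
    rw [this]; exact hp.add hq
  | mul_X p i hp =>
    have : polyFun (p * X i) = fun x => polyFun p x * x i := by
      funext x; rw [polyFun_mul, polyFun_X]
    rw [this]
    exact hp.mul (by fun_prop)

lemma continuous_polyFun (p : MvPolynomial (Fin 3) ℝ) : Continuous (polyFun p) :=
  (contDiff_polyFun (n := 0) p).continuous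

lemma fderiv_polyFun (p : MvPolynomial (Fin 3) ℝ) (i : Fin 3) (x : E3) :
    fderiv ℝ (polyFun p) x (EuclideanSpace.single i 1) = polyFun (pderiv i p) x := by
  induction p using MvPolynomial.induction_on with
  | C a =>
    have : polyFun (C a) = fun _ => a := by
      funext x; simp [polyFun]
    simp [this, polyFun_zero]
  | add p q hp hq =>
    have : polyFun (p + q) = polyFun p + polyFun q := by
      funext x; exact polyFun_add p q x
    rw [this, fderiv_add ((contDiff_polyFun (n := 1) p).differentiable (by simp) x)
      ((contDiff_polyFun (n := 1) q).differentiable (by simp) x)]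
    simp [hp, hq, polyFun_add]
  | mul_X p j hp =>
    have : polyFun (p * X j) = polyFun p * fun x => x j := by
      funext x; rw [polyFun_mul, polyFun_X]; rfl
    have hj : HasFDerivAt (fun x : E3 => x j) (EuclideanSpace.proj j : E3 →L[ℝ] ℝ) x :=
      (EuclideanSpace.proj j : E3 →L[ℝ] ℝ).hasFDerivAt
    have hd := (((contDiff_polyFun (n := 1) p).differentiable (by simp) x).hasFDerivAt.mul hj).fderiv
    rw [this, hd]
    simp only [add_apply, smul_apply, hp, smul_eq_mul,
      pderiv_mul, polyFun_add, polyFun_mul, polyFun_X, pderiv_X]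
    by_cases h : j = i
    · subst h; simp [polyFun]; ring
    · simp [h, polyFun_zero]; ring

/-- The gradient of a polynomial function. -/
def polyGrad (p : MvPolynomial (Fin 3) ℝ) (x : E3) : E3 :=
  WithLp.toLp 2 fun i => polyFun (pderiv i p) x

lemma polyGrad_apply (p : MvPolynomial (Fin 3) ℝ) (x : E3) (i : Fin 3) :
    polyGrad p x i = polyFun (pderiv i p) x := rfl

lemma gradient_apply (f : E3 → ℝ) (x : E3) (i : Fin 3) :
    gradient f x i = fderiv ℝ f x (EuclideanSpace.single i 1) := by
  rw [gradient]
  rw [← InnerProductSpace.toDual_symm_apply (𝕜 := ℝ), EuclideanSpace.inner_single_right]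
  simp

lemma inner_eq_sum (x y : E3) : inner ℝ x y = ∑ i, x i * y i := by
  simp [PiLp.inner_apply, mul_comm]

lemma polyFun_smul_arg {m : ℕ} {p : MvPolynomial (Fin 3) ℝ} (hp : p.IsHomogeneous m) (t : ℝ)
    (x : E3) : polyFun p (t • x) = t ^ m * polyFun p x := by
  simp only [polyFun, PiLp.smul_apply, smul_eq_mul]
  rw [eval_eq, eval_eq, Finset.mul_sum]
  refine Finset.sum_congr rfl fun d hd => ?_
  have h := hp.degree_eq_sum_deg_support hd
  simp only [mul_pow, Finset.prod_mul_distrib, Finset.prod_pow_eq_pow_sum]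
  rw [h]
  ring

lemma sum_mul_polyFun_pderiv {m : ℕ} {p : MvPolynomial (Fin 3) ℝ} (hp : p.IsHomogeneous m)
    (x : E3) : ∑ i, x i * polyFun (pderiv i p) x = m * polyFun p x := by
  have h := congrArg (fun q => polyFun q x) hp.sum_X_mul_pderiv
  simp only [polyFun_sum, polyFun_mul, polyFun_X] at h
  rw [h]; simp [polyFun]

/-! ### Multipoles -/

lemma hasFDerivAt_norm_pow_inv (n : ℕ) {x : E3} (hx : x ≠ 0) :
    HasFDerivAt (fun y : E3 => (‖y‖ ^ n)⁻¹) ((-(n * (‖x‖ ^ (n + 2))⁻¹)) • innerSL ℝ x) x := by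
  have h0 : ‖x‖ ≠ 0 := norm_ne_zero_iff.2 hx
  have h1 : HasFDerivAt (fun y : E3 => ‖y‖) (‖x‖⁻¹ • innerSL ℝ x) x := by
    have h2 := (hasStrictFDerivAt_norm_sq x).hasFDerivAt.sqrt (by positivity)
    simp only [Real.sqrt_sq (norm_nonneg _)] at h2
    refine h2.congr_fderiv ?_
    ext v
    simp
    field_simp
  have h3 := ((hasDerivAt_pow n ‖x‖).inv (pow_ne_zero n h0)).comp_hasFDerivAt x h1
  refine h3.congr_fderiv ?_
  ext v
  cases n with
  | zero => simp
  | succ n =>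
    simp
    field_simp
    ring

lemma contDiffAt_norm_pow_inv {m : WithTop ℕ∞} (n : ℕ) {x : E3} (hx : x ≠ 0) :
    ContDiffAt ℝ m (fun y : E3 => (‖y‖ ^ n)⁻¹) x :=
  ((contDiffAt_norm ℝ hx).pow n).inv (pow_ne_zero n (norm_ne_zero_iff.2 hx))

/-- The function `(a + b |x|^{-(2k+1)}) p(x)`. -/
def multipole (k : ℕ) (p : MvPolynomial (Fin 3) ℝ) (a b : ℝ) (x : E3) : ℝ :=
  (a + b * (‖x‖ ^ (2 * k + 1))⁻¹) * polyFun p x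

/-- The gradient of `multipole k p a b` away from the origin. -/
def multipoleGrad (k : ℕ) (p : MvPolynomial (Fin 3) ℝ) (a b : ℝ) (x : E3) : E3 :=
  (a + b * (‖x‖ ^ (2 * k + 1))⁻¹) • polyGrad p x -
    ((2 * k + 1) * b * (‖x‖ ^ (2 * k + 3))⁻¹ * polyFun p x) • x

lemma multipoleGrad_apply (k : ℕ) (p : MvPolynomial (Fin 3) ℝ) (a b : ℝ) (x : E3) (i : Fin 3) :
    multipoleGrad k p a b x i = (a + b * (‖x‖ ^ (2 * k + 1))⁻¹) * polyFun (pderiv i p) x -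
      (2 * k + 1) * b * (‖x‖ ^ (2 * k + 3))⁻¹ * polyFun p x * x i := rfl

lemma contDiffAt_multipole {m : WithTop ℕ∞} (k : ℕ) (p : MvPolynomial (Fin 3) ℝ) (a b : ℝ) {x : E3}
    (hx : x ≠ 0) : ContDiffAt ℝ m (multipole k p a b) x :=
  (contDiffAt_const.add (contDiffAt_const.mul (contDiffAt_norm_pow_inv _ hx))).mul
    (contDiff_polyFun p).contDiffAt

lemma contDiffAt_multipoleGrad {m : WithTop ℕ∞} (k : ℕ) (p : MvPolynomial (Fin 3) ℝ) (a b : ℝ)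
    {x : E3} (hx : x ≠ 0) : ContDiffAt ℝ m (multipoleGrad k p a b) x := by
  rw [contDiffAt_euclidean]
  intro i
  exact ((contDiffAt_const.add (contDiffAt_const.mul (contDiffAt_norm_pow_inv _ hx))).mul
    (contDiff_polyFun _).contDiffAt).sub ((((contDiffAt_const.mul (contDiffAt_norm_pow_inv _ hx))).mul
    (contDiff_polyFun p).contDiffAt).mul (by fun_prop))

lemma innerSL_single (x : E3) (i : Fin 3) :
    innerSL ℝ x (EuclideanSpace.single i (1 : ℝ)) = x i := by
  simp [EuclideanSpace.inner_single_right]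

lemma differentiableAt_polyFun (p : MvPolynomial (Fin 3) ℝ) (x : E3) :
    DifferentiableAt ℝ (polyFun p) x :=
  (contDiff_polyFun (n := 1) p).differentiable (by simp) x

lemma fderiv_multipole (k : ℕ) (p : MvPolynomial (Fin 3) ℝ) (a b : ℝ) {x : E3} (hx : x ≠ 0)
    (i : Fin 3) : fderiv ℝ (multipole k p a b) x (EuclideanSpace.single i 1) =
      multipoleGrad k p a b x i := by
  have h := (((hasFDerivAt_norm_pow_inv (2 * k + 1) hx).const_mul b).const_add a).mul
    (differentiableAt_polyFun p x).hasFDerivAt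
  have h' := h.fderiv
  change fderiv ℝ (multipole k p a b) x = _ at h'
  rw [h', multipoleGrad_apply]
  simp only [add_apply, smul_apply, innerSL_single,
    fderiv_polyFun, smul_eq_mul]
  push_cast
  ring

lemma fderiv_apply_coord {F : E3 → E3} {x : E3} (hF : DifferentiableAt ℝ F x) (v : E3) (i : Fin 3) :
    (fderiv ℝ F x v) i = fderiv ℝ (fun y => F y i) x v := by
  have h := ((EuclideanSpace.proj i : E3 →L[ℝ] ℝ).hasFDerivAt.comp x hF.hasFDerivAt).fderiv
  have h2 : (EuclideanSpace.proj i : E3 →L[ℝ] ℝ) ∘ F = fun y => F y i := rfl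
  rw [h2] at h
  rw [h]; rfl

/-- The divergence of a vector field on `ℝ³`. -/
def divergence (F : E3 → E3) (x : E3) : ℝ :=
  ∑ i : Fin 3, (fderiv ℝ F x (EuclideanSpace.single i 1)) i

/-- Multipoles built from a solid harmonic of degree `k` are harmonic away from the origin. -/
lemma divergence_multipoleGrad {k : ℕ} {p : MvPolynomial (Fin 3) ℝ} (hp : p ∈ solidHarmonics k)
    (a b : ℝ) {x : E3} (hx : x ≠ 0) : divergence (multipoleGrad k p a b) x = 0 := by
  rw [mem_solidHarmonics] at hp
  have hE := sum_mul_polyFun_pderiv hp.1 x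
  have hL := congrArg (fun q => polyFun q x) hp.2
  simp only [polyLaplacian_apply, polyFun_sum, polyFun_zero] at hL
  have h0 : ‖x‖ ≠ 0 := norm_ne_zero_iff.2 hx
  have key : ∀ i : Fin 3, (fderiv ℝ (multipoleGrad k p a b) x (EuclideanSpace.single i 1)) i =
      (a + b * (‖x‖ ^ (2 * k + 1))⁻¹) * polyFun (pderiv i (pderiv i p)) x
      - (2 * k + 1) * b * (‖x‖ ^ (2 * k + 3))⁻¹ *
        (2 * (x i * polyFun (pderiv i p) x) + polyFun p x)
      + (2 * k + 1) * (2 * k + 3) * b * (‖x‖ ^ (2 * k + 5))⁻¹ * polyFun p x * (x i) ^ 2 := by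
    intro i
    rw [fderiv_apply_coord ((contDiffAt_multipoleGrad (m := 1) k p a b hx).differentiableAt
      (by simp))]
    have hi : HasFDerivAt (fun x : E3 => x i) (EuclideanSpace.proj i : E3 →L[ℝ] ℝ) x :=
      (EuclideanSpace.proj i : E3 →L[ℝ] ℝ).hasFDerivAt
    have h1 := (((hasFDerivAt_norm_pow_inv (2 * k + 1) hx).const_mul b).const_add a).mul
      (differentiableAt_polyFun (pderiv i p) x).hasFDerivAt
    have h2 := ((((hasFDerivAt_norm_pow_inv (2 * k + 3) hx).const_mul ((2 * k + 1) * b)).mul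
      (differentiableAt_polyFun p x).hasFDerivAt).mul hi)
    have h' := (h1.sub h2).fderiv
    have hs : (EuclideanSpace.proj i : E3 →L[ℝ] ℝ) (EuclideanSpace.single i 1) = 1 := by simp
    change fderiv ℝ (fun y => multipoleGrad k p a b y i) x = _ at h'
    rw [h']
    simp only [add_apply, sub_apply,
      smul_apply, innerSL_single, fderiv_polyFun, smul_eq_mul,
      hs, Pi.mul_apply]
    push_cast
    ring
  -- Summing over i, Δp = 0 removes the first term, Euler's identity turns the second into the
  -- factor 2k + 3, and ∑ xᵢ² = |x|² makes the third cancel it.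
  rw [divergence, Finset.sum_congr rfl fun i _ => key i]
  rw [Finset.sum_add_distrib, Finset.sum_sub_distrib, ← Finset.mul_sum, ← Finset.mul_sum,
    ← Finset.mul_sum, hL, Finset.sum_add_distrib, ← Finset.mul_sum, hE]
  have hn : ∑ i : Fin 3, x i ^ 2 = ‖x‖ ^ 2 := by simp [EuclideanSpace.norm_sq_eq, sq_abs]
  rw [hn]
  simp only [Finset.sum_const, Finset.card_univ, Fintype.card_fin]
  have : (‖x‖ ^ (2 * k + 5))⁻¹ * ‖x‖ ^ 2 = (‖x‖ ^ (2 * k + 3))⁻¹ := by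
    field_simp
    ring
  simp only [nsmul_eq_mul]
  push_cast
  linear_combination ((2 * k + 1) * (2 * k + 3) * b * polyFun p x) * this

/-- Euler's identity makes the radial flux on a sphere a constant multiple of p, just like the
value. This reduces the transmission conditions to two scalar equations for (a, b). -/
lemma inner_multipoleGrad {k : ℕ} {p : MvPolynomial (Fin 3) ℝ} (hp : p.IsHomogeneous k)
    (a b : ℝ) {x : E3} (hx : x ≠ 0) : inner ℝ x (multipoleGrad k p a b x) =
      (k * a - (k + 1) * (b * (‖x‖ ^ (2 * k + 1))⁻¹)) * polyFun p x := by
  have h0 : ‖x‖ ≠ 0 := norm_ne_zero_iff.2 hx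
  rw [multipoleGrad, inner_sub_right, inner_smul_right, inner_smul_right, real_inner_self_eq_norm_sq]
  have h1 : inner ℝ x (polyGrad p x) = k * polyFun p x := by
    rw [inner_eq_sum]; exact sum_mul_polyFun_pderiv hp x
  have : (‖x‖ ^ (2 * k + 3))⁻¹ * ‖x‖ ^ 2 = (‖x‖ ^ (2 * k + 1))⁻¹ := by
    field_simp
    ring
  rw [h1]
  linear_combination (-(2 * k + 1) * b * polyFun p x) * this

/-! ### Derivatives of the fundamental solution -/

lemma partialD_of_eq {f : E3 → ℝ} {c : ℝ} {m : ℕ} {q : MvPolynomial (Fin 3) ℝ}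
    (hf : ∀ x : E3, x ≠ 0 → f x = c * ((‖x‖ ^ (2 * m + 1))⁻¹ * polyFun q x)) (i : Fin 3) {x : E3}
    (hx : x ≠ 0) :
    partialD i f x = c * ((‖x‖ ^ (2 * (m + 1) + 1))⁻¹ * polyFun (kelvinStep m i q) x) := by
  have h0 : ‖x‖ ≠ 0 := norm_ne_zero_iff.2 hx
  have he : f =ᶠ[nhds x] multipole m q 0 c := by
    filter_upwards [isOpen_ne.mem_nhds hx] with y hy
    rw [hf y hy, multipole]; ring
  rw [partialD, he.fderiv_eq, fderiv_multipole m q 0 c hx, multipoleGrad_apply, kelvinStep,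
    polyFun_sub, polyFun_mul, polyFun_mul, polyFun_mul, polyFun_normSq, polyFun_C, polyFun_X]
  have : (‖x‖ ^ (2 * m + 3))⁻¹ * ‖x‖ ^ 2 = (‖x‖ ^ (2 * m + 1))⁻¹ := by
    field_simp
    ring
  rw [show 2 * (m + 1) + 1 = 2 * m + 3 by ring]
  linear_combination (-c * polyFun (pderiv i q) x) * this

lemma partialD_iterate_of_eq {f : E3 → ℝ} {c : ℝ} {m : ℕ} {q : MvPolynomial (Fin 3) ℝ}
    (hf : ∀ x : E3, x ≠ 0 → f x = c * ((‖x‖ ^ (2 * m + 1))⁻¹ * polyFun q x)) (i : Fin 3) (n : ℕ) :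
    ∀ x : E3, x ≠ 0 → (partialD i)^[n] f x =
      c * ((‖x‖ ^ (2 * (m + n) + 1))⁻¹ * polyFun (kelvinIter i m q n) x) := by
  induction n with
  | zero => exact hf
  | succ n ih =>
    intro x hx
    rw [Function.iterate_succ_apply', partialD_of_eq ih i hx]
    rfl

/-- The derivatives of the fundamental solution as multipoles. -/
lemma multiD_fundSol (α : Fin 3 →₀ ℕ) {x : E3} (hx : x ≠ 0) :
    multiD α fundSol x = (1 / ((2 - 3) * (4 * Real.pi))) *
      ((‖x‖ ^ (2 * α.degree + 1))⁻¹ * polyFun (kelvinPoly α) x) := by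
  have h0 : ∀ x : E3, x ≠ 0 → fundSol x = (1 / ((2 - 3) * (4 * Real.pi))) *
      ((‖x‖ ^ (2 * 0 + 1))⁻¹ * polyFun 1 x) := by
    intro x _
    simp [fundSol, polyFun]
  have h := partialD_iterate_of_eq (partialD_iterate_of_eq (partialD_iterate_of_eq h0 2 (α 2)) 1
    (α 1)) 0 (α 0) x hx
  rw [degree_fin_three, kelvinPoly, multiD, h]
  simp

end

/-! ### Divergence theorem outside a sphere, without surface integrals. -/

section

open MeasureTheory Filter Topology

/-! ### The divergence theorem outside a ball for tangential fields -/

lemma continuous_fderiv_apply {E F : Type*} [NormedAddCommGroup E] [NormedSpace ℝ E]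
    [NormedAddCommGroup F] [NormedSpace ℝ F] {f : E → F} (hf : ContDiff ℝ 1 f) (v : E) :
    Continuous fun x => fderiv ℝ f x v :=
  (hf.continuous_fderiv (by simp)).clm_apply continuous_const

lemma hasCompactSupport_fderiv_apply {E F : Type*} [NormedAddCommGroup E] [NormedSpace ℝ E]
    [NormedAddCommGroup F] [NormedSpace ℝ F] {f : E → F} (hf : HasCompactSupport f) (v : E) :
    HasCompactSupport fun x => fderiv ℝ f x v :=
  (hf.fderiv ℝ).comp_left (g := fun L : E →L[ℝ] F => L v) (by simp)

lemma hasCompactSupport_coord {F : E3 → E3} (hF : HasCompactSupport F) (i : Fin 3) :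
    HasCompactSupport fun x => F x i :=
  hF.comp_left (g := fun y : E3 => y i) (by simp)

lemma contDiff_coord {m : WithTop ℕ∞} {F : E3 → E3} (hF : ContDiff ℝ m F) (i : Fin 3) :
    ContDiff ℝ m fun x => F x i := contDiff_euclidean.1 hF i

lemma divergence_eq {F : E3 → E3} {x : E3} (hF : DifferentiableAt ℝ F x) :
    divergence F x = ∑ i : Fin 3, fderiv ℝ (fun y => F y i) x (EuclideanSpace.single i 1) :=
  Finset.sum_congr rfl fun _ _ => fderiv_apply_coord hF _ _

lemma integral_mul_divergence {ψ : E3 → ℝ} (hψ : ContDiff ℝ 1 ψ) {F : E3 → E3}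
    (hF : ContDiff ℝ 1 F) (hc : HasCompactSupport F) :
    ∫ x, ψ x * divergence F x =
      -∫ x, ∑ i : Fin 3, fderiv ℝ ψ x (EuclideanSpace.single i 1) * F x i := by
  have hd := hF.differentiable (by simp)
  have h1 : ∀ i : Fin 3, Integrable fun x =>
      ψ x * fderiv ℝ (fun y => F y i) x (EuclideanSpace.single i 1) := fun i =>
    (hψ.continuous.mul (continuous_fderiv_apply (contDiff_coord hF i) _)).integrable_of_hasCompactSupport
      (hasCompactSupport_fderiv_apply (hasCompactSupport_coord hc i) _).mul_left
  have h2 : ∀ i : Fin 3, Integrable fun x =>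
      fderiv ℝ ψ x (EuclideanSpace.single i 1) * F x i := fun i =>
    ((continuous_fderiv_apply hψ _).mul (contDiff_coord hF i).continuous).integrable_of_hasCompactSupport
      (hasCompactSupport_coord hc i).mul_left
  have h3 : ∀ i : Fin 3, Integrable fun x => ψ x * F x i := fun i =>
    (hψ.continuous.mul (contDiff_coord hF i).continuous).integrable_of_hasCompactSupport
      (hasCompactSupport_coord hc i).mul_left
  simp only [fun x => divergence_eq (hd x), Finset.mul_sum]
  rw [integral_finsetSum _ fun i _ => h1 i, integral_finsetSum _ fun i _ => h2 i,
    ← Finset.sum_neg_distrib]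
  refine Finset.sum_congr rfl fun i _ => ?_
  exact integral_mul_fderiv_eq_neg_fderiv_mul_of_integrable (h2 i) (h1 i) (h3 i)
    (fun x _ => hψ.differentiable (by simp) x)
    (fun x _ => (contDiff_coord hF i).differentiable (by simp) x)

/-- The function `z s'(z)` for the smooth transition function `s`. -/
lemma exists_bound_mul_deriv_smoothTransition :
    (∀ z : ℝ, z ∉ Set.Icc (0 : ℝ) 1 → deriv Real.smoothTransition z = 0) ∧
    ∃ B : ℝ, ∀ z : ℝ, |z * deriv Real.smoothTransition z| ≤ B := by
  have h0 : ∀ z : ℝ, z ∉ Set.Icc (0 : ℝ) 1 → deriv Real.smoothTransition z = 0 := by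
    intro z hz
    rw [Set.mem_Icc, not_and_or, not_le, not_le] at hz
    rcases hz with hz | hz
    · have : Real.smoothTransition =ᶠ[𝓝 z] fun _ => 0 := by
        filter_upwards [Iio_mem_nhds hz] with y hy
        exact Real.smoothTransition.zero_of_nonpos (le_of_lt hy)
      rw [this.deriv_eq, deriv_const]
    · have : Real.smoothTransition =ᶠ[𝓝 z] fun _ => 1 := by
        filter_upwards [Ioi_mem_nhds hz] with y hy
        exact Real.smoothTransition.one_of_one_le (le_of_lt hy)
      rw [this.deriv_eq, deriv_const]
  refine ⟨h0, ?_⟩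
  have hcont : Continuous (deriv Real.smoothTransition) :=
    (Real.smoothTransition.contDiff (n := 1)).continuous_deriv (by simp)
  have hs : HasCompactSupport fun z => z * deriv Real.smoothTransition z :=
    HasCompactSupport.intro isCompact_Icc fun z hz => by rw [h0 z hz, mul_zero]
  obtain ⟨B, hB⟩ := (continuous_id.mul hcont).bounded_above_of_compact_support hs
  exact ⟨B, fun z => hB z⟩

lemma continuous_divergence {F : E3 → E3} (hF : ContDiff ℝ 1 F) : Continuous (divergence F) := by
  have : divergence F = fun x => ∑ i : Fin 3, (fderiv ℝ F x (EuclideanSpace.single i 1)) i := rfl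
  rw [this]
  refine continuous_finsetSum _ fun i _ => ?_
  exact (EuclideanSpace.proj i : E3 →L[ℝ] ℝ).continuous.comp (continuous_fderiv_apply hF _)

lemma hasCompactSupport_divergence {F : E3 → E3} (hc : HasCompactSupport F) :
    HasCompactSupport (divergence F) := by
  refine (hc.fderiv ℝ).comp_left
    (g := fun L : E3 →L[ℝ] E3 => ∑ i : Fin 3, (L (EuclideanSpace.single i 1)) i) ?_
  simp

lemma measurableSet_exterior (ρ : ℝ) : MeasurableSet {x : E3 | ρ < ‖x‖} :=
  measurableSet_lt measurable_const measurable_norm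

/-- The function x·F(x) is Lipschitz and vanishes on the sphere; compare x with its radial
projection. The division by ρ comes from | |x|² - ρ² | ≥ ρ | |x| - ρ |. -/
lemma exists_bound_inner {F : E3 → E3} (hF : ContDiff ℝ 1 F) (hc : HasCompactSupport F) {ρ : ℝ}
    (hρ : 0 < ρ) (h0 : ∀ x, ‖x‖ = ρ → inner ℝ x (F x) = 0) :
    ∃ K : ℝ, 0 ≤ K ∧ ∀ x : E3, x ≠ 0 → |inner ℝ x (F x)| ≤ K * |‖x‖ ^ 2 - ρ ^ 2| := by
  have hf : ContDiff ℝ 1 fun x : E3 => inner ℝ x (F x) := contDiff_id.inner ℝ hF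
  have hcs : HasCompactSupport fun x : E3 => inner ℝ x (F x) :=
    hc.mono fun x hx hx' => hx (by simp [hx'])
  obtain ⟨K, hK⟩ := hf.lipschitzWith_of_hasCompactSupport hcs (by simp)
  refine ⟨K / ρ, by positivity, fun x hx => ?_⟩
  have hn : 0 < ‖x‖ := norm_pos_iff.2 hx
  set y : E3 := (ρ * ‖x‖⁻¹) • x with hy
  have hyn : ‖y‖ = ρ := by
    rw [hy, norm_smul, Real.norm_eq_abs, abs_of_pos (by positivity)]
    field_simp
  have h1 := hK.dist_le_mul x y
  rw [Real.dist_eq, h0 y hyn, sub_zero, dist_eq_norm] at h1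
  have h2 : ‖x - y‖ = |‖x‖ - ρ| := by
    have : x - y = (1 - ρ * ‖x‖⁻¹) • x := by rw [sub_smul, one_smul]
    rw [this, norm_smul, Real.norm_eq_abs]
    nth_rewrite 2 [← abs_of_pos hn]
    rw [← abs_mul]
    congr 1
    field_simp
  rw [h2] at h1
  refine h1.trans ?_
  have h3 : |‖x‖ ^ 2 - ρ ^ 2| = |‖x‖ - ρ| * (‖x‖ + ρ) := by
    rw [sq_sub_sq, abs_mul, abs_of_pos (by positivity : 0 < ‖x‖ + ρ), mul_comm]
  rw [h3, div_mul_eq_mul_div, le_div_iff₀ hρ]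
  have h4 : 0 ≤ (K : ℝ) * |‖x‖ - ρ| := by positivity
  nlinarith

/-- Integrate div F against ψ_n = s(n(|x|² - ρ²)), which tends to the indicator of the exterior. Its
gradient has size n in a shell of width 1/n, where tangency makes x·F of size 1/n. With z = n(|x|² -
ρ²), the integrand ∇ψ_n·F is bounded by a multiple of |z s'(z)| and tends to 0 pointwise, so
dominated convergence applies to both sides of the integration by parts. -/
lemma integral_divergence_exterior_of_contDiff {F : E3 → E3} (hF : ContDiff ℝ 1 F)
    (hc : HasCompactSupport F) {ρ : ℝ} (hρ : 0 < ρ)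
    (h0 : ∀ x, ‖x‖ = ρ → inner ℝ x (F x) = 0) :
    ∫ x in {x : E3 | ρ < ‖x‖}, divergence F x = 0 := by
  obtain ⟨hs0, B, hB⟩ := exists_bound_mul_deriv_smoothTransition
  obtain ⟨K, hK0, hK⟩ := exists_bound_inner hF hc hρ h0
  set s := Real.smoothTransition with hs
  let ψ : ℕ → E3 → ℝ := fun n x => s (n * (‖x‖ ^ 2 - ρ ^ 2))
  have hψ : ∀ n, ContDiff ℝ 1 (ψ n) := fun n =>
    Real.smoothTransition.contDiff.comp (contDiff_const.mul ((contDiff_norm_sq ℝ).sub contDiff_const))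
  have hgrad : ∀ n x, ∑ i : Fin 3, fderiv ℝ (ψ n) x (EuclideanSpace.single i 1) * F x i =
      2 * n * deriv s (n * (‖x‖ ^ 2 - ρ ^ 2)) * inner ℝ x (F x) := by
    intro n x
    have h1 : HasFDerivAt (fun x : E3 => n * (‖x‖ ^ 2 - ρ ^ 2)) ((n : ℝ) • 2 • innerSL ℝ x) x :=
      ((hasStrictFDerivAt_norm_sq x).hasFDerivAt.sub_const _).const_mul _
    have h2 := ((Real.smoothTransition.contDiff (n := 1)).differentiable (by simp)
      (n * (‖x‖ ^ 2 - ρ ^ 2))).hasDerivAt.comp_hasFDerivAt x h1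
    have h3 : fderiv ℝ (ψ n) x = deriv s (n * (‖x‖ ^ 2 - ρ ^ 2)) • (n : ℝ) • 2 • innerSL ℝ x :=
      h2.fderiv
    rw [h3, inner_eq_sum, Finset.mul_sum]
    refine Finset.sum_congr rfl fun i _ => ?_
    simp only [smul_apply, innerSL_single, smul_eq_mul, nsmul_eq_mul]
    push_cast
    ring
  have hint := fun n => integral_mul_divergence (hψ n) hF hc
  have hdi : Integrable (divergence F) :=
    (continuous_divergence hF).integrable_of_hasCompactSupport (hasCompactSupport_divergence hc)
  have hlim1 : Tendsto (fun n => ∫ x, ψ n x * divergence F x) atTop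
      (𝓝 (∫ x in {x : E3 | ρ < ‖x‖}, divergence F x)) := by
    rw [← integral_indicator (measurableSet_exterior ρ)]
    refine tendsto_integral_of_dominated_convergence (fun x => ‖divergence F x‖)
      (fun n => ((hψ n).continuous.mul (continuous_divergence hF)).aestronglyMeasurable) hdi.norm
      (fun n => Eventually.of_forall fun x => ?_) (Eventually.of_forall fun x => ?_)
    · rw [norm_mul]
      refine mul_le_of_le_one_left (norm_nonneg _) ?_
      rw [Real.norm_eq_abs, abs_of_nonneg (Real.smoothTransition.nonneg _)]
      exact Real.smoothTransition.le_one _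
    · by_cases hx : ρ < ‖x‖
      · rw [Set.indicator_of_mem (by exact hx)]
        have ht : 0 < ‖x‖ ^ 2 - ρ ^ 2 := by nlinarith
        refine tendsto_const_nhds.congr' ?_
        obtain ⟨N, hN⟩ := exists_nat_ge (‖x‖ ^ 2 - ρ ^ 2)⁻¹
        filter_upwards [eventually_ge_atTop N] with n hn
        have : 1 ≤ n * (‖x‖ ^ 2 - ρ ^ 2) := by
          have h1 : (‖x‖ ^ 2 - ρ ^ 2)⁻¹ ≤ n := hN.trans (by exact_mod_cast hn)
          calc (1 : ℝ) = (‖x‖ ^ 2 - ρ ^ 2)⁻¹ * (‖x‖ ^ 2 - ρ ^ 2) := by field_simp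
            _ ≤ _ := by gcongr
        simp only [ψ, hs, Real.smoothTransition.one_of_one_le this, one_mul]
      · rw [Set.indicator_of_notMem (by exact hx)]
        refine tendsto_const_nhds.congr fun n => ?_
        have : n * (‖x‖ ^ 2 - ρ ^ 2) ≤ 0 := by
          refine mul_nonpos_of_nonneg_of_nonpos (by positivity) ?_
          have := norm_nonneg x
          nlinarith
        simp only [ψ, hs, Real.smoothTransition.zero_of_nonpos this, zero_mul]
  have hlim2 : Tendsto (fun n : ℕ => ∫ x, ∑ i : Fin 3,
      fderiv ℝ (ψ n) x (EuclideanSpace.single i 1) * F x i) atTop (𝓝 0) := by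
    have hle : ∀ (n : ℕ) (x : E3), ‖∑ i : Fin 3,
        fderiv ℝ (ψ n) x (EuclideanSpace.single i 1) * F x i‖ ≤
        2 * K * |(n * (‖x‖ ^ 2 - ρ ^ 2)) * deriv s (n * (‖x‖ ^ 2 - ρ ^ 2))| := by
      intro n x
      rw [hgrad, Real.norm_eq_abs, abs_mul, abs_mul, abs_mul, abs_mul, abs_mul]
      by_cases hx : x = 0
      · subst hx; simp; positivity
      · calc _ ≤ |2| * |(n : ℝ)| * |deriv s (n * (‖x‖ ^ 2 - ρ ^ 2))| *
              (K * |‖x‖ ^ 2 - ρ ^ 2|) := by gcongr; exact hK x hx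
          _ = _ := by rw [abs_of_pos (by norm_num : (0 : ℝ) < 2)]; ring
    rw [← integral_zero E3 ℝ]
    refine tendsto_integral_of_dominated_convergence
      ((tsupport F).indicator fun _ => 2 * K * B) (fun n => ?_) ?_
      (fun n => Eventually.of_forall fun x => ?_) (Eventually.of_forall fun x => ?_)
    · refine Continuous.aestronglyMeasurable (continuous_finsetSum _ fun i _ => ?_)
      exact (continuous_fderiv_apply (hψ n) _).mul (contDiff_coord hF i).continuous
    · exact (integrable_indicator_iff (isClosed_tsupport F).measurableSet).2
        (integrableOn_const (hs := hc.isCompact.measure_lt_top.ne))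
    · by_cases hx : x ∈ tsupport F
      · rw [Set.indicator_of_mem hx]
        refine (hle n x).trans ?_
        gcongr
        exact hB _
      · rw [Set.indicator_of_notMem hx]
        simp [image_eq_zero_of_notMem_tsupport hx]
    · refine tendsto_const_nhds.congr' ?_
      -- On the sphere the bound `hle` is already 0; off it, the argument of s' leaves [0, 1] for
      -- large n.
      by_cases ht : ‖x‖ ^ 2 - ρ ^ 2 = 0
      · refine Eventually.of_forall fun n => ?_
        have := hle n x
        rw [ht] at this
        simp only [mul_zero, zero_mul, abs_zero] at this
        exact (norm_le_zero_iff.1 this).symm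
      · obtain ⟨N, hN⟩ := exists_nat_gt (‖x‖ ^ 2 - ρ ^ 2)⁻¹
        filter_upwards [eventually_ge_atTop N, eventually_gt_atTop 0] with n hn hn0
        have hz : (n : ℝ) * (‖x‖ ^ 2 - ρ ^ 2) ∉ Set.Icc (0 : ℝ) 1 := by
          have hn0' : (0 : ℝ) < n := by exact_mod_cast hn0
          rintro ⟨h1, h2⟩
          have h3 : 0 < ‖x‖ ^ 2 - ρ ^ 2 :=
            lt_of_le_of_ne (nonneg_of_mul_nonneg_right h1 hn0') (Ne.symm ht)
          have h4 : (‖x‖ ^ 2 - ρ ^ 2)⁻¹ < n := lt_of_lt_of_le hN (by exact_mod_cast hn)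
          rw [inv_lt_iff_one_lt_mul₀ h3] at h4
          linarith
        rw [hgrad, hs0 _ hz]
        simp
  have h := hlim2.neg
  simp only [← hint, neg_zero] at h
  exact tendsto_nhds_unique hlim1 h

/-- If a compactly supported vector field, of class `C¹` away from the origin, is tangential to the
sphere `|x| = ρ`, then the integral of its divergence over the exterior of this sphere vanishes. -/
lemma integral_divergence_exterior {F : E3 → E3} (hF : ∀ x, x ≠ 0 → ContDiffAt ℝ 1 F x)
    (hc : HasCompactSupport F) {ρ : ℝ} (hρ : 0 < ρ)
    (h0 : ∀ x, ‖x‖ = ρ → inner ℝ x (F x) = 0) :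
    ∫ x in {x : E3 | ρ < ‖x‖}, divergence F x = 0 := by
  -- Multiplying by 1 - b removes a possible singularity at the origin and changes nothing where |x|
  -- > ρ/2.
  let b : ContDiffBump (0 : E3) := ⟨ρ / 4, ρ / 2, by positivity, by linarith⟩
  let G : E3 → E3 := fun x => (1 - b x) • F x
  have hG : ContDiff ℝ 1 G := by
    rw [contDiff_iff_contDiffAt]
    intro x
    by_cases hx : x = 0
    · subst hx
      have : G =ᶠ[𝓝 0] fun _ => 0 := by
        filter_upwards [Metric.ball_mem_nhds (0 : E3) (by positivity : 0 < ρ / 4)] with y hy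
        simp [G, b.one_of_mem_closedBall (Metric.ball_subset_closedBall hy)]
      exact contDiffAt_const.congr_of_eventuallyEq this
    · exact (contDiffAt_const.sub b.contDiffAt).smul (hF x hx)
  have hGF : ∀ x : E3, ρ / 2 < ‖x‖ → G x = F x := by
    intro x hx
    have : b x = 0 := b.zero_of_le_dist (by simpa using hx.le)
    simp [G, this]
  have hGc : HasCompactSupport G := hc.mono fun x hx hx' => hx (by simp [G, hx'])
  rw [← integral_divergence_exterior_of_contDiff hG hGc hρ fun x hx => by
    rw [hGF x (by linarith), h0 x hx]]
  refine setIntegral_congr_fun (measurableSet_exterior ρ) fun x hx => ?_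
  have hx' : ρ < ‖x‖ := hx
  have : F =ᶠ[𝓝 x] G := by
    filter_upwards [(isOpen_lt continuous_const continuous_norm).mem_nhds
      (show ρ / 2 < ‖x‖ by linarith)] with y hy
    exact (hGF y hy).symm
  simp only [divergence, this.fderiv_eq]

end

/-! ### Weak gradients and fluxes of multipoles cut off at a sphere. -/

section

open MeasureTheory Filter Topology MvPolynomial

/-! ### Locally square integrable functions -/

/-- Local square integrability on `ℝ³`. -/
def LocL2 {V : Type*} [NormedAddCommGroup V] (f : E3 → V) : Prop :=
  ∀ K : Set E3, IsCompact K → MemLp f 2 (volume.restrict K)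

section LocL2

variable {V : Type*} [NormedAddCommGroup V]

lemma LocL2.add {f g : E3 → V} (hf : LocL2 f) (hg : LocL2 g) : LocL2 fun x => f x + g x :=
  fun K hK => (hf K hK).add (hg K hK)

lemma locL2_sum {ι : Type*} (t : Finset ι) {f : ι → E3 → V} (hf : ∀ j ∈ t, LocL2 (f j)) :
    LocL2 fun x => ∑ j ∈ t, f j x :=
  fun K hK => memLp_finsetSum t fun j hj => hf j hj K hK

lemma LocL2.aestronglyMeasurable {f : E3 → V} (hf : LocL2 f) :
    AEStronglyMeasurable f volume := by
  have h : (⋃ n : ℕ, Metric.closedBall (0 : E3) n) = Set.univ := by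
    ext x
    simp only [Set.mem_iUnion, Metric.mem_closedBall, dist_zero_right, Set.mem_univ, iff_true]
    exact exists_nat_ge _
  rw [← Measure.restrict_univ (μ := volume), ← h, aestronglyMeasurable_iUnion_iff]
  exact fun n => (hf _ (isCompact_closedBall _ _)).1

lemma LocL2.locallyIntegrable {f : E3 → V} (hf : LocL2 f) : LocallyIntegrable f := by
  rw [locallyIntegrable_iff]
  intro K hK
  have : IsFiniteMeasure (volume.restrict K) := ⟨by simpa using hK.measure_lt_top⟩
  exact (hf K hK).integrable (by norm_num)

lemma locL2_of_bound {f : E3 → V} (hm : AEStronglyMeasurable f volume)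
    (hb : ∀ R : ℝ, ∃ C : ℝ, ∀ x, ‖x‖ ≤ R → ‖f x‖ ≤ C) : LocL2 f := by
  intro K hK
  have : IsFiniteMeasure (volume.restrict K) := ⟨by simpa using hK.measure_lt_top⟩
  obtain ⟨R, hR⟩ := hK.isBounded.subset_closedBall 0
  obtain ⟨C, hC⟩ := hb R
  refine MemLp.of_bound hm.restrict C ?_
  filter_upwards [ae_restrict_mem hK.measurableSet] with x hx
  exact hC x (by simpa using hR hx)

lemma locL2_of_continuous {f : E3 → V} (hf : Continuous f)  : LocL2 f := by
  refine locL2_of_bound hf.aestronglyMeasurable fun R => ?_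
  obtain ⟨C, hC⟩ := (isCompact_closedBall (0 : E3) R).exists_bound_of_continuousOn hf.continuousOn
  exact ⟨C, fun x hx => hC x (by simpa using hx)⟩

lemma locL2_indicator_exterior {f : E3 → V} (hf : ∀ x, x ≠ 0 → ContinuousAt f x) {ρ : ℝ}
    (hρ : 0 < ρ) : LocL2 ({x : E3 | ρ < ‖x‖}.indicator f) := by
  have hne : ∀ x : E3, ρ ≤ ‖x‖ → x ≠ 0 := fun x hx h => by
    rw [h, norm_zero] at hx; linarith
  refine locL2_of_bound ?_ fun R => ?_
  · rw [aestronglyMeasurable_indicator_iff (measurableSet_exterior ρ)]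
    refine ContinuousOn.aestronglyMeasurable (fun x hx => ?_) (measurableSet_exterior ρ)
    exact (hf x (hne x (le_of_lt hx))).continuousWithinAt
  · have hc : IsCompact (Metric.closedBall (0 : E3) R ∩ {x | ρ ≤ ‖x‖}) :=
      (isCompact_closedBall _ _).inter_right (isClosed_le continuous_const continuous_norm)
    obtain ⟨C, hC⟩ := hc.exists_bound_of_continuousOn (f := f) fun x hx =>
      (hf x (hne x hx.2)).continuousWithinAt
    refine ⟨max C 0, fun x hx => ?_⟩
    by_cases h : ρ < ‖x‖
    · rw [Set.indicator_of_mem (by exact h)]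
      exact (hC x ⟨by simpa using hx, h.le⟩).trans (le_max_left _ _)
    · rw [Set.indicator_of_notMem (by exact h), norm_zero]
      exact le_max_right _ _

lemma LocL2.bdd_smul [NormedSpace ℝ V] {f : E3 → V} (hf : LocL2 f) {c : E3 → ℝ}
    (hc : AEStronglyMeasurable c volume) {C : ℝ} (hC : ∀ x, |c x| ≤ C) :
    LocL2 fun x => c x • f x := fun K hK =>
  (hf K hK).of_le_mul (c := C) (hc.restrict.smul (hf K hK).1) (Eventually.of_forall fun x => by
    rw [norm_smul]
    exact mul_le_mul_of_nonneg_right (hC x) (norm_nonneg _))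

end LocL2

lemma continuous_gradient {φ : E3 → ℝ} (hφ : ContDiff ℝ 1 φ) : Continuous (gradient φ) :=
  (InnerProductSpace.toDual ℝ E3).symm.continuous.comp (hφ.continuous_fderiv (by simp))

lemma hasCompactSupport_gradient {φ : E3 → ℝ} (hφ : HasCompactSupport φ) :
    HasCompactSupport (gradient φ) :=
  (hφ.fderiv ℝ).comp_left (g := (InnerProductSpace.toDual ℝ E3).symm) (by simp)

lemma LocL2.integrable_inner {g Φ : E3 → E3} (hg : LocL2 g) (hΦ : Continuous Φ)
    (hc : HasCompactSupport Φ) : Integrable fun x => inner ℝ (g x) (Φ x) := by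
  have h1 : Integrable fun x => ‖Φ x‖ • g x :=
    hg.locallyIntegrable.integrable_smul_left_of_hasCompactSupport hΦ.norm hc.norm
  refine h1.mono (hg.aestronglyMeasurable.inner hΦ.aestronglyMeasurable)
    (Eventually.of_forall fun x => ?_)
  rw [norm_smul, norm_norm, mul_comm]
  exact norm_inner_le_norm _ _

lemma LocL2.integrable_mul {u : E3 → ℝ} (hu : LocL2 u) {φ : E3 → ℝ} (hφ : Continuous φ)
    (hc : HasCompactSupport φ) : Integrable fun x => u x * φ x :=
  hu.locallyIntegrable.integrable_smul_right_of_hasCompactSupport hφ hc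

lemma LocL2.integrable_smul_vector {u : E3 → ℝ} (hu : LocL2 u) {Φ : E3 → E3} (hΦ : Continuous Φ)
    (hc : HasCompactSupport Φ) : Integrable fun x => u x • Φ x :=
  hu.locallyIntegrable.integrable_smul_right_of_hasCompactSupport hΦ hc

lemma LocL2.integrable_vector_smul {g : E3 → E3} (hg : LocL2 g) {φ : E3 → ℝ} (hφ : Continuous φ)
    (hc : HasCompactSupport φ) : Integrable fun x => φ x • g x :=
  hg.locallyIntegrable.integrable_smul_left_of_hasCompactSupport hφ hc

lemma LocL2.coord {g : E3 → E3} (hg : LocL2 g) (i : Fin 3) : LocL2 fun x => g x i :=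
  fun K hK => (hg K hK).of_le ((EuclideanSpace.proj i : E3 →L[ℝ] ℝ).continuous.comp_aestronglyMeasurable
    (hg K hK).1) (Eventually.of_forall fun x => PiLp.norm_apply_le (g x) i)

lemma integral_coord {f : E3 → E3} (hf : Integrable f) (i : Fin 3) :
    (∫ x, f x) i = ∫ x, f x i :=
  ((EuclideanSpace.proj i : E3 →L[ℝ] ℝ).integral_comp_comm hf).symm

lemma isWeakGradient_of_coord {u : E3 → ℝ} {g : E3 → E3} (hu : LocL2 u) (hg : LocL2 g)
    (h : ∀ φ : E3 → ℝ, ContDiff ℝ 1 φ → HasCompactSupport φ → ∀ i : Fin 3,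
      ∫ x, (u x * fderiv ℝ φ x (EuclideanSpace.single i 1) + φ x * g x i) = 0) :
    IsWeakGradient u g := by
  intro φ hφ hc
  have hφ1 : ContDiff ℝ 1 φ := hφ.of_le (by exact_mod_cast le_top)
  have h1 := hu.integrable_smul_vector (continuous_gradient hφ1) (hasCompactSupport_gradient hc)
  have h2 := hg.integrable_vector_smul hφ1.continuous hc
  ext i
  have h3 := h φ hφ1 hc i
  rw [integral_add (hu.integrable_mul (continuous_fderiv_apply hφ1 _)
    (hasCompactSupport_fderiv_apply hc _)) (by
      simpa only [mul_comm] using (hg.coord i).integrable_mul hφ1.continuous hc)] at h3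
  rw [PiLp.neg_apply, integral_coord h1, integral_coord h2]
  simp only [PiLp.smul_apply, gradient_apply, smul_eq_mul]
  linarith

lemma isWeakGradient_add {u v : E3 → ℝ} {g h : E3 → E3} (hu : LocL2 u) (hg : LocL2 g)
    (hv : LocL2 v) (hh : LocL2 h) (h1 : IsWeakGradient u g) (h2 : IsWeakGradient v h) :
    IsWeakGradient (fun x => u x + v x) (fun x => g x + h x) := by
  intro φ hφ hc
  have hφ1 : ContDiff ℝ 1 φ := hφ.of_le (by exact_mod_cast le_top)
  have hG := continuous_gradient hφ1
  have hGc := hasCompactSupport_gradient hc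
  simp only [add_smul, smul_add]
  rw [integral_add (hu.integrable_smul_vector hG hGc) (hv.integrable_smul_vector hG hGc),
    integral_add (hg.integrable_vector_smul hφ1.continuous hc)
      (hh.integrable_vector_smul hφ1.continuous hc), h1 φ hφ hc, h2 φ hφ hc, neg_add]

lemma isWeakGradient_const_smul {u : E3 → ℝ} {g : E3 → E3} (c : ℝ) (h : IsWeakGradient u g) :
    IsWeakGradient (fun x => c * u x) (fun x => c • g x) := by
  intro φ hφ hc
  have h1 := h φ hφ hc
  simp only [mul_smul, smul_comm _ c, integral_smul, h1, smul_neg]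

/-! ### Multipoles outside a sphere -/

lemma divergence_smul {φ : E3 → ℝ} {V : E3 → E3} {x : E3} (hφ : DifferentiableAt ℝ φ x)
    (hV : DifferentiableAt ℝ V x) : divergence (fun y => φ y • V y) x =
      inner ℝ (V x) (gradient φ x) + φ x * divergence V x := by
  have h := (hφ.hasFDerivAt.smul hV.hasFDerivAt).fderiv
  change fderiv ℝ (fun y => φ y • V y) x = _ at h
  rw [divergence, h, inner_eq_sum, divergence, Finset.mul_sum, ← Finset.sum_add_distrib]
  refine Finset.sum_congr rfl fun i _ => ?_
  simp [gradient_apply]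
  ring

lemma divergence_const (v : E3) (x : E3) : divergence (fun _ => v) x = 0 := by
  simp [divergence]

/-- `h0` says that the multipole vanishes on the sphere, so extending it by 0 inside creates no
surface term: the field (multipole · φ) eᵢ vanishes there and is trivially tangential. -/
lemma isWeakGradient_multipole (k : ℕ) (p : MvPolynomial (Fin 3) ℝ) {a b ρ : ℝ} (hρ : 0 < ρ)
    (h0 : a + b * (ρ ^ (2 * k + 1))⁻¹ = 0) :
    IsWeakGradient ({x : E3 | ρ < ‖x‖}.indicator (multipole k p a b))
      ({x : E3 | ρ < ‖x‖}.indicator (multipoleGrad k p a b)) := by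
  refine isWeakGradient_of_coord
    (locL2_indicator_exterior (fun x hx => (contDiffAt_multipole (m := 0) k p a b hx).continuousAt) hρ)
    (locL2_indicator_exterior
      (fun x hx => (contDiffAt_multipoleGrad (m := 0) k p a b hx).continuousAt) hρ)
    fun φ hφ hc i => ?_
  have key := integral_divergence_exterior
    (F := fun x => (multipole k p a b x * φ x) • EuclideanSpace.single i (1 : ℝ)) (ρ := ρ)
    (fun x hx => ((contDiffAt_multipole k p a b hx).mul hφ.contDiffAt).smul contDiffAt_const)
    (hc.mono fun x hx hx' => hx (by simp [hx'])) hρ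
    (fun x hx => by simp [multipole, hx, h0])
  rw [← key, ← integral_indicator (measurableSet_exterior ρ)]
  congr 1
  funext x
  by_cases hx : ρ < ‖x‖
  · have hx0 : x ≠ 0 := fun h => by rw [h, norm_zero] at hx; linarith
    have hm : DifferentiableAt ℝ (multipole k p a b) x :=
      (contDiffAt_multipole (m := 1) k p a b hx0).differentiableAt (by simp)
    have hφx : DifferentiableAt ℝ φ x := hφ.differentiable (by simp) x
    rw [Set.indicator_of_mem (by exact hx), Set.indicator_of_mem (by exact hx),
      Set.indicator_of_mem (by exact hx),
      divergence_smul (φ := fun y => multipole k p a b y * φ y) (hm.mul hφx) (differentiableAt_const _),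
      divergence_const, mul_zero, add_zero, EuclideanSpace.inner_single_left, gradient_apply]
    have h := (hm.hasFDerivAt.mul hφx.hasFDerivAt).fderiv
    change fderiv ℝ (fun y => multipole k p a b y * φ y) x = _ at h
    rw [h]
    simp [fderiv_multipole k p a b hx0]
  · rw [Set.indicator_of_notMem (by exact hx), Set.indicator_of_notMem (by exact hx),
      Set.indicator_of_notMem (by exact hx)]
    simp

/-- Here `h0` annihilates the radial flux rather than the value, so φ times the gradient is
tangential and divergence-freeness leaves only ∇φ. -/
lemma integral_inner_multipoleGrad {k : ℕ} {p : MvPolynomial (Fin 3) ℝ}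
    (hp : p ∈ solidHarmonics k) {a b ρ : ℝ} (hρ : 0 < ρ)
    (h0 : k * a - (k + 1) * (b * (ρ ^ (2 * k + 1))⁻¹) = 0) {φ : E3 → ℝ} (hφ : ContDiff ℝ 1 φ)
    (hc : HasCompactSupport φ) :
    ∫ x, inner ℝ ({x : E3 | ρ < ‖x‖}.indicator (multipoleGrad k p a b) x) (gradient φ x) = 0 := by
  have hne : ∀ x : E3, ρ ≤ ‖x‖ → x ≠ 0 := fun x hx h => by
    rw [h, norm_zero] at hx; linarith
  have key := integral_divergence_exterior
    (F := fun x => φ x • multipoleGrad k p a b x) (ρ := ρ)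
    (fun x hx => hφ.contDiffAt.smul (contDiffAt_multipoleGrad k p a b hx))
    (hc.mono fun x hx hx' => hx (by simp [hx'])) hρ
    (fun x hx => by
      rw [inner_smul_right, inner_multipoleGrad (mem_solidHarmonics.1 hp).1 a b (hne x hx.ge), hx, h0,
        zero_mul, mul_zero])
  rw [← key, ← integral_indicator (measurableSet_exterior ρ)]
  congr 1
  funext x
  by_cases hx : ρ < ‖x‖
  · have hx0 := hne x hx.le
    rw [Set.indicator_of_mem (by exact hx), Set.indicator_of_mem (by exact hx),
      divergence_smul (hφ.differentiable (by simp) x)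
        ((contDiffAt_multipoleGrad (m := 1) k p a b hx0).differentiableAt (by simp)),
      divergence_multipoleGrad hp a b hx0, mul_zero, add_zero]
  · rw [Set.indicator_of_notMem (by exact hx), Set.indicator_of_notMem (by exact hx), inner_zero_left]

lemma integral_divergence {F : E3 → E3} (hF : ContDiff ℝ 1 F) (hc : HasCompactSupport F) :
    ∫ x, divergence F x = 0 := by
  have h := integral_mul_divergence (ψ := fun _ => 1) contDiff_const hF hc
  simpa using h

lemma contDiff_polyGrad {m : WithTop ℕ∞} (p : MvPolynomial (Fin 3) ℝ) :
    ContDiff ℝ m (polyGrad p) :=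
  contDiff_euclidean.2 fun i => contDiff_polyFun (pderiv i p)

lemma divergence_polyGrad (p : MvPolynomial (Fin 3) ℝ) (x : E3) :
    divergence (polyGrad p) x = polyFun (polyLaplacian p) x := by
  rw [divergence_eq ((contDiff_polyGrad (m := 1) p).differentiable (by simp) x),
    polyLaplacian_apply, polyFun_sum]
  exact Finset.sum_congr rfl fun i _ => fderiv_polyFun _ i x

lemma isWeakGradient_polyFun (p : MvPolynomial (Fin 3) ℝ) :
    IsWeakGradient (polyFun p) (polyGrad p) := by
  refine isWeakGradient_of_coord (locL2_of_continuous (continuous_polyFun p))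
    (locL2_of_continuous (contDiff_polyGrad (m := 0) p).continuous) fun φ hφ hc i => ?_
  have key := integral_divergence
    (F := fun x => (polyFun p x * φ x) • EuclideanSpace.single i (1 : ℝ))
    (((contDiff_polyFun p).mul hφ).smul contDiff_const)
    (hc.mono fun x hx hx' => hx (by simp [hx']))
  rw [← key]
  congr 1
  funext x
  have hm := differentiableAt_polyFun p x
  have hφx : DifferentiableAt ℝ φ x := hφ.differentiable (by simp) x
  rw [divergence_smul (φ := fun y => polyFun p y * φ y) (hm.mul hφx) (differentiableAt_const _),
    divergence_const, mul_zero, add_zero, EuclideanSpace.inner_single_left, gradient_apply]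
  have h := (hm.hasFDerivAt.mul hφx.hasFDerivAt).fderiv
  change fderiv ℝ (fun y => polyFun p y * φ y) x = _ at h
  rw [h]
  simp [fderiv_polyFun, polyGrad_apply]

lemma integral_inner_polyGrad {p : MvPolynomial (Fin 3) ℝ} (hp : polyLaplacian p = 0) {φ : E3 → ℝ}
    (hφ : ContDiff ℝ 1 φ) (hc : HasCompactSupport φ) :
    ∫ x, inner ℝ (polyGrad p x) (gradient φ x) = 0 := by
  have key := integral_divergence (F := fun x => φ x • polyGrad p x)
    (hφ.smul (contDiff_polyGrad p)) (hc.mono fun x hx hx' => hx (by simp [hx']))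
  rw [← key]
  congr 1
  funext x
  rw [divergence_smul (hφ.differentiable (by simp) x)
    ((contDiff_polyGrad (m := 1) p).differentiable (by simp) x), divergence_polyGrad, hp,
    polyFun_zero, mul_zero, add_zero]

end

/-! ### Superposition, and piecewise multipoles as weak solutions. -/

section

open MeasureTheory Filter Topology MvPolynomial

/-! ### Weak solutions -/

/-- `u` with weak gradient `g` is a weak solution of `∇ · (σ ∇u) = 0`. -/
structure IsWeakSolution (σ u : E3 → ℝ) (g : E3 → E3) : Prop where
  locL2 : LocL2 u
  locL2_grad : LocL2 g
  isWeakGradient : IsWeakGradient u g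
  integral_eq_zero : ∀ φ : E3 → ℝ, ContDiff ℝ (⊤ : ℕ∞) φ → HasCompactSupport φ →
    ∫ x, σ x * inner ℝ (g x) (gradient φ x) = 0

lemma isSolution_iff {σ H u : E3 → ℝ} : IsSolution σ H u ↔
    (∃ g, IsWeakSolution σ u g) ∧ ∃ C R : ℝ, ∀ᵐ x : E3, R < ‖x‖ → |u x - H x| ≤ C / ‖x‖ := by
  constructor
  · rintro ⟨⟨g, h1, h2, h3⟩, h4⟩
    exact ⟨⟨g, fun K hK => (h1 K hK).1, fun K hK => (h1 K hK).2, h2, h3⟩, h4⟩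
  · rintro ⟨⟨g, h1, h2, h3, h4⟩, h5⟩
    exact ⟨⟨g, fun K hK => ⟨h1 K hK, h2 K hK⟩, h3, h4⟩, h5⟩

lemma integrable_mul_inner {σ : E3 → ℝ} (hm : AEStronglyMeasurable σ volume) {C : ℝ}
    (hb : ∀ x, |σ x| ≤ C) {g Φ : E3 → E3} (hg : LocL2 g) (hΦ : Continuous Φ)
    (hc : HasCompactSupport Φ) : Integrable fun x => σ x * inner ℝ (g x) (Φ x) := by
  have h := (hg.bdd_smul hm hb).integrable_inner hΦ hc
  simpa only [real_inner_smul_left] using h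

lemma IsWeakSolution.add {σ u v : E3 → ℝ} {g h : E3 → E3} (hm : AEStronglyMeasurable σ volume)
    {C : ℝ} (hb : ∀ x, |σ x| ≤ C) (hu : IsWeakSolution σ u g) (hv : IsWeakSolution σ v h) :
    IsWeakSolution σ (fun x => u x + v x) (fun x => g x + h x) where
  locL2 := hu.locL2.add hv.locL2
  locL2_grad := hu.locL2_grad.add hv.locL2_grad
  isWeakGradient := isWeakGradient_add hu.locL2 hu.locL2_grad hv.locL2 hv.locL2_grad
    hu.isWeakGradient hv.isWeakGradient
  integral_eq_zero φ hφ hc := by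
    have hφ1 : ContDiff ℝ 1 φ := hφ.of_le (by exact_mod_cast le_top)
    have hG := continuous_gradient hφ1
    have hGc := hasCompactSupport_gradient hc
    simp only [inner_add_left, mul_add]
    rw [integral_add (integrable_mul_inner hm hb hu.locL2_grad hG hGc)
      (integrable_mul_inner hm hb hv.locL2_grad hG hGc), hu.integral_eq_zero φ hφ hc,
      hv.integral_eq_zero φ hφ hc, add_zero]

lemma IsWeakSolution.const_mul {σ u : E3 → ℝ} {g : E3 → E3} (c : ℝ) (hu : IsWeakSolution σ u g) :
    IsWeakSolution σ (fun x => c * u x) (fun x => c • g x) where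
  locL2 := fun K hK => (hu.locL2 K hK).const_mul c
  locL2_grad := fun K hK => (hu.locL2_grad K hK).const_smul c
  isWeakGradient := isWeakGradient_const_smul c hu.isWeakGradient
  integral_eq_zero φ hφ hc := by
    simp only [real_inner_smul_left, mul_left_comm _ c]
    rw [integral_const_mul, hu.integral_eq_zero φ hφ hc, mul_zero]

lemma isWeakSolution_zero (σ : E3 → ℝ) : IsWeakSolution σ (fun _ => 0) (fun _ => 0) where
  locL2 := locL2_of_continuous continuous_const
  locL2_grad := locL2_of_continuous continuous_const
  isWeakGradient := fun φ _ _ => by simp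
  integral_eq_zero := fun φ _ _ => by simp

lemma isWeakSolution_sum {ι : Type*} (t : Finset ι) {σ : E3 → ℝ}
    (hm : AEStronglyMeasurable σ volume) {C : ℝ} (hb : ∀ x, |σ x| ≤ C) {u : ι → E3 → ℝ}
    {g : ι → E3 → E3} (h : ∀ j, IsWeakSolution σ (u j) (g j)) :
    IsWeakSolution σ (fun x => ∑ j ∈ t, u j x) (fun x => ∑ j ∈ t, g j x) := by
  classical
  induction t using Finset.induction_on with
  | empty => simpa using isWeakSolution_zero σ
  | insert j t hj ih =>
    simp only [Finset.sum_insert hj]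
    exact (h j).add hm hb ih

/-! ### The layered structure -/

/-- The function equal to `f j` in the `j`-th region. -/
def layered {V : Type*} [AddCommGroup V] (L : ℕ) (r : ℕ → ℝ) (f : ℕ → E3 → V) (x : E3) : V :=
  f (L + 1) x + ∑ j ∈ Finset.range (L + 1),
    {x : E3 | r (j + 1) < ‖x‖}.indicator (fun x => f j x - f (j + 1) x) x

lemma radius_antitone {L : ℕ} {r : ℕ → ℝ} (hrr : ∀ j, 1 ≤ j → j ≤ L → r (j + 1) < r j) {i j : ℕ}
    (hi : 1 ≤ i) (hij : i ≤ j) (hj : j ≤ L + 1) : r j ≤ r i := by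
  induction j, hij using Nat.le_induction with
  | base => rfl
  | succ j hij ih => exact (hrr j (hi.trans hij) (by omega)).le.trans (ih (by omega))

/-- J is the index of the region of x. A point with |x| = r_{j+1} counts as lying on the inner side.
-/
lemma exists_layer {L : ℕ} {r : ℕ → ℝ} (hrr : ∀ j, 1 ≤ j → j ≤ L → r (j + 1) < r j) (x : E3) :
    ∃ J, J ≤ L + 1 ∧ ∀ j, j ≤ L → (r (j + 1) < ‖x‖ ↔ J ≤ j) := by
  classical
  have hex : ∃ J, J = L + 1 ∨ r (J + 1) < ‖x‖ := ⟨L + 1, Or.inl rfl⟩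
  refine ⟨Nat.find hex, Nat.find_min' hex (Or.inl rfl), fun j hj => ⟨fun h =>
    Nat.find_min' hex (Or.inr h), fun h => ?_⟩⟩
  rcases Nat.find_spec hex with h1 | h1
  · omega
  · exact lt_of_le_of_lt (radius_antitone hrr (by omega) (by omega) (by omega)) h1

/-- The jumps telescope from J to L + 1. The form of `layered` as a core field plus jumps lets every
interface be treated separately. -/
lemma layered_eq {V : Type*} [AddCommGroup V] {L : ℕ} {r : ℕ → ℝ} {x : E3} {J : ℕ}
    (hJ : J ≤ L + 1) (h : ∀ j, j ≤ L → (r (j + 1) < ‖x‖ ↔ J ≤ j)) (f : ℕ → E3 → V) :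
    layered L r f x = f J x := by
  have key : ∀ n, ∑ j ∈ Finset.range n, (if J ≤ j then f j x - f (j + 1) x else 0) =
      if J ≤ n then f J x - f n x else 0 := by
    intro n
    induction n with
    | zero => by_cases h : J ≤ 0 <;> simp_all
    | succ n ih =>
      rw [Finset.sum_range_succ, ih]
      by_cases h1 : J ≤ n
      · simp [h1, Nat.le_succ_of_le h1]
      · by_cases h2 : J = n + 1
        · simp [h2]
        · simp [h1, show ¬ J ≤ n + 1 by omega]
  have h2 : ∀ j ∈ Finset.range (L + 1),
      {x : E3 | r (j + 1) < ‖x‖}.indicator (fun x => f j x - f (j + 1) x) x =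
        if J ≤ j then f j x - f (j + 1) x else 0 := by
    intro j hj
    have hj' : j ≤ L := by simpa [Nat.lt_succ_iff] using hj
    by_cases hh : J ≤ j
    · rw [if_pos hh, Set.indicator_of_mem (by exact (h j hj').2 hh)]
    · rw [if_neg hh, Set.indicator_of_notMem (by exact fun h' => hh ((h j hj').1 h'))]
  rw [layered, Finset.sum_congr rfl h2, key, if_pos hJ]
  abel

/-- With decreasing radii the sphere |x| = r_{L+1} lies in no region, since the core is an open
ball; it is excluded here and is a null set in the applications. -/
lemma conductivity_eq {L : ℕ} {s r : ℕ → ℝ} {x : E3} (hx : ‖x‖ ≠ r (L + 1)) {J : ℕ}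
    (hJ : J ≤ L + 1) (h : ∀ j, j ≤ L → (r (j + 1) < ‖x‖ ↔ J ≤ j)) : conductivity L s r x = s J := by
  classical
  have h1 : ∀ j ∈ Finset.range (L + 2), (region L r j).indicator (fun _ => s j) x =
      if j = J then s J else 0 := by
    intro j hj
    have hj' : j ≤ L + 1 := by simpa [Nat.lt_succ_iff] using hj
    have hmem : x ∈ region L r j ↔ j = J := by
      unfold region
      split_ifs with h0 hL
      · subst h0
        rw [Set.mem_ofPred_eq, h 0 (by omega)]; omega
      · subst hL
        rw [Metric.mem_ball, dist_zero_right]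
        have := h L le_rfl
        constructor
        · intro hlt
          have : ¬ J ≤ L := fun h' => by linarith [this.2 h']
          omega
        · intro he
          have : ¬ r (L + 1) < ‖x‖ := fun h' => by have := this.1 h'; omega
          exact lt_of_le_of_ne (not_lt.1 this) hx
      · obtain ⟨i, rfl⟩ := Nat.exists_eq_succ_of_ne_zero h0
        rw [Set.mem_ofPred_eq, h _ (by omega), ← not_lt (a := r i.succ), h i (by omega)]
        omega
    by_cases hjJ : j = J
    · rw [if_pos hjJ, Set.indicator_of_mem (hmem.2 hjJ), hjJ]
    · rw [if_neg hjJ, Set.indicator_of_notMem fun h' => hjJ (hmem.1 h')]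
  rw [conductivity, Finset.sum_congr rfl h1, Finset.sum_ite_eq']
  simp [Nat.lt_succ_iff, hJ]

lemma measurableSet_region (L : ℕ) (r : ℕ → ℝ) (j : ℕ) : MeasurableSet (region L r j) := by
  unfold region
  split_ifs
  · exact measurableSet_exterior _
  · exact Metric.isOpen_ball.measurableSet
  · exact (measurableSet_exterior _).inter (measurableSet_le measurable_norm measurable_const)

lemma aestronglyMeasurable_conductivity (L : ℕ) (s r : ℕ → ℝ) :
    AEStronglyMeasurable (conductivity L s r) volume := by
  have : Measurable (conductivity L s r) :=
    Finset.measurable_sum _ fun j _ => measurable_const.indicator (measurableSet_region L r j)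
  exact this.aestronglyMeasurable

lemma abs_conductivity_le (L : ℕ) (s r : ℕ → ℝ) (x : E3) :
    |conductivity L s r x| ≤ ∑ j ∈ Finset.range (L + 2), |s j| := by
  refine (Finset.abs_sum_le_sum_abs _ _).trans (Finset.sum_le_sum fun j _ => ?_)
  by_cases h : x ∈ region L r j
  · rw [Set.indicator_of_mem h]
  · rw [Set.indicator_of_notMem h, abs_zero]; positivity

lemma conductivity_nonneg {L : ℕ} {s : ℕ → ℝ} (r : ℕ → ℝ) (hs : ∀ j, j ≤ L + 1 → 0 ≤ s j) (x : E3) :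
    0 ≤ conductivity L s r x :=
  Finset.sum_nonneg fun j hj => Set.indicator_nonneg (fun _ _ => hs j (by
    simpa [Nat.lt_succ_iff] using hj)) x

lemma ae_norm_ne (ρ : ℝ) : ∀ᵐ x : E3, ‖x‖ ≠ ρ := by
  have h : volume (Metric.sphere (0 : E3) ρ) = 0 := Measure.addHaar_sphere _ _ _
  rw [ae_iff]
  convert h using 2
  ext x; simp

/-! ### The field of a single mode -/

lemma multipole_sub (k : ℕ) (p : MvPolynomial (Fin 3) ℝ) (a b a' b' : ℝ) (x : E3) :
    multipole k p a b x - multipole k p a' b' x = multipole k p (a - a') (b - b') x := by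
  simp only [multipole]; ring

lemma multipoleGrad_sub (k : ℕ) (p : MvPolynomial (Fin 3) ℝ) (a b a' b' : ℝ) (x : E3) :
    multipoleGrad k p a b x - multipoleGrad k p a' b' x =
      multipoleGrad k p (a - a') (b - b') x := by
  ext i
  simp only [multipoleGrad_apply, PiLp.sub_apply]; ring

lemma smul_multipoleGrad (k : ℕ) (p : MvPolynomial (Fin 3) ℝ) (c a b : ℝ) (x : E3) :
    c • multipoleGrad k p a b x = multipoleGrad k p (c * a) (c * b) x := by
  ext i
  simp only [multipoleGrad_apply, PiLp.smul_apply, smul_eq_mul]; ring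

lemma multipole_zero (k : ℕ) (p : MvPolynomial (Fin 3) ℝ) (a : ℝ) (x : E3) :
    multipole k p a 0 x = a * polyFun p x := by
  simp [multipole]

lemma multipoleGrad_zero (k : ℕ) (p : MvPolynomial (Fin 3) ℝ) (a : ℝ) (x : E3) :
    multipoleGrad k p a 0 x = a • polyGrad p x := by
  simp [multipoleGrad]

lemma layered_multipole (L : ℕ) (r : ℕ → ℝ) (k : ℕ) (p : MvPolynomial (Fin 3) ℝ) {a b : ℕ → ℝ}
    (hb : b (L + 1) = 0) : layered L r (fun j => multipole k p (a j) (b j)) =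
      fun x => a (L + 1) * polyFun p x + ∑ j ∈ Finset.range (L + 1),
        {x : E3 | r (j + 1) < ‖x‖}.indicator
          (multipole k p (a j - a (j + 1)) (b j - b (j + 1))) x := by
  funext x
  rw [layered, hb, multipole_zero]
  simp only [multipole_sub]

lemma layered_multipoleGrad (L : ℕ) (r : ℕ → ℝ) (k : ℕ) (p : MvPolynomial (Fin 3) ℝ) {a b : ℕ → ℝ}
    (hb : b (L + 1) = 0) : layered L r (fun j => multipoleGrad k p (a j) (b j)) =
      fun x => a (L + 1) • polyGrad p x + ∑ j ∈ Finset.range (L + 1),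
        {x : E3 | r (j + 1) < ‖x‖}.indicator
          (multipoleGrad k p (a j - a (j + 1)) (b j - b (j + 1))) x := by
  funext x
  rw [layered, hb, multipoleGrad_zero]
  simp only [multipoleGrad_sub]

lemma isWeakGradient_sum {ι : Type*} (t : Finset ι) {u : ι → E3 → ℝ} {g : ι → E3 → E3}
    (hu : ∀ j ∈ t, LocL2 (u j)) (hg : ∀ j ∈ t, LocL2 (g j))
    (h : ∀ j ∈ t, IsWeakGradient (u j) (g j)) :
    IsWeakGradient (fun x => ∑ j ∈ t, u j x) (fun x => ∑ j ∈ t, g j x) := by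
  classical
  induction t using Finset.induction_on with
  | empty => intro φ _ _; simp
  | insert j t hj ih =>
    simp only [Finset.sum_insert hj]
    simp only [Finset.mem_insert, forall_eq_or_imp] at hu hg h
    exact isWeakGradient_add hu.1 hg.1 (locL2_sum t hu.2) (locL2_sum t hg.2) h.1
      (ih hu.2 hg.2 h.2)

/-- Coefficients satisfying the transmission conditions give a weak solution. -/
lemma isWeakSolution_layered {L : ℕ} {s r : ℕ → ℝ} (hr : 0 < r (L + 1))
    (hrr : ∀ j, 1 ≤ j → j ≤ L → r (j + 1) < r j) {k : ℕ} {p : MvPolynomial (Fin 3) ℝ}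
    (hp : p ∈ solidHarmonics k) {a b : ℕ → ℝ} (hb : b (L + 1) = 0)
    (hD : ∀ j, j ≤ L → a j + b j * (r (j + 1) ^ (2 * k + 1))⁻¹ =
      a (j + 1) + b (j + 1) * (r (j + 1) ^ (2 * k + 1))⁻¹)
    (hN : ∀ j, j ≤ L → s j * (k * a j - (k + 1) * (b j * (r (j + 1) ^ (2 * k + 1))⁻¹)) =
      s (j + 1) * (k * a (j + 1) - (k + 1) * (b (j + 1) * (r (j + 1) ^ (2 * k + 1))⁻¹))) :
    IsWeakSolution (conductivity L s r) (layered L r fun j => multipole k p (a j) (b j))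
      (layered L r fun j => multipoleGrad k p (a j) (b j)) := by
  have hpos : ∀ j ∈ Finset.range (L + 1), 0 < r (j + 1) := fun j hj =>
    hr.trans_le (radius_antitone hrr (by omega) (by simpa using hj) le_rfl)
  have hle : ∀ j ∈ Finset.range (L + 1), j ≤ L := fun j hj => by
    simpa [Nat.lt_succ_iff] using hj
  have hm : ∀ j ∈ Finset.range (L + 1), ∀ a b : ℝ,
      LocL2 ({x : E3 | r (j + 1) < ‖x‖}.indicator (multipole k p a b)) := fun j hj a b =>
    locL2_indicator_exterior (fun x hx => (contDiffAt_multipole (m := 0) k p a b hx).continuousAt)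
      (hpos j hj)
  have hmg : ∀ j ∈ Finset.range (L + 1), ∀ a b : ℝ,
      LocL2 ({x : E3 | r (j + 1) < ‖x‖}.indicator (multipoleGrad k p a b)) := fun j hj a b =>
    locL2_indicator_exterior
      (fun x hx => (contDiffAt_multipoleGrad (m := 0) k p a b hx).continuousAt) (hpos j hj)
  have hc1 : LocL2 fun x => a (L + 1) * polyFun p x :=
    locL2_of_continuous (continuous_const.mul (continuous_polyFun p))
  have hc2 : ∀ c : ℝ, LocL2 fun x => c • polyGrad p x := fun c =>
    locL2_of_continuous ((contDiff_polyGrad (m := 0) p).continuous.const_smul c)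
  refine ⟨?_, ?_, ?_, fun φ hφ hc => ?_⟩
  · rw [layered_multipole L r k p hb]
    exact hc1.add (locL2_sum _ fun j hj => hm j hj _ _)
  · rw [layered_multipoleGrad L r k p hb]
    exact (hc2 _).add (locL2_sum _ fun j hj => hmg j hj _ _)
  · rw [layered_multipole L r k p hb, layered_multipoleGrad L r k p hb]
    refine isWeakGradient_add hc1 (hc2 _) (locL2_sum _ fun j hj => hm j hj _ _)
      (locL2_sum _ fun j hj => hmg j hj _ _)
      (isWeakGradient_const_smul _ (isWeakGradient_polyFun p))
      (isWeakGradient_sum _ (fun j hj => hm j hj _ _) (fun j hj => hmg j hj _ _) fun j hj => ?_)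
    -- `hD` states that the jump of the value at this interface vanishes.
    refine isWeakGradient_multipole k p (hpos j hj) ?_
    linear_combination hD j (hle j hj)
  · have hφ1 : ContDiff ℝ 1 φ := hφ.of_le (by exact_mod_cast le_top)
    have hG := continuous_gradient hφ1
    have hGc := hasCompactSupport_gradient hc
    -- The field σ∇u is again a layered multipole gradient, with coefficients s_j a_j and s_j b_j,
    -- so `hN` becomes the vanishing of its flux jumps.
    have hae : (fun x => conductivity L s r x *
        inner ℝ (layered L r (fun j => multipoleGrad k p (a j) (b j)) x) (gradient φ x)) =ᵐ[volume]
        fun x => inner ℝ (layered L r (fun j => multipoleGrad k p (s j * a j) (s j * b j)) x)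
          (gradient φ x) := by
      filter_upwards [ae_norm_ne (r (L + 1))] with x hx
      obtain ⟨J, hJ, hJ'⟩ := exists_layer hrr x
      rw [layered_eq hJ hJ', layered_eq hJ hJ', conductivity_eq hx hJ hJ', ← smul_multipoleGrad,
        real_inner_smul_left]
    rw [integral_congr_ae hae, layered_multipoleGrad L r k p (a := fun j => s j * a j)
      (b := fun j => s j * b j) (by simp [hb])]
    simp only [inner_add_left, sum_inner]
    rw [integral_add ((hc2 _).integrable_inner hG hGc)
      (integrable_finsetSum _ fun j hj => (hmg j hj _ _).integrable_inner hG hGc),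
      integral_finsetSum _ fun j hj => (hmg j hj _ _).integrable_inner hG hGc]
    simp only [real_inner_smul_left]
    rw [integral_const_mul, integral_inner_polyGrad (mem_solidHarmonics.1 hp).2 hφ1 hc, mul_zero,
      zero_add]
    refine Finset.sum_eq_zero fun j hj => integral_inner_multipoleGrad hp (hpos j hj) ?_ hφ1 hc
    linear_combination hN j (hle j hj)

lemma layered_exterior {V : Type*} [AddCommGroup V] {L : ℕ} {r : ℕ → ℝ}
    (hrr : ∀ j, 1 ≤ j → j ≤ L → r (j + 1) < r j) (f : ℕ → E3 → V) {x : E3} (hx : r 1 < ‖x‖) :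
    layered L r f x = f 0 x := by
  obtain ⟨J, hJ, hJ'⟩ := exists_layer hrr x
  have : J = 0 := by have := (hJ' 0 (by omega)).1 hx; omega
  rw [layered_eq hJ hJ', this]

lemma conductivity_exterior {L : ℕ} {s r : ℕ → ℝ} (hrr : ∀ j, 1 ≤ j → j ≤ L → r (j + 1) < r j)
    {x : E3} (hx : r 1 < ‖x‖) : conductivity L s r x = s 0 := by
  obtain ⟨J, hJ, hJ'⟩ := exists_layer hrr x
  have : J = 0 := by have := (hJ' 0 (by omega)).1 hx; omega
  rw [conductivity_eq _ hJ hJ', this]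
  have := radius_antitone hrr le_rfl (show 1 ≤ L + 1 by omega) le_rfl
  linarith

end

/-! ### Mollification of weak gradients and convergence of L² pairings. -/

section

open MeasureTheory Filter Topology

/-! ### Mollification -/

/-- A sequence of bump functions shrinking to the origin. -/
def bumpSeq (n : ℕ) : ContDiffBump (0 : E3) where
  rIn := 1 / (2 * ((n : ℝ) + 1))
  rOut := 1 / ((n : ℝ) + 1)
  rIn_pos := by positivity
  rIn_lt_rOut := one_div_lt_one_div_of_lt (by positivity) (by
    have : (0 : ℝ) < n + 1 := by positivity
    linarith)

lemma tendsto_bumpSeq_rOut : Tendsto (fun n => (bumpSeq n).rOut) atTop (𝓝 0) :=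
  tendsto_one_div_add_atTop_nhds_zero_nat

/-- The associated smooth approximation of the identity. -/
def mollifier (n : ℕ) : E3 → ℝ := (bumpSeq n).normed volume

lemma contDiff_mollifier (n : ℕ) : ContDiff ℝ (⊤ : ℕ∞) (mollifier n) :=
  (bumpSeq n).contDiff_normed

lemma contDiff_one_mollifier (n : ℕ) : ContDiff ℝ 1 (mollifier n) :=
  (contDiff_mollifier n).of_le (by exact_mod_cast le_top)

lemma hasCompactSupport_mollifier (n : ℕ) : HasCompactSupport (mollifier n) :=
  (bumpSeq n).hasCompactSupport_normed

lemma mollifier_nonneg (n : ℕ) (t : E3) : 0 ≤ mollifier n t := (bumpSeq n).nonneg_normed t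

lemma integral_mollifier (n : ℕ) : ∫ t, mollifier n t = 1 := (bumpSeq n).integral_normed

lemma integrable_mollifier (n : ℕ) : Integrable (mollifier n) := (bumpSeq n).integrable_normed

lemma mollifier_eq_zero (n : ℕ) {t : E3} (ht : 1 ≤ ‖t‖) : mollifier n t = 0 := by
  rw [← Function.notMem_support, mollifier, ContDiffBump.support_normed_eq, Metric.mem_ball,
    dist_zero_right, not_lt]
  refine le_trans ?_ ht
  change 1 / ((n : ℝ) + 1) ≤ 1
  rw [div_le_one (by positivity)]
  have : (0 : ℝ) ≤ n := by positivity
  linarith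

section Mollify

variable {V : Type*} [NormedAddCommGroup V] [NormedSpace ℝ V]

/-- The mollification of a function. -/
def mollify (n : ℕ) (f : E3 → V) : E3 → V :=
  convolution (mollifier n) f (ContinuousLinearMap.lsmul ℝ ℝ) volume

lemma mollify_apply (n : ℕ) (f : E3 → V) (x : E3) :
    mollify n f x = ∫ t, mollifier n t • f (x - t) := rfl

lemma integrable_mollify_integrand (n : ℕ) {f : E3 → V} (hf : LocallyIntegrable f) (x : E3) :
    Integrable fun t => mollifier n t • f (x - t) :=
  (hasCompactSupport_mollifier n).convolutionExists_left (ContinuousLinearMap.lsmul ℝ ℝ)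
    (contDiff_mollifier n).continuous hf x

lemma contDiff_mollify (n : ℕ) {f : E3 → V} (hf : LocallyIntegrable f) :
    ContDiff ℝ (⊤ : ℕ∞) (mollify n f) :=
  (hasCompactSupport_mollifier n).contDiff_convolution_left _ (contDiff_mollifier n) hf

lemma hasCompactSupport_mollify (n : ℕ) {f : E3 → V} (hf : HasCompactSupport f) :
    HasCompactSupport (mollify n f) :=
  (hasCompactSupport_mollifier n).convolution _ hf

/-- The mollification at `x` only depends on the values in the unit ball around `x`. -/
lemma mollify_eq_zero (n : ℕ) {f : E3 → V} {R : ℝ} (hf : ∀ᵐ y : E3, R < ‖y‖ → f y = 0) {x : E3}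
    (hx : R + 1 < ‖x‖) : mollify n f x = 0 := by
  rw [mollify_apply]
  refine integral_eq_zero_of_ae ?_
  have h := (Measure.measurePreserving_sub_left (volume : Measure E3) x).quasiMeasurePreserving.ae hf
  filter_upwards [h] with t ht
  by_cases h1 : 1 ≤ ‖t‖
  · simp [mollifier_eq_zero n h1]
  · have : R < ‖x - t‖ := by
      have := norm_sub_norm_le x t
      linarith
    simp [ht this]

lemma norm_mollify_le (n : ℕ) {f : E3 → V} {R C : ℝ} (hf : ∀ᵐ y : E3, R < ‖y‖ → ‖f y‖ ≤ C) {x : E3}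
    (hx : R + 1 < ‖x‖) : ‖mollify n f x‖ ≤ C := by
  rw [mollify_apply]
  have h := (Measure.measurePreserving_sub_left (volume : Measure E3) x).quasiMeasurePreserving.ae hf
  have h2 : ‖∫ t, mollifier n t • f (x - t)‖ ≤ ∫ t, mollifier n t * C := by
    refine norm_integral_le_of_norm_le ((integrable_mollifier n).mul_const C) ?_
    filter_upwards [h] with t ht
    rw [norm_smul, Real.norm_eq_abs, abs_of_nonneg (mollifier_nonneg n t)]
    by_cases h1 : 1 ≤ ‖t‖
    · simp [mollifier_eq_zero n h1]
    · have : R < ‖x - t‖ := by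
        have := norm_sub_norm_le x t
        linarith
      exact mul_le_mul_of_nonneg_left (ht this) (mollifier_nonneg n t)
  rwa [integral_mul_const, integral_mollifier, one_mul] at h2

lemma ae_tendsto_mollify [CompleteSpace V] {f : E3 → V} (hf : LocallyIntegrable f) :
    ∀ᵐ x : E3, Tendsto (fun n => mollify n f x) atTop (𝓝 (f x)) :=
  ContDiffBump.ae_convolution_tendsto_right_of_locallyIntegrable (K := 2) tendsto_bumpSeq_rOut
    (Eventually.of_forall fun n => by
      change 1 / ((n : ℝ) + 1) ≤ 2 * (1 / (2 * ((n : ℝ) + 1)))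
      apply le_of_eq
      field_simp) hf

end Mollify

/-- Mollification commutes with the weak gradient. -/
lemma fderiv_mollify (n : ℕ) {u : E3 → ℝ} {g : E3 → E3} (hu : LocL2 u) (hg : LocL2 g)
    (h : IsWeakGradient u g) (x : E3) (i : Fin 3) :
    fderiv ℝ (mollify n u) x (EuclideanSpace.single i 1) = mollify n g x i := by
  have hρ1 := contDiff_one_mollifier n
  have hρc := hasCompactSupport_mollifier n
  have h1 := (hρc.hasFDerivAt_convolution_left (ContinuousLinearMap.lsmul ℝ ℝ) hρ1
    hu.locallyIntegrable x).fderiv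
  have hex : Integrable (fun t => (ContinuousLinearMap.precompL E3
      (ContinuousLinearMap.lsmul ℝ ℝ : ℝ →L[ℝ] ℝ →L[ℝ] ℝ)) (fderiv ℝ (mollifier n) t) (u (x - t))) :=
    (hρc.fderiv ℝ).convolutionExists_left _ (hρ1.continuous_fderiv (by simp)) hu.locallyIntegrable x
  have h2 : fderiv ℝ (mollify n u) x (EuclideanSpace.single i 1) =
      ∫ t, fderiv ℝ (mollifier n) t (EuclideanSpace.single i 1) * u (x - t) := by
    rw [mollify, h1, convolution_def, ContinuousLinearMap.integral_apply hex]
    simp [ContinuousLinearMap.precompL_apply]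
  -- The reflected mollifier centred at x is an admissible test function in the definition of the
  -- weak gradient.
  set φ : E3 → ℝ := fun y => mollifier n (x - y) with hφdef
  have hφ : ContDiff ℝ (⊤ : ℕ∞) φ := (contDiff_mollifier n).comp (contDiff_const.sub contDiff_id)
  have hφ1 : ContDiff ℝ 1 φ := hφ.of_le (by exact_mod_cast le_top)
  have hφc : HasCompactSupport φ := hρc.comp_homeomorph (Homeomorph.subLeft x)
  have hφd : ∀ y, fderiv ℝ φ y (EuclideanSpace.single i 1) =
      -fderiv ℝ (mollifier n) (x - y) (EuclideanSpace.single i 1) := by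
    intro y
    have h3 := (hρ1.differentiable (by simp) (x - y)).hasFDerivAt.comp y
      ((hasFDerivAt_id y).const_sub x)
    have h4 : fderiv ℝ φ y = _ := h3.fderiv
    rw [h4]; simp
  have h5 := congrArg (fun v : E3 => v i) (h φ hφ hφc)
  simp only [PiLp.neg_apply] at h5
  rw [integral_coord (hu.integrable_smul_vector (continuous_gradient hφ1)
    (hasCompactSupport_gradient hφc)),
    integral_coord (hg.integrable_vector_smul hφ1.continuous hφc)] at h5
  simp only [PiLp.smul_apply, gradient_apply, smul_eq_mul, hφd, mul_neg] at h5
  rw [integral_neg, neg_inj] at h5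
  rw [h2, mollify_apply, integral_coord (integrable_mollify_integrand n hg.locallyIntegrable x)]
  simp only [PiLp.smul_apply, smul_eq_mul]
  rw [← integral_sub_left_eq_self _ _ x,
    ← integral_sub_left_eq_self (fun t => mollifier n t * g (x - t) i) _ x]
  simp only [sub_sub_cancel]
  rw [← h5]
  congr 1
  funext y
  ring

lemma gradient_mollify (n : ℕ) {u : E3 → ℝ} {g : E3 → E3} (hu : LocL2 u) (hg : LocL2 g)
    (h : IsWeakGradient u g) (x : E3) : gradient (mollify n u) x = mollify n g x := by
  ext i
  rw [gradient_apply, fderiv_mollify n hu hg h]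

/-- The correlation of two square integrable functions is continuous. -/
lemma continuous_integral_inner_translate {F G : E3 → E3} (hF : MemLp F 2 volume)
    (hG : MemLp G 2 volume) : Continuous fun t : E3 => ∫ x, inner ℝ (F x) (G (x - t)) := by
  have hmp : ∀ t : E3, MeasurePreserving (fun x : E3 => x - t) volume volume :=
    fun t => measurePreserving_sub_right volume t
  let T : E3 → C(E3, E3) := fun t => ⟨fun x => x - t, by fun_prop⟩
  have hT : Continuous T := by
    have : Continuous (fun a : E3 × E3 => a.2 - a.1) := by fun_prop
    exact (ContinuousMap.curry ⟨fun a : E3 × E3 => a.2 - a.1, this⟩).continuous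
  have hc := (continuous_const (y := hG.toLp G)).compMeasurePreservingLp hT hmp (by norm_num)
  have hc2 := (continuous_const (y := hF.toLp F)).inner (𝕜 := ℝ) hc
  refine hc2.congr fun t => ?_
  rw [L2.inner_def]
  refine integral_congr_ae ?_
  filter_upwards [hF.coeFn_toLp, Lp.coeFn_compMeasurePreserving (hG.toLp G) (hmp t),
    (hmp t).quasiMeasurePreserving.ae_eq_comp hG.coeFn_toLp] with x h1 h2 h3
  rw [h1]
  congr 1
  exact h2.trans h3

lemma integral_inner_mollify (n : ℕ) {F G : E3 → E3} (hF : MemLp F 2 volume)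
    (hG : MemLp G 2 volume) : ∫ x, inner ℝ (F x) (mollify n G x) =
      ∫ t, mollifier n t * ∫ x, inner ℝ (F x) (G (x - t)) := by
  have hGl : LocallyIntegrable G := hG.locallyIntegrable (by norm_num)
  -- Fubini's hypothesis follows from the pointwise bound by ρ_n(t)(|F(x)|² + |G(x - t)|²), where
  -- ρ_n is the mollifier.
  have hint : Integrable (Function.uncurry fun x t : E3 =>
      inner ℝ (F x) (mollifier n t • G (x - t))) (volume.prod volume) := by
    have hF2 : Integrable fun x => ‖F x‖ ^ 2 := (memLp_two_iff_integrable_sq_norm hF.1).1 hF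
    have hG2 : Integrable fun x => ‖G x‖ ^ 2 := (memLp_two_iff_integrable_sq_norm hG.1).1 hG
    have h1 : Integrable (fun z : E3 × E3 => ‖F z.1‖ ^ 2 * mollifier n z.2) (volume.prod volume) :=
      hF2.mul_prod (integrable_mollifier n)
    have h2 : Integrable (fun z : E3 × E3 => mollifier n z.2 * ‖G (z.1 - z.2)‖ ^ 2)
        (volume.prod volume) :=
      (integrable_mollifier n).convolution_integrand (ContinuousLinearMap.mul ℝ ℝ) hG2
    refine (h1.add h2).mono' ?_ (Eventually.of_forall fun z => ?_)
    · have h3 : AEStronglyMeasurable (fun z : E3 × E3 => mollifier n z.2 • G (z.1 - z.2))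
          (volume.prod volume) :=
        (integrable_mollifier n).1.convolution_integrand (ContinuousLinearMap.lsmul ℝ ℝ) hG.1
      exact hF.1.comp_fst.inner h3
    · simp only [Function.uncurry, Pi.add_apply]
      refine (norm_inner_le_norm _ _).trans ?_
      rw [norm_smul, Real.norm_eq_abs, abs_of_nonneg (mollifier_nonneg n _)]
      have hm := mollifier_nonneg n z.2
      nlinarith [sq_nonneg (‖F z.1‖ - ‖G (z.1 - z.2)‖), sq_nonneg (‖F z.1‖ + ‖G (z.1 - z.2)‖),
        mul_nonneg hm (sq_nonneg (‖F z.1‖ - ‖G (z.1 - z.2)‖)),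
        mul_nonneg hm (sq_nonneg (‖F z.1‖ + ‖G (z.1 - z.2)‖))]
  have h := integral_integral_swap hint
  calc ∫ x, inner ℝ (F x) (mollify n G x)
      = ∫ x, ∫ t, inner ℝ (F x) (mollifier n t • G (x - t)) := by
        congr 1
        funext x
        rw [integral_inner (integrable_mollify_integrand n hGl x), mollify_apply]
    _ = ∫ t, ∫ x, inner ℝ (F x) (mollifier n t • G (x - t)) := h
    _ = _ := by
        congr 1
        funext t
        simp only [real_inner_smul_right]
        rw [integral_const_mul]

/-- The pairing is the average of the continuous correlation of F and G against the mollifier, that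
is, a convolution evaluated at 0. The reflection by `continuous_neg` compensates for the sign in the
convolution. -/
lemma tendsto_integral_inner_mollify {F G : E3 → E3} (hF : MemLp F 2 volume)
    (hG : MemLp G 2 volume) : Tendsto (fun n => ∫ x, inner ℝ (F x) (mollify n G x)) atTop
      (𝓝 (∫ x, inner ℝ (F x) (G x))) := by
  have hc := (continuous_integral_inner_translate hF hG).comp (continuous_neg (G := E3))
  have h := ContDiffBump.convolution_tendsto_right_of_continuous (μ := volume)
    tendsto_bumpSeq_rOut hc 0
  simp only [Function.comp_apply, neg_zero, sub_zero] at h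
  refine h.congr fun n => ?_
  rw [integral_inner_mollify n hF hG, convolution_def]
  congr 1
  funext t
  simp [mollifier]

end

/-! ### Energy estimates and uniqueness near infinity. -/

section

open MeasureTheory Filter Topology

/-! ### The energy identity -/

lemma exists_bound_of_hasCompactSupport {V : Type*} [NormedAddCommGroup V] {f : E3 → V}
    (hf : Continuous f) (hc : HasCompactSupport f) : ∃ C : ℝ, ∀ x, ‖f x‖ ≤ C :=
  hf.bounded_above_of_compact_support hc

lemma LocL2.smul_bdd {u : E3 → ℝ} (hu : LocL2 u) {Φ : E3 → E3} (hΦ : Continuous Φ) {C : ℝ}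
    (hC : ∀ x, ‖Φ x‖ ≤ C) : LocL2 fun x => u x • Φ x := fun K hK =>
  (hu K hK).of_le_mul (c := C) ((hu K hK).1.smul hΦ.aestronglyMeasurable)
    (Eventually.of_forall fun x => by
      rw [norm_smul, mul_comm]
      exact mul_le_mul_of_nonneg_right (hC x) (norm_nonneg _))

lemma LocL2.memLp_of_support {V : Type*} [NormedAddCommGroup V] {f : E3 → V} (hf : LocL2 f)
    {K : Set E3} (hK : IsCompact K) (h : ∀ x, x ∉ K → f x = 0) : MemLp f 2 volume := by
  have : f = K.indicator f := by
    funext x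
    by_cases hx : x ∈ K
    · rw [Set.indicator_of_mem hx]
    · rw [Set.indicator_of_notMem hx, h x hx]
  rw [this, memLp_indicator_iff_restrict hK.measurableSet]
  exact hf K hK

lemma gradient_mul {φ ψ : E3 → ℝ} {x : E3} (hφ : DifferentiableAt ℝ φ x)
    (hψ : DifferentiableAt ℝ ψ x) :
    gradient (fun y => φ y * ψ y) x = φ x • gradient ψ x + ψ x • gradient φ x := by
  have h : fderiv ℝ (fun y => φ y * ψ y) x = _ := (hφ.hasFDerivAt.mul hψ.hasFDerivAt).fderiv
  rw [gradient, h, map_add, map_smul, map_smul]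
  rfl

lemma isWeakGradient_cutoff {u : E3 → ℝ} {g : E3 → E3} (hu : LocL2 u) (hg : LocL2 g)
    (h : IsWeakGradient u g) {ζ : E3 → ℝ} (hζ : ContDiff ℝ (⊤ : ℕ∞) ζ) (hζc : HasCompactSupport ζ) :
    IsWeakGradient (fun x => ζ x * u x) (fun x => ζ x • g x + u x • gradient ζ x) := by
  intro φ hφ hc
  have hφ1 : ContDiff ℝ 1 φ := hφ.of_le (by exact_mod_cast le_top)
  have hζ1 : ContDiff ℝ 1 ζ := hζ.of_le (by exact_mod_cast le_top)
  have h1 := h (fun x => ζ x * φ x) (hζ.mul hφ) hc.mul_left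
  have e1 : ∀ x, u x • gradient (fun x => ζ x * φ x) x =
      (ζ x * u x) • gradient φ x + u x • (φ x • gradient ζ x) := fun x => by
    rw [gradient_mul (hζ1.differentiable (by simp) x) (hφ1.differentiable (by simp) x), smul_add,
      smul_smul, mul_comm (u x)]
  have i1 : Integrable fun x => (ζ x * u x) • gradient φ x := by
    have := hu.integrable_smul_vector (Φ := fun x => ζ x • gradient φ x)
      (hζ1.continuous.smul (continuous_gradient hφ1))
      ((hasCompactSupport_gradient hc).smul_left (f := ζ))
    simpa only [smul_smul, mul_comm] using this
  have i2 : Integrable fun x => u x • (φ x • gradient ζ x) :=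
    hu.integrable_smul_vector (hφ1.continuous.smul (continuous_gradient hζ1))
      ((hasCompactSupport_gradient hζc).smul_left (f := φ))
  have i3 : Integrable fun x => (ζ x * φ x) • g x :=
    hg.integrable_vector_smul (hζ1.continuous.mul hφ1.continuous) hc.mul_left
  simp only [e1] at h1
  rw [integral_add i1 i2] at h1
  have e2 : ∀ x, φ x • (ζ x • g x + u x • gradient ζ x) =
      (ζ x * φ x) • g x + u x • (φ x • gradient ζ x) := fun x => by
    rw [smul_add, smul_smul, smul_comm (φ x) (u x), mul_comm]
  simp only [e2]
  rw [integral_add i3 i2, neg_add, ← h1]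
  abel

/-- The equation can be tested with `ζ w`. -/
lemma IsWeakSolution.integral_cutoff {σ w : E3 → ℝ} {g : E3 → E3}
    (hm : AEStronglyMeasurable σ volume) {C : ℝ} (hb : ∀ x, |σ x| ≤ C) (hw : IsWeakSolution σ w g)
    {ζ : E3 → ℝ} (hζ : ContDiff ℝ (⊤ : ℕ∞) ζ) (hζc : HasCompactSupport ζ) :
    ∫ x, σ x * inner ℝ (g x) (ζ x • g x + w x • gradient ζ x) = 0 := by
  have hζ1 : ContDiff ℝ 1 ζ := hζ.of_le (by exact_mod_cast le_top)
  obtain ⟨B, hB⟩ := exists_bound_of_hasCompactSupport hζ1.continuous hζc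
  obtain ⟨D, hD⟩ := exists_bound_of_hasCompactSupport (continuous_gradient hζ1)
    (hasCompactSupport_gradient hζc)
  obtain ⟨R, hR⟩ := hζc.isCompact.isBounded.subset_closedBall 0
  set W : E3 → ℝ := fun x => ζ x * w x with hWdef
  set G : E3 → E3 := fun x => ζ x • g x + w x • gradient ζ x with hGdef
  have hW : LocL2 W := hw.locL2.bdd_smul hζ1.continuous.aestronglyMeasurable hB
  have hG : LocL2 G := (hw.locL2_grad.bdd_smul hζ1.continuous.aestronglyMeasurable hB).add
    (hw.locL2.smul_bdd (continuous_gradient hζ1) hD)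
  have hWG : IsWeakGradient W G :=
    isWeakGradient_cutoff hw.locL2 hw.locL2_grad hw.isWeakGradient hζ hζc
  have hWc : HasCompactSupport W := hζc.mul_right
  have hG0 : ∀ y : E3, R < ‖y‖ → G y = 0 := by
    intro y hy
    have h1 : y ∉ tsupport ζ := fun h => by
      have := hR h
      rw [Metric.mem_closedBall, dist_zero_right] at this
      linarith
    have h2 : gradient ζ y = 0 := by
      rw [gradient, fderiv_of_notMem_tsupport ℝ h1, map_zero]
    simp [hGdef, image_eq_zero_of_notMem_tsupport h1, h2]
  have hKc : IsCompact (Metric.closedBall (0 : E3) (R + 1)) := isCompact_closedBall _ _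
  -- The mollifiers live in the unit ball, so radius R + 1 contains the supports of all
  -- mollifications of G. The truncation makes σg globally square integrable without changing these
  -- pairings.
  set F : E3 → E3 := (Metric.closedBall (0 : E3) (R + 1)).indicator fun x => σ x • g x with hFdef
  have hF : MemLp F 2 volume := by
    rw [hFdef, memLp_indicator_iff_restrict hKc.measurableSet]
    exact hw.locL2_grad.bdd_smul hm hb _ hKc
  have hGL : MemLp G 2 volume := hG.memLp_of_support (isCompact_closedBall (0 : E3) R) fun x hx =>
    hG0 x (by simpa using hx)
  have hFe : ∀ Φ : E3 → E3, (∀ x, R + 1 < ‖x‖ → Φ x = 0) →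
      ∀ x, inner ℝ (F x) (Φ x) = σ x * inner ℝ (g x) (Φ x) := by
    intro Φ hΦ x
    by_cases hx : R + 1 < ‖x‖
    · simp [hΦ x hx]
    · rw [hFdef, Set.indicator_of_mem (by simpa using hx), real_inner_smul_left]
  have hlim := tendsto_integral_inner_mollify hF hGL
  have hzero : ∀ n, ∫ x, inner ℝ (F x) (mollify n G x) = 0 := by
    intro n
    -- The product ζw is not smooth, but its mollification is a legitimate test function, with
    -- gradient the mollification of G.
    rw [← hw.integral_eq_zero (mollify n W) (contDiff_mollify n hW.locallyIntegrable)
      (hasCompactSupport_mollify n hWc)]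
    congr 1
    funext x
    rw [gradient_mollify n hW hG hWG]
    exact hFe _ (fun y hy => mollify_eq_zero n (Eventually.of_forall hG0) hy) x
  simp only [hzero] at hlim
  rw [tendsto_nhds_unique tendsto_const_nhds hlim]
  congr 1
  funext x
  exact (hFe G (fun y hy => hG0 y (by linarith)) x).symm

/-! ### Caccioppoli's inequality and uniqueness -/

lemma integrable_mul_sq {σ : E3 → ℝ} (hm : AEStronglyMeasurable σ volume) {C : ℝ}
    (hb : ∀ x, |σ x| ≤ C) {V : Type*} [NormedAddCommGroup V] {f : E3 → V} (hf : MemLp f 2 volume) :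
    Integrable fun x => σ x * ‖f x‖ ^ 2 :=
  ((memLp_two_iff_integrable_sq_norm hf.1).1 hf).bdd_mul (c := C) hm (Eventually.of_forall hb)

/-- Testing with η²w gives ∫σ|ηg|² = -2∫σ⟨ηg, w∇η⟩, and Young's inequality absorbs half of the left
side. Only σ ≥ 0 is used, so an insulating core is allowed. -/
lemma caccioppoli {σ w : E3 → ℝ} {g : E3 → E3}
    (hm : AEStronglyMeasurable σ volume) {C : ℝ} (hb : ∀ x, |σ x| ≤ C) (h0 : ∀ x, 0 ≤ σ x)
    (hw : IsWeakSolution σ w g) {η : E3 → ℝ} (hη : ContDiff ℝ (⊤ : ℕ∞) η)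
    (hηc : HasCompactSupport η) :
    Integrable (fun x => σ x * ‖η x • g x‖ ^ 2) ∧
    ∫ x, σ x * ‖η x • g x‖ ^ 2 ≤ 4 * ∫ x, σ x * ‖w x • gradient η x‖ ^ 2 := by
  have hη1 : ContDiff ℝ 1 η := hη.of_le (by exact_mod_cast le_top)
  obtain ⟨B, hB⟩ := exists_bound_of_hasCompactSupport hη1.continuous hηc
  obtain ⟨D, hD⟩ := exists_bound_of_hasCompactSupport (continuous_gradient hη1)
    (hasCompactSupport_gradient hηc)
  have hgrad0 : ∀ x, x ∉ tsupport η → gradient η x = 0 := fun x hx => by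
    rw [gradient, fderiv_of_notMem_tsupport ℝ hx, map_zero]
  have i1 : Integrable fun x => σ x * ‖η x • g x‖ ^ 2 := integrable_mul_sq hm hb
    ((hw.locL2_grad.bdd_smul hη1.continuous.aestronglyMeasurable hB).memLp_of_support
      hηc.isCompact fun x hx => by rw [image_eq_zero_of_notMem_tsupport hx, zero_smul])
  have i2 : Integrable fun x => σ x * ‖w x • gradient η x‖ ^ 2 := integrable_mul_sq hm hb
    ((hw.locL2.smul_bdd (continuous_gradient hη1) hD).memLp_of_support
      hηc.isCompact fun x hx => by rw [hgrad0 x hx, smul_zero])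
  refine ⟨i1, ?_⟩
  have h := hw.integral_cutoff hm hb (ζ := fun x => η x * η x) (hη.mul hη) hηc.mul_left
  have e : ∀ x, σ x * inner ℝ (g x) ((η x * η x) • g x + w x • gradient (fun x => η x * η x) x) =
      σ x * ‖η x • g x‖ ^ 2 + 2 * (σ x * inner ℝ (η x • g x) (w x • gradient η x)) := by
    intro x
    rw [gradient_mul (hη1.differentiable (by simp) x) (hη1.differentiable (by simp) x),
      inner_add_right, real_inner_smul_right, real_inner_self_eq_norm_sq, norm_smul,
      real_inner_smul_left, real_inner_smul_right, real_inner_smul_right, inner_add_right,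
      real_inner_smul_right, mul_pow, Real.norm_eq_abs, sq_abs]
    ring
  simp only [e] at h
  have hle : ∀ x, σ x * ‖η x • g x‖ ^ 2 / 2 - 2 * (σ x * ‖w x • gradient η x‖ ^ 2) ≤
      σ x * ‖η x • g x‖ ^ 2 + 2 * (σ x * inner ℝ (η x • g x) (w x • gradient η x)) := by
    intro x
    have h1 := abs_le.1 (abs_real_inner_le_norm (η x • g x) (w x • gradient η x))
    have h2 : 0 ≤ ‖η x • g x‖ ^ 2 / 2 + 2 * inner ℝ (η x • g x) (w x • gradient η x) +
        2 * ‖w x • gradient η x‖ ^ 2 := by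
      nlinarith [sq_nonneg (‖η x • g x‖ - 2 * ‖w x • gradient η x‖)]
    nlinarith [mul_nonneg (h0 x) h2]
  have i3 : Integrable fun x => σ x * inner ℝ (η x • g x) (w x • gradient η x) := by
    refine (i1.add i2).mono' ?_ (Eventually.of_forall fun x => ?_)
    · exact hm.mul ((hη1.continuous.aestronglyMeasurable.smul
        hw.locL2_grad.aestronglyMeasurable).inner
        (hw.locL2.aestronglyMeasurable.smul (continuous_gradient hη1).aestronglyMeasurable))
    · rw [norm_mul, Real.norm_eq_abs, abs_of_nonneg (h0 x), Real.norm_eq_abs, Pi.add_apply,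
        ← mul_add]
      refine mul_le_mul_of_nonneg_left ?_ (h0 x)
      have h1 := abs_real_inner_le_norm (η x • g x) (w x • gradient η x)
      nlinarith [sq_nonneg (‖η x • g x‖ - ‖w x • gradient η x‖),
        sq_nonneg (‖η x • g x‖ + ‖w x • gradient η x‖)]
  have h2 := integral_mono ((i1.div_const 2).sub (i2.const_mul 2)) (i1.add (i3.const_mul 2)) hle
  simp only [Pi.sub_apply, Pi.add_apply] at h2
  rw [h, integral_sub (i1.div_const 2) (i2.const_mul 2), integral_div, integral_const_mul] at h2
  linarith

/-- A weak solution that is `O(|x|⁻¹)` at infinity has zero energy. -/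
lemma IsWeakSolution.ae_eq_zero_of_decay {σ w : E3 → ℝ} {g : E3 → E3}
    (hm : AEStronglyMeasurable σ volume) {S : ℝ} (hb : ∀ x, |σ x| ≤ S) (h0 : ∀ x, 0 ≤ σ x)
    (hw : IsWeakSolution σ w g) {C R : ℝ} (hd : ∀ᵐ x : E3, R < ‖x‖ → |w x| ≤ C / ‖x‖) :
    ∀ᵐ x : E3, σ x * ‖g x‖ ^ 2 = 0 := by
  let χ : ContDiffBump (0 : E3) := ⟨1, 2, one_pos, one_lt_two⟩
  have hχ : ContDiff ℝ (⊤ : ℕ∞) χ := χ.contDiff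
  have hχ1 : ContDiff ℝ 1 χ := χ.contDiff
  have hχc : HasCompactSupport χ := χ.hasCompactSupport
  obtain ⟨D, hD⟩ := exists_bound_of_hasCompactSupport (continuous_gradient hχ1)
    (hasCompactSupport_gradient hχc)
  have hS : 0 ≤ S := (abs_nonneg _).trans (hb 0)
  set v := (volume : Measure E3).real (Metric.ball 0 1) with hv
  -- the energy in a ball is bounded by a multiple of `1 / T`
  have key : ∀ M : ℕ, ∀ T : ℝ, 0 < T → R < T → (M : ℝ) ≤ T →
      ∫ x in Metric.closedBall (0 : E3) M, σ x * ‖g x‖ ^ 2 ≤ 4 * (S * (C * D) ^ 2 * (8 * v)) / T := by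
    intro M T hT hRT hMT
    let η : E3 → ℝ := fun x => χ (T⁻¹ • x)
    have hη : ContDiff ℝ (⊤ : ℕ∞) η := hχ.comp (contDiff_const_smul _)
    have hη1 : ContDiff ℝ 1 η := hη.of_le (by exact_mod_cast le_top)
    have hTn : ∀ x : E3, ‖T⁻¹ • x‖ = ‖x‖ / T := fun x => by
      rw [norm_smul, norm_inv, Real.norm_eq_abs, abs_of_pos hT]; ring
    have hηz : ∀ x : E3, x ∉ Metric.closedBall (0 : E3) (2 * T) → η x = 0 := by
      intro x hx
      rw [Metric.mem_closedBall, dist_zero_right, not_le] at hx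
      refine χ.zero_of_le_dist ?_
      rw [dist_zero_right, hTn]
      change 2 ≤ ‖x‖ / T
      rw [le_div_iff₀ hT]; exact hx.le
    have hηc : HasCompactSupport η :=
      HasCompactSupport.intro (isCompact_closedBall (0 : E3) (2 * T)) hηz
    have hηone : ∀ x : E3, ‖x‖ ≤ T → η x = 1 := by
      intro x hx
      refine χ.one_of_mem_closedBall ?_
      rw [Metric.mem_closedBall, dist_zero_right, hTn]
      change ‖x‖ / T ≤ 1
      rwa [div_le_one hT]
    have hgr : ∀ x, ‖gradient η x‖ ≤ D / T := by
      intro x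
      have h1 := ((hχ1.differentiable (by simp) (T⁻¹ • x)).hasFDerivAt.comp x
        ((hasFDerivAt_id x).const_smul T⁻¹)).fderiv
      have h2 : gradient η x = T⁻¹ • gradient χ (T⁻¹ • x) := by
        ext i
        rw [PiLp.smul_apply, gradient_apply, gradient_apply]
        change fderiv ℝ η x = _ at h1
        rw [h1]
        simp
      rw [h2, norm_smul, norm_inv, Real.norm_eq_abs, abs_of_pos hT, inv_mul_eq_div]
      gcongr
      exact hD _
    have hgr0 : ∀ x, ‖x‖ < T → gradient η x = 0 := by
      intro x hx
      have : η =ᶠ[𝓝 x] fun _ => 1 := by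
        filter_upwards [(isOpen_lt continuous_norm continuous_const).mem_nhds hx] with y hy
        exact hηone y (le_of_lt hy)
      rw [gradient, this.fderiv_eq]
      simp
    have hgr1 : ∀ x, x ∉ Metric.closedBall (0 : E3) (2 * T) → gradient η x = 0 := by
      intro x hx
      have : η =ᶠ[𝓝 x] fun _ => 0 := by
        filter_upwards [Metric.isClosed_closedBall.isOpen_compl.mem_nhds hx] with y hy
        exact hηz y hy
      rw [gradient, this.fderiv_eq]
      simp
    obtain ⟨hi, hcac⟩ := caccioppoli hm hb h0 hw hη hηc
    have hlow : ∫ x in Metric.closedBall (0 : E3) M, σ x * ‖g x‖ ^ 2 ≤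
        ∫ x, σ x * ‖η x • g x‖ ^ 2 := by
      refine le_trans (le_of_eq ?_) (setIntegral_le_integral (s := Metric.closedBall (0 : E3) M) hi
        (Eventually.of_forall fun x => mul_nonneg (h0 x) (sq_nonneg _)))
      refine setIntegral_congr_fun Metric.isClosed_closedBall.measurableSet fun x hx => ?_
      rw [Metric.mem_closedBall, dist_zero_right] at hx
      simp only [hηone x (hx.trans hMT), one_smul]
    -- The gradient of η lives in T ≤ |x| ≤ 2T, where |w| ≤ C/T and |∇η| ≤ D/T: an integrand O(T⁻⁴)
    -- over a volume O(T³) leaves O(1/T).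
    have hup : ∫ x, σ x * ‖w x • gradient η x‖ ^ 2 ≤
        ∫ x, (Metric.closedBall (0 : E3) (2 * T)).indicator
          (fun _ => S * (C / T * (D / T)) ^ 2) x := by
      refine integral_mono_of_nonneg
        (Eventually.of_forall fun x => mul_nonneg (h0 x) (sq_nonneg _)) ?_ ?_
      · exact (integrable_indicator_iff Metric.isClosed_closedBall.measurableSet).2
          (integrableOn_const (hs := (isCompact_closedBall (0 : E3) (2 * T)).measure_lt_top.ne))
      · filter_upwards [hd] with x hx
        by_cases h1 : x ∈ Metric.closedBall (0 : E3) (2 * T)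
        · rw [Set.indicator_of_mem h1]
          by_cases h2 : ‖x‖ < T
          · rw [hgr0 x h2, smul_zero, norm_zero]
            simp only [ne_eq, OfNat.ofNat_ne_zero, not_false_eq_true, zero_pow, mul_zero]
            positivity
          · rw [not_lt] at h2
            have h3 := hx (lt_of_lt_of_le hRT h2)
            -- The sign of C is not assumed; it follows as soon as the decay bound holds at one
            -- point.
            have hC : 0 ≤ C := by
              have h4 := (abs_nonneg _).trans h3
              rw [div_nonneg_iff] at h4
              rcases h4 with h4 | h4
              · exact h4.1
              · linarith [h4.2]
            have h5 : |w x| ≤ C / T := h3.trans (by gcongr)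
            rw [norm_smul, Real.norm_eq_abs]
            refine mul_le_mul ((le_abs_self _).trans (hb x)) ?_ (sq_nonneg _) hS
            refine pow_le_pow_left₀ (by positivity) ?_ 2
            exact mul_le_mul h5 (hgr x) (norm_nonneg _) ((abs_nonneg _).trans h5)
        · rw [Set.indicator_of_notMem h1, hgr1 x h1, smul_zero, norm_zero]
          simp
    rw [integral_indicator Metric.isClosed_closedBall.measurableSet, setIntegral_const,
      Measure.addHaar_real_closedBall _ _ (by positivity), smul_eq_mul] at hup
    have hf : Module.finrank ℝ E3 = 3 := by simp
    rw [hf, ← hv] at hup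
    refine hlow.trans (hcac.trans ?_)
    calc 4 * ∫ x, σ x * ‖w x • gradient η x‖ ^ 2
        ≤ 4 * ((2 * T) ^ 3 * v * (S * (C / T * (D / T)) ^ 2)) := by gcongr
      _ = 4 * (S * (C * D) ^ 2 * (8 * v)) / T := by field_simp; ring
  have hball : ∀ M : ℕ, ∀ᵐ x : E3, x ∈ Metric.closedBall (0 : E3) M → σ x * ‖g x‖ ^ 2 = 0 := by
    intro M
    have hnn : 0 ≤ ∫ x in Metric.closedBall (0 : E3) M, σ x * ‖g x‖ ^ 2 :=
      integral_nonneg fun x => mul_nonneg (h0 x) (sq_nonneg _)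
    have hle : ∫ x in Metric.closedBall (0 : E3) M, σ x * ‖g x‖ ^ 2 ≤ 0 := by
      refine ge_of_tendsto (tendsto_const_nhds.div_atTop tendsto_id :
        Tendsto (fun T : ℝ => 4 * (S * (C * D) ^ 2 * (8 * v)) / T) atTop (𝓝 0)) ?_
      filter_upwards [eventually_gt_atTop 0, eventually_gt_atTop R, eventually_ge_atTop (M : ℝ)]
        with T h1 h2 h3 using key M T h1 h2 h3
    have hint : IntegrableOn (fun x => σ x * ‖g x‖ ^ 2) (Metric.closedBall (0 : E3) M) := by
      have h1 := hw.locL2_grad _ (isCompact_closedBall (0 : E3) (M : ℝ))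
      exact ((memLp_two_iff_integrable_sq_norm h1.1).1 h1).bdd_mul (c := S) hm.restrict
        (Eventually.of_forall hb)
    have h2 := (integral_eq_zero_iff_of_nonneg (fun x => mul_nonneg (h0 x) (sq_nonneg _)) hint).1
      (le_antisymm hle hnn)
    exact (ae_restrict_iff' Metric.isClosed_closedBall.measurableSet).1 h2
  filter_upwards [ae_all_iff.2 hball] with x hx
  obtain ⟨M, hM⟩ := exists_nat_ge ‖x‖
  exact hx M (by simpa using hM)

/-- A weak solution that is `O(|x|⁻¹)` at infinity vanishes near infinity. -/
lemma IsWeakSolution.exists_ae_eq_zero {σ w : E3 → ℝ} {g : E3 → E3}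
    (hm : AEStronglyMeasurable σ volume) {S : ℝ} (hb : ∀ x, |σ x| ≤ S) (h0 : ∀ x, 0 ≤ σ x)
    {R₀ : ℝ} (h1 : ∀ x, R₀ < ‖x‖ → 0 < σ x)
    (hw : IsWeakSolution σ w g) {C R : ℝ} (hd : ∀ᵐ x : E3, R < ‖x‖ → |w x| ≤ C / ‖x‖) :
    ∃ R' : ℝ, ∀ᵐ x : E3, R' < ‖x‖ → w x = 0 := by
  -- Zero energy forces zero gradient only where σ > 0, hence the restriction to the exterior.
  have hg0 : ∀ᵐ x : E3, R₀ < ‖x‖ → g x = 0 := by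
    filter_upwards [hw.ae_eq_zero_of_decay hm hb h0 hd] with x hx hx'
    rcases mul_eq_zero.1 hx with h | h
    · exact absurd h (h1 x hx').ne'
    · simpa using h
  -- The added 1 leaves room for the support of the mollifiers, so that beyond this radius a
  -- mollification of w has zero gradient, is constant on rays, and decays.
  refine ⟨max (max R₀ R) 0 + 1, ?_⟩
  have hmz : ∀ (n : ℕ) (x : E3), max (max R₀ R) 0 + 1 < ‖x‖ → mollify n w x = 0 := by
    intro n x hx
    have hR₀ : R₀ ≤ max (max R₀ R) 0 := (le_max_left _ _).trans (le_max_left _ _)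
    have hR : R ≤ max (max R₀ R) 0 := (le_max_right _ _).trans (le_max_left _ _)
    have hxp : 0 < ‖x‖ := by
      have := le_max_right (max R₀ R) 0
      linarith
    have hdiff : Differentiable ℝ (mollify n w) :=
      (contDiff_mollify n hw.locL2.locallyIntegrable).differentiable (by simp)
    have hfz : ∀ y : E3, R₀ + 1 < ‖y‖ → fderiv ℝ (mollify n w) y = 0 := by
      intro y hy
      have h2 := gradient_mollify n hw.locL2 hw.locL2_grad hw.isWeakGradient y
      rw [mollify_eq_zero n hg0 hy, gradient] at h2
      simpa using h2
    -- along the ray through `x` the mollification is constant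
    have hray : ∀ s : ℝ, 1 ≤ s → mollify n w (s • x) = mollify n w x := by
      intro s hs
      have hder : ∀ t ∈ Set.Ico (1 : ℝ) s,
          HasDerivWithinAt (fun t : ℝ => mollify n w (t • x)) 0 (Set.Ici t) t := by
        intro t ht
        have h3 : HasDerivAt (fun t : ℝ => t • x) x t := by
          simpa using (hasDerivAt_id t).smul_const x
        have h4 := (hdiff (t • x)).hasFDerivAt.comp_hasDerivAt t h3
        rw [hfz (t • x) ?_, zero_apply] at h4
        · exact h4.hasDerivWithinAt
        · rw [norm_smul, Real.norm_eq_abs, abs_of_pos (by linarith [ht.1])]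
          nlinarith [ht.1]
      have hcont : ContinuousOn (fun t : ℝ => mollify n w (t • x)) (Set.Icc 1 s) :=
        (hdiff.continuous.comp (by fun_prop)).continuousOn
      have h5 := constant_of_has_deriv_right_zero hcont hder s ⟨hs, le_rfl⟩
      simpa using h5
    have hC : ∀ s : ℝ, 1 < s → ‖mollify n w x‖ ≤ |C| / (s * ‖x‖ - 1) := by
      intro s hs
      have hsn : ‖s • x‖ = s * ‖x‖ := by
        rw [norm_smul, Real.norm_eq_abs, abs_of_pos (by linarith)]
      have hlt : ‖x‖ < s * ‖x‖ := by nlinarith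
      rw [← hray s hs.le]
      -- take bounds slightly inside
      have hb2 : ∀ ρ : ℝ, ‖x‖ - 1 < ρ → ρ + 1 < s * ‖x‖ → ‖mollify n w (s • x)‖ ≤ |C| / ρ := by
        intro ρ hρ1 hρ2
        have hρ0 : 0 < ρ := by
          have := le_max_right (max R₀ R) 0
          linarith
        refine norm_mollify_le n (R := ρ) ?_ (by rw [hsn]; exact hρ2)
        filter_upwards [hd] with y hy hyρ
        refine (hy (by linarith)).trans ?_
        refine (div_le_div_of_nonneg_right (le_abs_self C) (norm_nonneg _)).trans ?_
        exact div_le_div_of_nonneg_left (abs_nonneg _) hρ0 hyρ.le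
      have hρpos : s * ‖x‖ - 1 ≠ 0 := by
        have := le_max_right (max R₀ R) 0
        nlinarith
      have hlim : Tendsto (fun ρ : ℝ => |C| / ρ) (𝓝[<] (s * ‖x‖ - 1)) (𝓝 (|C| / (s * ‖x‖ - 1))) :=
        (tendsto_const_nhds.div tendsto_id hρpos).mono_left nhdsWithin_le_nhds
      refine ge_of_tendsto hlim ?_
      filter_upwards [Ioo_mem_nhdsLT (show ‖x‖ - 1 < s * ‖x‖ - 1 by linarith)] with ρ hρ
      exact hb2 ρ hρ.1 (by linarith [hρ.2])
    have hlim : Tendsto (fun s : ℝ => |C| / (s * ‖x‖ - 1)) atTop (𝓝 0) :=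
      tendsto_const_nhds.div_atTop
        (tendsto_atTop_add_const_right _ (-1) (tendsto_id.atTop_mul_const hxp))
    have := ge_of_tendsto hlim (by
      filter_upwards [eventually_gt_atTop 1] with s hs using hC s hs)
    exact norm_le_zero_iff.1 this
  filter_upwards [ae_tendsto_mollify hw.locL2.locallyIntegrable] with x hx hx'
  simp only [hmz _ x hx'] at hx
  exact (tendsto_nhds_unique hx tendsto_const_nhds)

end

/-! ### Transmission recursion, nonvanishing of p_22, and the far field. -/

section

open MeasureTheory Filter Topology MvPolynomial

/-! ### The transmission coefficients -/

/-- The interface matrix is the solution of the two equations, continuity of value and of flux, for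
the inner coefficients; the common factor p has been dropped. -/
lemma interface_conditions {k : ℕ} {sOut sIn ρ a b a' b' : ℝ} (hs : sIn ≠ 0) (hρ : ρ ≠ 0)
    (ha : a' = interfaceMatrix k sOut sIn ρ 0 0 * a + interfaceMatrix k sOut sIn ρ 0 1 * b)
    (hb : b' = interfaceMatrix k sOut sIn ρ 1 0 * a + interfaceMatrix k sOut sIn ρ 1 1 * b) :
    a + b * (ρ ^ (2 * k + 1))⁻¹ = a' + b' * (ρ ^ (2 * k + 1))⁻¹ ∧
    sOut * (k * a - (k + 1) * (b * (ρ ^ (2 * k + 1))⁻¹)) =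
      sIn * (k * a' - (k + 1) * (b' * (ρ ^ (2 * k + 1))⁻¹)) := by
  have hk : (2 * (k : ℝ) + 1) ≠ 0 := by positivity
  have hτ : ρ ^ (2 * k + 1) ≠ 0 := pow_ne_zero _ hρ
  subst ha hb
  simp only [interfaceMatrix, Matrix.smul_apply, Matrix.of_apply, Matrix.cons_val', Matrix.cons_val_zero,
    Matrix.cons_val_one, Matrix.cons_val_fin_one, smul_eq_mul]
  generalize ρ ^ (2 * k + 1) = τ at *
  constructor <;> field_simp <;> ring

/-- The coefficients of `r^k` and `r^{-(k+1)}` in the layers, for outer coefficients `a` and `b`. -/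
def layerCoeff (s r : ℕ → ℝ) (k : ℕ) (a b : ℝ) (i : Fin 2) (j : ℕ) : ℝ :=
  layerProduct s r k j i 0 * a + layerProduct s r k j i 1 * b

lemma layerCoeff_succ (s r : ℕ → ℝ) (k : ℕ) (a b : ℝ) (i : Fin 2) (j : ℕ) :
    layerCoeff s r k a b i (j + 1) =
      interfaceMatrix k (s j) (s (j + 1)) (r (j + 1)) i 0 * layerCoeff s r k a b 0 j +
      interfaceMatrix k (s j) (s (j + 1)) (r (j + 1)) i 1 * layerCoeff s r k a b 1 j := by
  simp only [layerCoeff, layerProduct, Matrix.mul_apply, Fin.sum_univ_two]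
  ring

lemma layerCoeff_conditions {s r : ℕ → ℝ} (k : ℕ) (a b : ℝ) {j : ℕ} (hs : s (j + 1) ≠ 0)
    (hr : r (j + 1) ≠ 0) :
    layerCoeff s r k a b 0 j + layerCoeff s r k a b 1 j * (r (j + 1) ^ (2 * k + 1))⁻¹ =
      layerCoeff s r k a b 0 (j + 1) +
        layerCoeff s r k a b 1 (j + 1) * (r (j + 1) ^ (2 * k + 1))⁻¹ ∧
    s j * (k * layerCoeff s r k a b 0 j -
        (k + 1) * (layerCoeff s r k a b 1 j * (r (j + 1) ^ (2 * k + 1))⁻¹)) =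
      s (j + 1) * (k * layerCoeff s r k a b 0 (j + 1) -
        (k + 1) * (layerCoeff s r k a b 1 (j + 1) * (r (j + 1) ^ (2 * k + 1))⁻¹)) :=
  interface_conditions hs hr (layerCoeff_succ s r k a b 0 j) (layerCoeff_succ s r k a b 1 j)

lemma layerCoeff_zero (s r : ℕ → ℝ) (k : ℕ) (a b : ℝ) :
    layerCoeff s r k a b 0 0 = a ∧ layerCoeff s r k a b 1 0 = b := by
  simp [layerCoeff, layerProduct]

/-- The data of the layered ball. -/
structure IsLayering (L : ℕ) (s r : ℕ → ℝ) : Prop where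
  s_zero : s 0 = 1
  s_pos : ∀ j, 1 ≤ j → j ≤ L → 0 < s j
  core_nonneg : 0 ≤ s (L + 1)
  core_radius_pos : 0 < r (L + 1)
  radius_lt : ∀ j, 1 ≤ j → j ≤ L → r (j + 1) < r j

namespace IsLayering

variable {L : ℕ} {s r : ℕ → ℝ}

lemma s_pos' (h : IsLayering L s r) {j : ℕ} (hj : j ≤ L) : 0 < s j := by
  rcases Nat.eq_zero_or_pos j with rfl | h0
  · rw [h.s_zero]; exact one_pos
  · exact h.s_pos j h0 hj

lemma s_nonneg (h : IsLayering L s r) {j : ℕ} (hj : j ≤ L + 1) : 0 ≤ s j := by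
  rcases Nat.lt_or_ge L j with h1 | h1
  · rw [show j = L + 1 by omega]; exact h.core_nonneg
  · exact (h.s_pos' h1).le

lemma radius_pos (h : IsLayering L s r) {j : ℕ} (hj : j ≤ L) : 0 < r (j + 1) :=
  h.core_radius_pos.trans_le (radius_antitone h.radius_lt (by omega) (by omega) le_rfl)

/-- Sign invariants of the decaying mode: value and flux have opposite signs. -/
lemma layerCoeff_signs (h : IsLayering L s r) (k : ℕ) {j : ℕ} (hj : j ≤ L) :
    0 < layerCoeff s r k 0 1 0 j + layerCoeff s r k 0 1 1 j * (r (j + 1) ^ (2 * k + 1))⁻¹ ∧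
    k * layerCoeff s r k 0 1 0 j -
      (k + 1) * (layerCoeff s r k 0 1 1 j * (r (j + 1) ^ (2 * k + 1))⁻¹) < 0 := by
  induction j with
  | zero =>
    obtain ⟨h1, h2⟩ := layerCoeff_zero s r k 0 1
    have := h.radius_pos hj
    rw [h1, h2]
    constructor
    · simp only [zero_add, one_mul]; positivity
    · have : 0 < ((k : ℝ) + 1) * (1 * (r (0 + 1) ^ (2 * k + 1))⁻¹) := by positivity
      linarith
  | succ j ih =>
    obtain ⟨i1, i2⟩ := ih (by omega)
    have hs1 := h.s_pos' hj
    have hs0 := h.s_pos' (show j ≤ L by omega)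
    have hr1 := h.radius_pos (show j ≤ L by omega)
    have hr2 := h.radius_pos hj
    obtain ⟨c1, c2⟩ := layerCoeff_conditions (s := s) (r := r) k 0 1 hs1.ne' hr1.ne'
    have hlt := h.radius_lt (j + 1) (by omega) hj
    have ht : (r (j + 1) ^ (2 * k + 1))⁻¹ ≤ (r (j + 1 + 1) ^ (2 * k + 1))⁻¹ := by
      gcongr
    have ht0 : 0 < (r (j + 1) ^ (2 * k + 1))⁻¹ := by positivity
    rw [c1] at i1
    have i3 : k * layerCoeff s r k 0 1 0 (j + 1) -
        (k + 1) * (layerCoeff s r k 0 1 1 (j + 1) * (r (j + 1) ^ (2 * k + 1))⁻¹) < 0 := by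
      have := mul_neg_of_pos_of_neg hs0 i2
      rw [c2] at this
      exact neg_of_mul_neg_right this hs1.le
    generalize layerCoeff s r k 0 1 0 (j + 1) = A at *
    generalize layerCoeff s r k 0 1 1 (j + 1) = B at *
    generalize (r (j + 1) ^ (2 * k + 1))⁻¹ = t at *
    generalize (r (j + 1 + 1) ^ (2 * k + 1))⁻¹ = t' at *
    have hk : (0 : ℝ) ≤ k := by positivity
    -- k times the value minus the flux equals (2k+1)Bt.
    have hB : 0 < B := by
      have : 0 < B * t := by nlinarith [mul_nonneg hk i1.le]
      exact pos_of_mul_pos_left this ht0.le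
    have hBt : B * t ≤ B * t' := by gcongr
    -- Moving inward from r_{j+1} to r_{j+2} only increases Bt, which raises the value and lowers
    -- the flux.
    constructor
    · linarith
    · nlinarith [mul_nonneg hk (sub_nonneg.2 hBt)]

lemma transferMatrix_apply_of_eq_zero (hs : s (L + 1) = 0) (k : ℕ) (a b : ℝ) :
    transferMatrix L s r k 1 0 * a + transferMatrix L s r k 1 1 * b =
      -(k * r (L + 1) ^ (2 * k + 1)) * layerCoeff s r k a b 0 L +
        (k + 1) * layerCoeff s r k a b 1 L := by
  rw [transferMatrix, if_pos hs]
  simp only [Matrix.mul_apply, Fin.sum_univ_two, insulatingMatrix, layerCoeff, Matrix.of_apply,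
    Matrix.cons_val', Matrix.cons_val_zero, Matrix.cons_val_one, Matrix.cons_val_fin_one]
  ring

lemma transferMatrix_apply_of_ne_zero (hs : s (L + 1) ≠ 0) (k : ℕ) (a b : ℝ) :
    transferMatrix L s r k 1 0 * a + transferMatrix L s r k 1 1 * b =
      layerCoeff s r k a b 1 (L + 1) := by
  rw [transferMatrix, if_neg hs]
  rfl

/-- If p_22 = 0, the mode with outer coefficients (0, 1) would meet the core condition. In a
conducting core it would be A r^k, whose flux kA does not have the sign opposite to its value A; an
insulating core would require zero flux. Both contradict `layerCoeff_signs`. -/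
lemma transferMatrix_ne_zero (h : IsLayering L s r) (k : ℕ) : transferMatrix L s r k 1 1 ≠ 0 := by
  obtain ⟨i1, i2⟩ := h.layerCoeff_signs k le_rfl
  have hr1 := h.core_radius_pos
  have ht0 : 0 < (r (L + 1) ^ (2 * k + 1))⁻¹ := by positivity
  have hk : (0 : ℝ) ≤ k := by positivity
  have e : transferMatrix L s r k 1 1 =
      transferMatrix L s r k 1 0 * 0 + transferMatrix L s r k 1 1 * 1 := by ring
  by_cases hs : s (L + 1) = 0
  · have hτ : r (L + 1) ^ (2 * k + 1) * (r (L + 1) ^ (2 * k + 1))⁻¹ = 1 :=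
      mul_inv_cancel₀ (by positivity)
    rw [e, transferMatrix_apply_of_eq_zero hs]
    intro h0
    generalize layerCoeff s r k 0 1 0 L = A at *
    generalize layerCoeff s r k 0 1 1 L = B at *
    generalize (r (L + 1) ^ (2 * k + 1))⁻¹ = t at *
    refine i2.ne ?_
    linear_combination (-t) * h0 - k * A * hτ
  · have hs1 : 0 < s (L + 1) := lt_of_le_of_ne h.core_nonneg (Ne.symm hs)
    obtain ⟨c1, c2⟩ := layerCoeff_conditions (s := s) (r := r) k 0 1 hs hr1.ne'
    have hs0 := h.s_pos' le_rfl
    rw [e, transferMatrix_apply_of_ne_zero hs]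
    intro h0
    rw [c1, h0] at i1
    have := mul_neg_of_pos_of_neg hs0 i2
    rw [c2, h0] at this
    have h3 := neg_of_mul_neg_right this hs1.le
    nlinarith [mul_nonneg hk i1.le]

end IsLayering

/-- The amplitude of the outgoing multipole of degree `k` caused by a unit background field. -/
def modeCoeff (L : ℕ) (s r : ℕ → ℝ) (k : ℕ) : ℝ :=
  if k = 0 then 0 else -(transferMatrix L s r k 1 0 / transferMatrix L s r k 1 1)

namespace IsLayering

variable {L : ℕ} {s r : ℕ → ℝ}

/-- The outer coefficients are (1, β), where β is chosen so that the lower row of the transfer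
matrix annihilates them: no singular part in a conducting core, no flux into an insulating one. -/
lemma exists_transmission (h : IsLayering L s r) (k : ℕ) :
    ∃ a b : ℕ → ℝ, a 0 = 1 ∧ b 0 = modeCoeff L s r k ∧ b (L + 1) = 0 ∧
      (∀ j, j ≤ L → a j + b j * (r (j + 1) ^ (2 * k + 1))⁻¹ =
        a (j + 1) + b (j + 1) * (r (j + 1) ^ (2 * k + 1))⁻¹) ∧
      (∀ j, j ≤ L → s j * (k * a j - (k + 1) * (b j * (r (j + 1) ^ (2 * k + 1))⁻¹)) =
        s (j + 1) * (k * a (j + 1) - (k + 1) * (b (j + 1) * (r (j + 1) ^ (2 * k + 1))⁻¹))) := by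
  -- A constant background is itself a solution, in accordance with the value 0 of `modeCoeff` in
  -- degree 0.
  rcases Nat.eq_zero_or_pos k with rfl | hk
  · exact ⟨fun _ => 1, fun _ => 0, rfl, by simp [modeCoeff], rfl, by simp, by simp⟩
  have hne := h.transferMatrix_ne_zero k
  set β := modeCoeff L s r k with hβ
  have hzero : transferMatrix L s r k 1 0 * 1 + transferMatrix L s r k 1 1 * β = 0 := by
    rw [hβ, modeCoeff, if_neg hk.ne']
    field_simp
    ring
  set A := layerCoeff s r k 1 β 0 with hA
  set B := layerCoeff s r k 1 β 1 with hB
  obtain ⟨hA0, hB0⟩ := layerCoeff_zero s r k 1 β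
  have hcond : ∀ j, j + 1 ≤ L → _ := fun j hj => layerCoeff_conditions (s := s) (r := r) k 1 β
    (h.s_pos' hj).ne' (h.radius_pos (show j ≤ L by omega)).ne'
  by_cases hs : s (L + 1) = 0
  · rw [transferMatrix_apply_of_eq_zero hs] at hzero
    have hτ : r (L + 1) ^ (2 * k + 1) * (r (L + 1) ^ (2 * k + 1))⁻¹ = 1 :=
      mul_inv_cancel₀ (pow_ne_zero _ h.core_radius_pos.ne')
    -- In an insulating core the flux equation does not constrain the inner coefficients; the
    -- boundary value is continued by the regular mode alone.
    refine ⟨Function.update A (L + 1) (A L + B L * (r (L + 1) ^ (2 * k + 1))⁻¹),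
      Function.update B (L + 1) 0, by simpa using hA0, by simpa using hB0, by simp,
      fun j hj => ?_, fun j hj => ?_⟩
    · rw [Function.update_of_ne (by omega), Function.update_of_ne (by omega)]
      rcases Nat.lt_or_ge j L with hj' | hj'
      · rw [Function.update_of_ne (by omega), Function.update_of_ne (by omega)]
        exact (hcond j hj').1
      · obtain rfl : j = L := by omega
        simp
    · rw [Function.update_of_ne (by omega), Function.update_of_ne (by omega)]
      rcases Nat.lt_or_ge j L with hj' | hj'
      · rw [Function.update_of_ne (by omega), Function.update_of_ne (by omega)]
        exact (hcond j hj').2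
      · obtain rfl : j = L := by omega
        rw [hs, zero_mul]
        refine mul_eq_zero_of_right _ ?_
        linear_combination (-(r (j + 1) ^ (2 * k + 1))⁻¹) * hzero - k * A j * hτ
  · rw [transferMatrix_apply_of_ne_zero hs] at hzero
    have hcond' : ∀ j, j ≤ L → _ := fun j hj => layerCoeff_conditions (s := s) (r := r) k 1 β
      (show s (j + 1) ≠ 0 by
        rcases Nat.lt_or_ge j L with hj' | hj'
        · exact (h.s_pos' hj').ne'
        · obtain rfl : j = L := by omega
          exact hs) (h.radius_pos hj).ne'
    exact ⟨A, B, hA0, hB0, hzero, fun j hj => (hcond' j hj).1, fun j hj => (hcond' j hj).2⟩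

/-! ### Existence, uniqueness and the far field -/

lemma exists_mode (h : IsLayering L s r) {k : ℕ} {p : MvPolynomial (Fin 3) ℝ}
    (hp : p ∈ solidHarmonics k) :
    ∃ (u : E3 → ℝ) (g : E3 → E3), IsWeakSolution (conductivity L s r) u g ∧
      ∀ x, r 1 < ‖x‖ → u x =
        polyFun p x + modeCoeff L s r k * ((‖x‖ ^ (2 * k + 1))⁻¹ * polyFun p x) := by
  obtain ⟨a, b, ha, hb, hb', hD, hN⟩ := h.exists_transmission k
  refine ⟨_, _, isWeakSolution_layered h.core_radius_pos h.radius_lt hp hb' hD hN, fun x hx => ?_⟩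
  rw [layered_exterior h.radius_lt _ hx, multipole, ha, hb]
  ring

end IsLayering

lemma exists_bound_multipole {k : ℕ} {p : MvPolynomial (Fin 3) ℝ} (hp : p.IsHomogeneous k) :
    ∃ C : ℝ, ∀ x : E3, 1 < ‖x‖ → |(‖x‖ ^ (2 * k + 1))⁻¹ * polyFun p x| ≤ C / ‖x‖ := by
  obtain ⟨C, hC⟩ := (isCompact_sphere (0 : E3) 1).exists_bound_of_continuousOn
    (continuous_polyFun p).continuousOn
  refine ⟨C, fun x hx => ?_⟩
  have hn : 0 < ‖x‖ := by linarith
  have h1 : polyFun p x = ‖x‖ ^ k * polyFun p (‖x‖⁻¹ • x) := by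
    rw [← polyFun_smul_arg hp, smul_smul, mul_inv_cancel₀ hn.ne', one_smul]
  have h2 : |polyFun p (‖x‖⁻¹ • x)| ≤ C := hC _ (by
    simp [norm_smul, hn.ne'])
  have h3 : (‖x‖ ^ (2 * k + 1))⁻¹ * polyFun p x =
      (‖x‖ ^ k)⁻¹ * (polyFun p (‖x‖⁻¹ • x) / ‖x‖) := by
    rw [h1]
    field_simp
    ring
  have h4 : (‖x‖ ^ k)⁻¹ ≤ 1 := inv_le_one_of_one_le₀ (one_le_pow₀ hx.le)
  rw [h3, abs_mul, abs_div, abs_of_pos hn, abs_of_nonneg (by positivity)]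
  calc (‖x‖ ^ k)⁻¹ * (|polyFun p (‖x‖⁻¹ • x)| / ‖x‖)
      ≤ 1 * (C / ‖x‖) := by gcongr
    _ = C / ‖x‖ := one_mul _

/-- The far field caused by the background `∑_k p_k`, with `p_k` a solid harmonic of degree `k`. -/
def farField (L : ℕ) (s r : ℕ → ℝ) (t : Finset ℕ) (p : ℕ → MvPolynomial (Fin 3) ℝ) (x : E3) : ℝ :=
  ∑ k ∈ t, modeCoeff L s r k * ((‖x‖ ^ (2 * k + 1))⁻¹ * polyFun (p k) x)

namespace IsLayering

variable {L : ℕ} {s r : ℕ → ℝ}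

lemma exists_solution_farField (h : IsLayering L s r) (t : Finset ℕ)
    {p : ℕ → MvPolynomial (Fin 3) ℝ} (hp : ∀ k, p k ∈ solidHarmonics k) :
    ∃ u, IsSolution (conductivity L s r) (polyFun (∑ k ∈ t, p k)) u ∧
      ∀ x, r 1 < ‖x‖ → u x - polyFun (∑ k ∈ t, p k) x = farField L s r t p x := by
  choose u g hw hu using fun k => h.exists_mode (hp k)
  have hfar : ∀ x, r 1 < ‖x‖ →
      ∑ k ∈ t, u k x - polyFun (∑ k ∈ t, p k) x = farField L s r t p x := by
    intro x hx
    rw [polyFun_sum, ← Finset.sum_sub_distrib, farField]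
    exact Finset.sum_congr rfl fun k _ => by rw [hu k x hx]; ring
  refine ⟨fun x => ∑ k ∈ t, u k x, isSolution_iff.2 ⟨⟨_, isWeakSolution_sum t
    (aestronglyMeasurable_conductivity L s r) (abs_conductivity_le L s r) hw⟩, ?_⟩, hfar⟩
  choose C hC using fun k => exists_bound_multipole (mem_solidHarmonics.1 (hp k)).1
  refine ⟨∑ k ∈ t, |modeCoeff L s r k| * C k, max (r 1) 1, Eventually.of_forall fun x hx => ?_⟩
  rw [hfar x ((le_max_left _ _).trans_lt hx), farField, Finset.sum_div]
  refine (Finset.abs_sum_le_sum_abs _ _).trans (Finset.sum_le_sum fun k _ => ?_)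
  rw [abs_mul, mul_div_assoc]
  exact mul_le_mul_of_nonneg_left (hC k x ((le_max_right _ _).trans_lt hx)) (abs_nonneg _)

/-- Two solutions with the same background agree near infinity. -/
lemma ae_eq_of_isSolution (h : IsLayering L s r) {H u v : E3 → ℝ}
    (hu : IsSolution (conductivity L s r) H u) (hv : IsSolution (conductivity L s r) H v) :
    ∃ R : ℝ, ∀ᵐ x : E3, R < ‖x‖ → u x = v x := by
  obtain ⟨⟨g, hg⟩, C, R, hd⟩ := isSolution_iff.1 hu
  obtain ⟨⟨g', hg'⟩, C', R', hd'⟩ := isSolution_iff.1 hv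
  have hm := aestronglyMeasurable_conductivity L s r
  have hb := abs_conductivity_le L s r
  have hw := hg.add hm hb (hg'.const_mul (-1))
  obtain ⟨R'', hR''⟩ := hw.exists_ae_eq_zero hm hb
    (conductivity_nonneg r fun j hj => h.s_nonneg hj) (R₀ := r 1)
    (fun x hx => by rw [conductivity_exterior h.radius_lt hx, h.s_zero]; exact one_pos)
    (C := C + C') (R := max R R') (by
      filter_upwards [hd, hd'] with x h1 h2 hx
      have h3 := h1 ((le_max_left _ _).trans_lt hx)
      have h4 := h2 ((le_max_right _ _).trans_lt hx)
      rw [add_div]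
      calc |u x + -1 * v x| = |(u x - H x) - (v x - H x)| := by congr 1; ring
        _ ≤ _ := (abs_sub _ _).trans (add_le_add h3 h4))
  refine ⟨R'', ?_⟩
  filter_upwards [hR''] with x hx hx'
  linarith [hx hx']

/-- Uniqueness near infinity transfers the far field of the explicit solution to an arbitrary one,
so the expansion is a finite sum, exact beyond some radius. -/
lemma farField_of_isSolution (h : IsLayering L s r) {t : Finset ℕ}
    {p : ℕ → MvPolynomial (Fin 3) ℝ} (hp : ∀ k, p k ∈ solidHarmonics k) {u : E3 → ℝ}
    (hu : IsSolution (conductivity L s r) (polyFun (∑ k ∈ t, p k)) u) :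
    ∃ R : ℝ, ∀ᵐ x : E3, R < ‖x‖ →
      u x - polyFun (∑ k ∈ t, p k) x = farField L s r t p x := by
  obtain ⟨v, hv, hvf⟩ := h.exists_solution_farField t hp
  obtain ⟨R, hR⟩ := h.ae_eq_of_isSolution hu hv
  refine ⟨max R (r 1), ?_⟩
  filter_upwards [hR] with x hx hx'
  rw [hx ((le_max_left _ _).trans_lt hx'), hvf x ((le_max_right _ _).trans_lt hx')]

end IsLayering

end

/-! ### Reading off CGPTs and GPTs from the far field. -/

section

open MeasureTheory Filter Topology MvPolynomial

/-! ### Uniqueness of multipole expansions -/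

/-- Identity theorem: summability at 1/(N+1) gives a positive radius of convergence, and the zeros
1/(n+1) accumulate at 0. -/
lemma coeff_eq_zero_of_hasSum {c : ℕ → ℝ} {N : ℕ}
    (h : ∀ n : ℕ, N ≤ n → HasSum (fun m => c m * (1 / ((n : ℝ) + 1)) ^ m) 0) (m : ℕ) : c m = 0 := by
  set P := FormalMultilinearSeries.ofScalars ℝ c with hP
  have hrad : 0 < P.radius := by
    have h0 : (0 : ℝ) < 1 / ((N : ℝ) + 1) := by positivity
    let ρ : NNReal := ⟨1 / ((N : ℝ) + 1), h0.le⟩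
    have h1 : (ρ : ENNReal) ≤ P.radius := by
      refine P.le_radius_of_summable_norm ?_
      refine (h N le_rfl).summable.norm.congr fun n => ?_
      rw [hP, FormalMultilinearSeries.ofScalars_norm, norm_mul, norm_pow,
        Real.norm_of_nonneg h0.le]
      rfl
    refine lt_of_lt_of_le ?_ h1
    rw [ENNReal.coe_pos]
    exact h0
  have hps := (P.hasFPowerSeriesOnBall hrad).hasFPowerSeriesAt
  by_contra hm
  have hP0 : P ≠ 0 := fun h' => hm (by
    rw [hP, FormalMultilinearSeries.ofScalars_series_eq_zero] at h'
    rw [h']; rfl)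
  have hev := hps.locally_ne_zero hP0
  have ht : Tendsto (fun n : ℕ => 1 / ((n : ℝ) + 1)) atTop (𝓝[≠] 0) :=
    tendsto_nhdsWithin_iff.2 ⟨tendsto_one_div_add_atTop_nhds_zero_nat,
      Eventually.of_forall fun n => by
        have : (0 : ℝ) < 1 / ((n : ℝ) + 1) := by positivity
        exact this.ne'⟩
  obtain ⟨n, hn1, hn2⟩ := ((ht.eventually hev).and (eventually_ge_atTop N)).exists
  refine hn1 ?_
  have h3 := FormalMultilinearSeries.ofScalars_sum_eq c (1 / ((n : ℝ) + 1))
  exact h3.trans (h n hn2).tsum_eq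

lemma ae_smul {P : E3 → Prop} (hP : ∀ᵐ x : E3, P x) {c : ℝ} (hc : c ≠ 0) : ∀ᵐ x : E3, P (c • x) := by
  rw [ae_iff] at hP ⊢
  have h := Measure.addHaar_preimage_smul (volume : Measure E3) hc {x | ¬ P x}
  rw [hP, mul_zero] at h
  exact h

/-- A series of multipoles of increasing degrees that sums to zero near infinity is trivial. -/
lemma eq_zero_of_hasSum_multipole {q : ℕ → MvPolynomial (Fin 3) ℝ} (hq : ∀ m, (q m).IsHomogeneous m)
    {R : ℝ} (h : ∀ᵐ x : E3, R < ‖x‖ →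
      HasSum (fun m => (‖x‖ ^ (2 * m + 1))⁻¹ * polyFun (q m) x) 0) (m : ℕ) : q m = 0 := by
  -- The hypothesis holds only almost everywhere. Using countably many dilations, almost every x has
  -- all its multiples (n+1)x outside the exceptional set.
  have h1 : ∀ᵐ x : E3, ∀ n : ℕ, R < ‖((n : ℝ) + 1) • x‖ →
      HasSum (fun m => (‖((n : ℝ) + 1) • x‖ ^ (2 * m + 1))⁻¹ * polyFun (q m) (((n : ℝ) + 1) • x)) 0 :=
    ae_all_iff.2 fun n => ae_smul h (by positivity)
  have h2 : polyFun (q m) =ᵐ[volume] fun _ => 0 := by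
    filter_upwards [h1, ae_norm_ne 0] with x hx hx0
    have hn : 0 < ‖x‖ := lt_of_le_of_ne (norm_nonneg x) (Ne.symm hx0)
    obtain ⟨N, hN⟩ := exists_nat_gt (R / ‖x‖)
    have h3 := coeff_eq_zero_of_hasSum (c := fun m => (‖x‖ ^ (2 * m + 1))⁻¹ * polyFun (q m) x)
      (N := N) (fun n hn' => ?_) m
    · rcases mul_eq_zero.1 h3 with h4 | h4
      · exact absurd h4 (by positivity)
      · exact h4
    · have hp : (0 : ℝ) < (n : ℝ) + 1 := by positivity
      have hnorm : ‖((n : ℝ) + 1) • x‖ = ((n : ℝ) + 1) * ‖x‖ := by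
        rw [norm_smul, Real.norm_of_nonneg hp.le]
      have hR : R < ‖((n : ℝ) + 1) • x‖ := by
        rw [hnorm, ← div_lt_iff₀ hn]
        have : (N : ℝ) ≤ n := by exact_mod_cast hn'
        linarith
      -- At (n+1)x the term of degree m scales by (n+1)^{-(m+1)}; one factor n + 1 is removed to
      -- obtain a power series in 1/(n+1).
      have h5 := (hx n hR).mul_left ((n : ℝ) + 1)
      rw [mul_zero] at h5
      refine h5.congr_fun fun j => ?_
      simp only [hnorm, polyFun_smul_arg (hq j)]
      rw [mul_pow, one_div, inv_pow]
      field_simp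
      ring
  rw [Continuous.ae_eq_iff_eq _ (continuous_polyFun _) continuous_const] at h2
  refine MvPolynomial.funext fun y => ?_
  have h6 := congrFun h2 (WithLp.toLp 2 y)
  simpa [polyFun] using h6

/-! ### Backgrounds -/

/-- The homogeneous components of `background Y c K a`. -/
def backgroundPart (Y : HarmonicSystem) (c : ℝ) (a : (k : ℕ) → Order k → ℝ) (k : ℕ) :
    MvPolynomial (Fin 3) ℝ :=
  if k = 0 then C c else ∑ l : Order k, a k l • (Y k l : MvPolynomial (Fin 3) ℝ)

lemma C_mem_solidHarmonics (c : ℝ) : (C c : MvPolynomial (Fin 3) ℝ) ∈ solidHarmonics 0 :=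
  mem_solidHarmonics.2 ⟨isHomogeneous_C _ c, by simp [polyLaplacian_apply]⟩

lemma backgroundPart_mem (Y : HarmonicSystem) (c : ℝ) (a : (k : ℕ) → Order k → ℝ) (k : ℕ) :
    backgroundPart Y c a k ∈ solidHarmonics k := by
  unfold backgroundPart
  split_ifs with h
  · subst h; exact C_mem_solidHarmonics c
  · exact Submodule.sum_mem _ fun l _ => Submodule.smul_mem _ _ (Y k l).2

lemma range_succ_eq_insert (K : ℕ) : Finset.range (K + 1) = insert 0 (Finset.Icc 1 K) := by
  ext k
  simp only [Finset.mem_range, Finset.mem_insert, Finset.mem_Icc]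
  omega

lemma background_eq (Y : HarmonicSystem) (c : ℝ) (K : ℕ) (a : (k : ℕ) → Order k → ℝ) :
    background Y c K a = ∑ k ∈ Finset.range (K + 1), backgroundPart Y c a k := by
  rw [range_succ_eq_insert, Finset.sum_insert (by simp), background]
  congr 1
  refine Finset.sum_congr rfl fun k hk => ?_
  rw [Finset.mem_Icc] at hk
  rw [backgroundPart, if_neg (by omega)]

lemma sphericalHarmonic_div (Y : HarmonicSystem) (m : ℕ) (n : Order m) {x : E3} (hx : x ≠ 0) :
    sphericalHarmonic Y m n x / ‖x‖ ^ (m + 1) =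
      (‖x‖ ^ (2 * m + 1))⁻¹ * polyFun (Y m n : MvPolynomial (Fin 3) ℝ) x := by
  have hn : ‖x‖ ≠ 0 := norm_ne_zero_iff.2 hx
  rw [sphericalHarmonic, polyFun_smul_arg (mem_solidHarmonics.1 (Y m n).2).1, inv_pow]
  field_simp
  ring

lemma order_eq_iff {k : ℕ} (n l : Order k) : (n : ℤ) = (l : ℤ) ↔ n = l := Subtype.ext_iff.symm

/-- The multipole of degree `m` in the expansion defining the contracted GPTs. -/
lemma cgpt_term (Y : HarmonicSystem) (m : ℕ) (b : Order m → ℝ) {x : E3} (hx : x ≠ 0) :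
    ∑ n : Order m, sphericalHarmonic Y m n x / ((2 * (m : ℝ) + 1) * ‖x‖ ^ (m + 1)) * b n =
      (‖x‖ ^ (2 * m + 1))⁻¹ * polyFun
        (∑ n : Order m, (b n / (2 * (m : ℝ) + 1)) • (Y m n : MvPolynomial (Fin 3) ℝ)) x := by
  rw [polyFun_sum, Finset.mul_sum]
  refine Finset.sum_congr rfl fun n _ => ?_
  have hm : (2 * (m : ℝ) + 1) ≠ 0 := by positivity
  rw [polyFun_smul, mul_left_comm, ← sphericalHarmonic_div Y m n hx]
  have hn : ‖x‖ ≠ 0 := norm_ne_zero_iff.2 hx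
  field_simp

lemma ne_zero_of_lt_norm {R : ℝ} {x : E3} (hx : max R 0 < ‖x‖) : x ≠ 0 :=
  norm_pos_iff.1 ((le_max_right _ _).trans_lt hx)

namespace IsLayering

variable {L : ℕ} {s r : ℕ → ℝ}

/-- The contracted GPTs predicted by the transfer matrices. -/
lemma isCGPT_of_eq (h : IsLayering L s r) (Y : HarmonicSystem)
    {M : (m : ℕ) → Order m → (k : ℕ) → Order k → ℝ}
    (hM : ∀ m k : ℕ, 1 ≤ m → 1 ≤ k → ∀ (n : Order m) (l : Order k), M m n k l =
      if m = k ∧ (n : ℤ) = (l : ℤ) then (2 * (k : ℝ) + 1) * modeCoeff L s r k else 0) :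
    IsCGPT (conductivity L s r) Y M := by
  intro c K a u hu
  rw [background_eq] at hu ⊢
  obtain ⟨R, hR⟩ := h.farField_of_isSolution (backgroundPart_mem Y c a) hu
  refine ⟨max R 0, ?_⟩
  filter_upwards [hR] with x hx hx'
  have hx0 := ne_zero_of_lt_norm hx'
  rw [hx ((le_max_left _ _).trans_lt hx')]
  have hcoef : ∀ (i : ℕ) (n : Order (i + 1)),
      ∑ k ∈ Finset.Icc 1 K, ∑ l : Order k, M (i + 1) n k l * a k l =
        if i < K then (2 * ((i + 1 : ℕ) : ℝ) + 1) * modeCoeff L s r (i + 1) * a (i + 1) n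
        else 0 := by
    intro i n
    have hoff : ∀ k ∈ Finset.Icc 1 K, k ≠ i + 1 → ∑ l : Order k, M (i + 1) n k l * a k l = 0 := by
      intro k hk hki
      rw [Finset.mem_Icc] at hk
      refine Finset.sum_eq_zero fun l _ => ?_
      rw [hM _ _ (by omega) hk.1, if_neg (fun h' => hki h'.1.symm), zero_mul]
    by_cases hi : i < K
    · rw [if_pos hi, Finset.sum_eq_single (i + 1) hoff (fun h' => absurd (Finset.mem_Icc.2
        ⟨by omega, by omega⟩) h'), Finset.sum_eq_single n]
      · rw [hM _ _ (by omega) (by omega), if_pos ⟨rfl, rfl⟩]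
      · intro l _ hl
        rw [hM _ _ (by omega) (by omega), if_neg, zero_mul]
        rintro ⟨-, h'⟩
        exact hl ((order_eq_iff n l).1 h').symm
      · intro h'; exact absurd (Finset.mem_univ n) h'
    · rw [if_neg hi]
      refine Finset.sum_eq_zero fun k hk => hoff k hk ?_
      rw [Finset.mem_Icc] at hk
      omega
  have hterm : ∀ i : ℕ, (∑ n : Order (i + 1), sphericalHarmonic Y (i + 1) n x /
      ((2 * ((i + 1 : ℕ) : ℝ) + 1) * ‖x‖ ^ ((i + 1) + 1)) *
        ∑ k ∈ Finset.Icc 1 K, ∑ l : Order k, M (i + 1) n k l * a k l) =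
      if i < K then modeCoeff L s r (i + 1) *
        ((‖x‖ ^ (2 * (i + 1) + 1))⁻¹ * polyFun (backgroundPart Y c a (i + 1)) x) else 0 := by
    intro i
    simp only [hcoef]
    by_cases hi : i < K
    · simp only [if_pos hi]
      rw [cgpt_term Y (i + 1) _ hx0, backgroundPart, if_neg (by omega), mul_left_comm,
        ← polyFun_smul (modeCoeff L s r (i + 1)), Finset.smul_sum]
      congr 2
      refine Finset.sum_congr rfl fun n _ => ?_
      rw [smul_smul]
      congr 1
      have hm : (2 * ((i + 1 : ℕ) : ℝ) + 1) ≠ 0 := by positivity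
      field_simp
    · simp [hi]
  have hsum := hasSum_sum_of_ne_finset_zero (f := fun i : ℕ => ∑ n : Order (i + 1),
    sphericalHarmonic Y (i + 1) n x / ((2 * ((i + 1 : ℕ) : ℝ) + 1) * ‖x‖ ^ ((i + 1) + 1)) *
      ∑ k ∈ Finset.Icc 1 K, ∑ l : Order k, M (i + 1) n k l * a k l) (s := Finset.range K)
    (L := SummationFilter.unconditional ℕ) (fun i hi => by
      rw [hterm, if_neg (by simpa using hi)])
  convert hsum using 1
  -- The far field starts in degree 0 and the series of CGPTs in degree 1; the term of degree 0 is
  -- zero.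
  rw [farField, Finset.sum_range_succ', modeCoeff, if_pos rfl, zero_mul, add_zero]
  refine Finset.sum_congr rfl fun i hi => ?_
  rw [hterm, if_pos (by simpa using hi)]

/-- Take the single background r^k Y_k^l. The assumed expansion and the explicit far field must
agree degree by degree, and linear independence of the Y_m^n gives each entry. -/
lemma eq_of_isCGPT (h : IsLayering L s r) (Y : HarmonicSystem)
    {M : (m : ℕ) → Order m → (k : ℕ) → Order k → ℝ} (hM : IsCGPT (conductivity L s r) Y M)
    {m k : ℕ} (hm : 1 ≤ m) (hk : 1 ≤ k) (n : Order m) (l : Order k) : M m n k l =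
      if m = k ∧ (n : ℤ) = (l : ℤ) then (2 * (k : ℝ) + 1) * modeCoeff L s r k else 0 := by
  classical
  let a : (k' : ℕ) → Order k' → ℝ := fun k' l' => if k' = k ∧ (l' : ℤ) = (l : ℤ) then 1 else 0
  have hpart : ∀ k', backgroundPart Y 0 a k' =
      if k' = k then (Y k l : MvPolynomial (Fin 3) ℝ) else 0 := by
    intro k'
    unfold backgroundPart
    by_cases h0 : k' = 0
    · rw [if_pos h0, if_neg (by omega), C_0]
    · rw [if_neg h0]
      by_cases hkk : k' = k
      · subst hkk
        rw [if_pos rfl, Finset.sum_eq_single l]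
        · simp [a]
        · intro l' _ hl'
          have : ¬ ((l' : ℤ) = (l : ℤ)) := fun h' => hl' ((order_eq_iff l' l).1 h')
          simp [a, this]
        · intro h'; exact absurd (Finset.mem_univ l) h'
      · rw [if_neg hkk]
        exact Finset.sum_eq_zero fun l' _ => by simp [a, hkk]
  obtain ⟨u, hu, hfar⟩ := h.exists_solution_farField (Finset.range (k + 1))
    (backgroundPart_mem Y 0 a)
  have hu' : IsSolution (conductivity L s r) (polyFun (background Y 0 k a)) u := by
    rw [background_eq]; exact hu
  obtain ⟨R, hR⟩ := hM 0 k a u hu'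
  -- the degree `m` part of the difference of the two expansions
  let q : ℕ → MvPolynomial (Fin 3) ℝ := fun m => if m = 0 then 0 else
    ∑ n : Order m, (M m n k l / (2 * (m : ℝ) + 1)) • (Y m n : MvPolynomial (Fin 3) ℝ) -
      if m = k then modeCoeff L s r k • (Y k l : MvPolynomial (Fin 3) ℝ) else 0
  have hq : ∀ m, q m ∈ solidHarmonics m := by
    intro m
    simp only [q]
    split_ifs with h0 h1
    · exact Submodule.zero_mem _
    · subst h1
      exact Submodule.sub_mem _ (Submodule.sum_mem _ fun n _ => Submodule.smul_mem _ _ (Y m n).2)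
        (Submodule.smul_mem _ _ (Y m l).2)
    · rw [sub_zero]
      exact Submodule.sum_mem _ fun n _ => Submodule.smul_mem _ _ (Y m n).2
  have hsum : ∀ᵐ x : E3, max (max R (r 1)) 0 < ‖x‖ →
      HasSum (fun m => (‖x‖ ^ (2 * m + 1))⁻¹ * polyFun (q m) x) 0 := by
    filter_upwards [hR] with x hx hx'
    have hx0 := ne_zero_of_lt_norm hx'
    have hx1 := (le_max_left _ _).trans_lt hx'
    have h1 := hx ((le_max_left _ _).trans_lt hx1)
    rw [background_eq, hfar x ((le_max_right _ _).trans_lt hx1), farField] at h1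
    have h2 : ∀ (i : ℕ) (n : Order (i + 1)),
        ∑ k' ∈ Finset.Icc 1 k, ∑ l' : Order k', M (i + 1) n k' l' * a k' l' = M (i + 1) n k l := by
      intro i n
      rw [Finset.sum_eq_single k, Finset.sum_eq_single l]
      · simp [a]
      · intro l' _ hl'
        have : ¬ ((l' : ℤ) = (l : ℤ)) := fun h' => hl' ((order_eq_iff l' l).1 h')
        simp [a, this]
      · intro h'; exact absurd (Finset.mem_univ l) h'
      · intro k' _ hk'
        exact Finset.sum_eq_zero fun l' _ => by simp [a, hk']
      · intro h'; exact absurd (Finset.mem_Icc.2 ⟨hk, le_rfl⟩) h'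
    simp only [h2, hpart] at h1
    rw [Finset.sum_eq_single k (fun k' _ hk' => by simp [hk', polyFun_zero])
      (fun h' => absurd (Finset.mem_range.2 (by omega)) h'), if_pos rfl] at h1
    obtain ⟨k₀, rfl⟩ : ∃ k₀, k = k₀ + 1 := ⟨k - 1, by omega⟩
    have h3 := hasSum_ite_eq k₀ (modeCoeff L s r (k₀ + 1) *
      ((‖x‖ ^ (2 * (k₀ + 1) + 1))⁻¹ * polyFun (Y (k₀ + 1) l : MvPolynomial (Fin 3) ℝ) x))
    have h4 := h1.sub h3
    rw [sub_self] at h4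
    -- The index is shifted back by one, inserting the term q 0 = 0.
    have h5 := (hasSum_nat_add_iff (f := fun m => (‖x‖ ^ (2 * m + 1))⁻¹ * polyFun (q m) x)
      (g := 0) 1).1 (h4.congr_fun fun i => by
        rw [cgpt_term Y (i + 1) _ hx0]
        simp only [q, Nat.succ_ne_zero, if_false, polyFun_sub]
        by_cases hi : i = k₀
        · subst hi
          simp only [if_true, polyFun_smul]
          ring
        · have hi' : ¬ (i + 1 = k₀ + 1) := by omega
          simp [hi, polyFun_zero])
    simpa [q, polyFun_zero] using h5
  have hq0 := eq_zero_of_hasSum_multipole (fun m => (mem_solidHarmonics.1 (hq m)).1) hsum m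
  simp only [q, if_neg (show m ≠ 0 by omega)] at hq0
  have hli := (Y m).linearIndependent.map' (solidHarmonics m).subtype (Submodule.ker_subtype _)
  rw [Fintype.linearIndependent_iff] at hli
  have hm' : (2 * (m : ℝ) + 1) ≠ 0 := by positivity
  have hlin : M m n k l / (2 * (m : ℝ) + 1) -
      (if m = k ∧ (n : ℤ) = (l : ℤ) then modeCoeff L s r k else 0) = 0 := by
    refine hli (fun n : Order m => M m n k l / (2 * (m : ℝ) + 1) -
      (if m = k ∧ (n : ℤ) = (l : ℤ) then modeCoeff L s r k else 0)) ?_ n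
    simp only [Function.comp_apply, Submodule.subtype_apply, sub_smul, Finset.sum_sub_distrib]
    rw [← hq0]
    congr 1
    by_cases hmk : m = k
    · subst hmk
      rw [if_pos rfl, Finset.sum_eq_single l]
      · simp
      · intro l' _ hl'
        have : ¬ ((l' : ℤ) = (l : ℤ)) := fun h' => hl' ((order_eq_iff l' l).1 h')
        simp [this]
      · intro h'; exact absurd (Finset.mem_univ l) h'
    · rw [if_neg hmk]
      exact Finset.sum_eq_zero fun l' _ => by simp [hmk]
  rw [sub_eq_zero, div_eq_iff hm'] at hlin
  rw [hlin]
  split_ifs with hc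
  · rw [hc.1]; ring
  · ring

/-! ### Generalized polarization tensors -/

lemma sum_homogeneousComponent_range (H : MvPolynomial (Fin 3) ℝ) :
    ∑ k ∈ Finset.range (H.totalDegree + 1), homogeneousComponent k H = H :=
  sum_homogeneousComponent H

lemma exists_solution (h : IsLayering L s r) {H : MvPolynomial (Fin 3) ℝ}
    (hH : polyLaplacian H = 0) : ∃ u, IsSolution (conductivity L s r) (polyFun H) u := by
  obtain ⟨u, hu, -⟩ := h.exists_solution_farField (Finset.range (H.totalDegree + 1))
    (homogeneousComponent_mem_solidHarmonics hH)
  rw [sum_homogeneousComponent_range] at hu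
  exact ⟨u, hu⟩

/-- The layered ball has generalized polarization tensors. -/
lemma exists_isGPT (h : IsLayering L s r) : ∃ M, IsGPT (conductivity L s r) M := by
  classical
  set κ : ℝ := 1 / ((2 - 3) * (4 * Real.pi)) with hκ
  have hκ0 : κ ≠ 0 := by
    have := Real.pi_pos
    rw [hκ]
    exact one_div_ne_zero (mul_ne_zero (by norm_num) (by positivity))
  -- For the diagonal family α! d_{|α|}, the degree m part of the expansion is (-1)^m d_m p_m(∂)Γ,
  -- with p_m the component of H of degree m, hence (-1)^m d_m κ `kelvinConst m` times |x|^{-(2m+1)}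
  -- p_m. The constant d_m is chosen so that this factor is `modeCoeff`.
  let d : ℕ → ℝ := fun m => (-1) ^ m * modeCoeff L s r m / (κ * kelvinConst m)
  refine ⟨fun α β => if α = β then multiFactorial α * d α.degree else 0, ?_⟩
  intro H hH u hu
  have hp := homogeneousComponent_mem_solidHarmonics hH
  rw [← sum_homogeneousComponent_range H] at hu
  obtain ⟨R, hR⟩ := h.farField_of_isSolution hp hu
  rw [sum_homogeneousComponent_range] at hR
  refine ⟨max R 0, ?_⟩
  filter_upwards [hR] with x hx hx'
  have hx0 := ne_zero_of_lt_norm hx'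
  rw [hx ((le_max_left _ _).trans_lt hx')]
  have hterm : ∀ m : ℕ, (∑ α ∈ multiIndices m, ∑ β ∈ H.support,
      (-1) ^ m / (multiFactorial α : ℝ) * multiD α fundSol x *
        (if α = β then multiFactorial α * d α.degree else 0) * H.coeff β) =
      modeCoeff L s r m * ((‖x‖ ^ (2 * m + 1))⁻¹ * polyFun (homogeneousComponent m H) x) := by
    intro m
    have hk := congrArg (fun q => polyFun q x) (sum_coeff_smul_kelvinPoly (hp m))
    simp only [polyFun_sum, polyFun_smul] at hk
    have h1 : ∀ α ∈ multiIndices m, ∑ β ∈ H.support,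
        (-1) ^ m / (multiFactorial α : ℝ) * multiD α fundSol x *
          (if α = β then multiFactorial α * d α.degree else 0) * H.coeff β =
        (-1) ^ m * d m * κ * (‖x‖ ^ (2 * m + 1))⁻¹ *
          (coeff α (homogeneousComponent m H) * polyFun (kelvinPoly α) x) := by
      intro α hα
      rw [mem_multiIndices] at hα
      have hf : (multiFactorial α : ℝ) ≠ 0 := by exact_mod_cast (multiFactorial_pos α).ne'
      have h2 : ∀ β ∈ H.support, (-1) ^ m / (multiFactorial α : ℝ) * multiD α fundSol x *
          (if α = β then multiFactorial α * d α.degree else 0) * H.coeff β =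
          if α = β then (-1) ^ m * multiD α fundSol x * d α.degree * H.coeff α else 0 := by
        intro β _
        by_cases hb : α = β
        · subst hb
          simp only [if_true]
          field_simp
        · simp [hb]
      rw [Finset.sum_congr rfl h2, Finset.sum_ite_eq, coeff_homogeneousComponent, if_pos hα,
        multiD_fundSol α hx0, hα, ← hκ]
      by_cases hs : α ∈ H.support
      · rw [if_pos hs]; ring
      · rw [if_neg hs, notMem_support_iff.1 hs]; ring
    rw [Finset.sum_congr rfl h1, ← Finset.mul_sum, hk]
    have hc := kelvinConst_ne_zero m
    have hsq : ((-1 : ℝ) ^ m) * (-1) ^ m = 1 := by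
      rw [← mul_pow]; simp
    have hd : (-1) ^ m * d m * κ * kelvinConst m = modeCoeff L s r m := by
      simp only [d]
      field_simp
      linear_combination modeCoeff L s r m * hsq
    rw [← hd]
    ring
  have hsum := hasSum_sum_of_ne_finset_zero (f := fun m : ℕ => ∑ α ∈ multiIndices m,
    ∑ β ∈ H.support, (-1) ^ m / (multiFactorial α : ℝ) * multiD α fundSol x *
      (if α = β then multiFactorial α * d α.degree else 0) * H.coeff β)
    (s := Finset.range (H.totalDegree + 1)) (L := SummationFilter.unconditional ℕ) (fun m hm => by
      rw [hterm, homogeneousComponent_eq_zero m H (by simpa using hm), polyFun_zero, mul_zero,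
        mul_zero])
  convert hsum using 1
  rw [farField]
  exact Finset.sum_congr rfl fun m _ => (hterm m).symm

/-- The background r^k Y_k^l has zero far field, so for any family of GPTs each degree of its
multipole series vanishes. Fischer orthogonality then yields the contraction with every Y_m^n; no
condition on the degree m is needed. -/
lemma contraction_eq_zero (h : IsLayering L s r) (Y : HarmonicSystem)
    {M : (Fin 3 →₀ ℕ) → (Fin 3 →₀ ℕ) → ℝ} (hM : IsGPT (conductivity L s r) M) {k : ℕ}
    (hk : modeCoeff L s r k = 0) (m : ℕ) (n : Order m) (l : Order k) :
    contraction Y M m n k l = 0 := by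
  classical
  set H : MvPolynomial (Fin 3) ℝ := (Y k l : MvPolynomial (Fin 3) ℝ) with hHdef
  have hH := mem_solidHarmonics.1 (Y k l).2
  let p : ℕ → MvPolynomial (Fin 3) ℝ := fun j => if j = k then H else 0
  have hp : ∀ j, p j ∈ solidHarmonics j := by
    intro j
    simp only [p]
    split_ifs with hj
    · subst hj; exact (Y j l).2
    · exact Submodule.zero_mem _
  have hpH : ∑ j ∈ {k}, p j = H := by simp [p]
  obtain ⟨u, hu, hfar⟩ := h.exists_solution_farField {k} hp
  rw [hpH] at hu
  simp only [hpH] at hfar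
  obtain ⟨R, hR⟩ := hM H hH.2 u hu
  set κ : ℝ := 1 / ((2 - 3) * (4 * Real.pi)) with hκ
  have hκ0 : κ ≠ 0 := by
    have := Real.pi_pos
    rw [hκ]
    exact one_div_ne_zero (mul_ne_zero (by norm_num) (by positivity))
  -- The β-sum is carried out beforehand: w α is the weight of ∂^αΓ produced by this background, up
  -- to the factor (-1)^{|α|}/α!.
  let w : (Fin 3 →₀ ℕ) → ℝ := fun α => ∑ β ∈ H.support, M α β * H.coeff β
  let q : ℕ → MvPolynomial (Fin 3) ℝ := fun m =>
    ((-1) ^ m * κ) • ∑ α ∈ multiIndices m, (w α / multiFactorial α) • kelvinPoly α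
  have hq : ∀ m, (q m).IsHomogeneous m := by
    intro m
    refine (mem_solidHarmonics.1 (Submodule.smul_mem _ _ (Submodule.sum_mem _ fun α hα =>
      Submodule.smul_mem _ _ ?_))).1
    rw [← mem_multiIndices.1 hα]
    exact kelvinPoly_mem α
  have hsum : ∀ᵐ x : E3, max (max R (r 1)) 0 < ‖x‖ →
      HasSum (fun m => (‖x‖ ^ (2 * m + 1))⁻¹ * polyFun (q m) x) 0 := by
    filter_upwards [hR] with x hx hx'
    have hx0 := ne_zero_of_lt_norm hx'
    have hx1 := (le_max_left _ _).trans_lt hx'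
    have h1 := hx ((le_max_left _ _).trans_lt hx1)
    rw [hfar x ((le_max_right _ _).trans_lt hx1), farField, Finset.sum_singleton, hk, zero_mul] at h1
    refine h1.congr_fun fun j => ?_
    simp only [q, polyFun_smul, polyFun_sum, Finset.mul_sum]
    refine Finset.sum_congr rfl fun α hα => ?_
    rw [multiD_fundSol α hx0, mem_multiIndices.1 hα, ← hκ]
    simp only [w, Finset.sum_div, Finset.sum_mul, Finset.mul_sum]
    refine Finset.sum_congr rfl fun β _ => ?_
    ring
  have hq0 := eq_zero_of_hasSum_multipole hq hsum m
  have hne : ((-1 : ℝ) ^ m * κ) ≠ 0 := mul_ne_zero (pow_ne_zero _ (by norm_num)) hκ0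
  have hz := (smul_eq_zero.1 hq0).resolve_left hne
  have hc := sum_coeff_mul_eq_zero_of_kelvin hz (mem_solidHarmonics.1 (Y m n).2).2
  rw [contraction, ← hc]
  refine Finset.sum_congr rfl fun α _ => ?_
  simp only [w, Finset.mul_sum]
  refine (Finset.sum_subset (support_subset_multiIndices hH.1) fun β _ hβ => ?_).symm.trans
    (Finset.sum_congr rfl fun β _ => by ring)
  rw [notMem_support_iff.1 hβ]
  ring

end IsLayering

end

end Gpt

end

theorem proposition2p2 (L : ℕ) (s r : ℕ → ℝ)
    (hs0 : s 0 = 1)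
    (hs : ∀ j, 1 ≤ j → j ≤ L → 0 < s j)
    (hcore : 0 ≤ s (L + 1))
    (hr : 0 < r (L + 1))
    (hrr : ∀ j, 1 ≤ j → j ≤ L → r (j + 1) < r j)
    (Y : Gpt.HarmonicSystem) :
    -- the conductivity problem is solvable for every harmonic polynomial background field
    (∀ H : MvPolynomial (Fin 3) ℝ, Gpt.polyLaplacian H = 0 →
      ∃ u, Gpt.IsSolution (Gpt.conductivity L s r) (Gpt.polyFun H) u) ∧
    (∀ k, 1 ≤ k → Gpt.transferMatrix L s r k 1 1 ≠ 0) ∧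
    -- the contracted GPTs exist, are unique and diagonal, and are given by the matrices
    (∀ M : (m : ℕ) → Gpt.Order m → (k : ℕ) → Gpt.Order k → ℝ,
      Gpt.IsCGPT (Gpt.conductivity L s r) Y M ↔
        ∀ m k : ℕ, 1 ≤ m → 1 ≤ k → ∀ (n : Gpt.Order m) (l : Gpt.Order k),
          M m n k l =
            if m = k ∧ (n : ℤ) = (l : ℤ) then
              -(2 * (k : ℝ) + 1) *
                (Gpt.transferMatrix L s r k 1 0 / Gpt.transferMatrix L s r k 1 1)
            else 0) ∧
    -- vanishing of the lower left entries gives a GPT-vanishing structure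
    (∀ N : ℕ, (∀ k, 1 ≤ k → k ≤ N → Gpt.transferMatrix L s r k 1 0 = 0) →
      Gpt.IsGPTVanishing (Gpt.conductivity L s r) Y N ∧
      ∀ M, Gpt.IsCGPT (Gpt.conductivity L s r) Y M →
        ∀ m k : ℕ, 1 ≤ m → m ≤ N → 1 ≤ k → k ≤ N →
          ∀ (n : Gpt.Order m) (l : Gpt.Order k), M m n k l = 0) := by
  have h : Gpt.IsLayering L s r := ⟨hs0, hs, hcore, hr, hrr⟩
  have hβ : ∀ k : ℕ, 1 ≤ k → Gpt.modeCoeff L s r k =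
      -(Gpt.transferMatrix L s r k 1 0 / Gpt.transferMatrix L s r k 1 1) := fun k hk => by
    rw [Gpt.modeCoeff, if_neg (by omega)]
  have hcgpt : ∀ k : ℕ, 1 ≤ k → (2 * (k : ℝ) + 1) * Gpt.modeCoeff L s r k = -(2 * (k : ℝ) + 1) *
      (Gpt.transferMatrix L s r k 1 0 / Gpt.transferMatrix L s r k 1 1) := fun k hk => by
    rw [hβ k hk]; ring
  refine ⟨fun H hH => h.exists_solution hH, fun k _ => h.transferMatrix_ne_zero k,
    fun M => ⟨fun hM m k hm hk n l => ?_, fun hM => h.isCGPT_of_eq Y fun m k hm hk n l => ?_⟩,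
    fun N hN => ⟨⟨h.exists_isGPT, fun M hM m k _ _ hk hkN n l => ?_⟩,
      fun M hM m k hm _ hk hkN n l => ?_⟩⟩
  · rw [h.eq_of_isCGPT Y hM hm hk, hcgpt k hk]
  · rw [hM m k hm hk, hcgpt k hk]
  · refine h.contraction_eq_zero Y hM ?_ m n l
    rw [hβ k hk, hN k hk hkN, zero_div, neg_zero]
  · rw [h.eq_of_isCGPT Y hM hm hk, hβ k hk, hN k hk hkN, zero_div, neg_zero, mul_zero, ite_self]
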